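/- For a group $G$ let $\mathcal F(G)$ denote the set of isomorphism classes of finite quotients of $G$. An $n$-dimensional crystallographic group is a group isomorphic to a discrete, cocompact subgroup $\Gamma$ of the isometry group of Euclidean space $\mathbb E^n$; the point group $P$ of $\Gamma$ is the group of linear parts of elements of $\Gamma$, i.e. the quotient of $\Gamma$ by its subgroup of translations (which is isomorphic to $\mathbb Z^n$), and the group is symmorphic if $1\to\mathbb Z^n\to\Gamma\to P\to 1$ splits. Choosing a $\mathbb Z$-basis of the lattice of translations, one regards $P$ as a subgroup of $\mathrm{GL}_n(\mathbb Z)$; two such subgroups are in the same $\mathbb Q$-class if they are conjugate in $\mathrm{GL}_n(\mathbb Q)$. Let $\mathcal{CF}(G)$ be the set of conjugacy classes of finite subgroups of $G$, ordered by $[A]\le[B]$ iff $A\subseteq gBg^{-1}$ for some $g\in G$. A group is just infinite if it is infinite and all its proper quotients are finite. A group $G$ is profinitely rigid relative to a class $\mathcal C$ of groups if $G\in\mathcal C$ and every $K\in\mathcal C$ with $\mathcal F(K)=\mathcal F(G)$ is isomorphic to $G$; it is profinitely rigid in the absolute sense if this holds for $\mathcal C$ the class of finitely generated residually finite groups. **Proposition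 1.2.** Let $G$ be an $n$-dimensional crystallographic group and let $H$ be a finitely generated residually finite group with $\mathcal F(G)=\mathcal F(H)$. Then $H$ is an $n$-dimensional crystallographic group whose point group is isomorphic to the point group of $G$. In particular, if $G$ is profinitely rigid relative to the class of $n$-dimensional crystallographic groups, then $G$ is profinitely rigid in the absolute sense. Moreover: 1. $\mathcal{CF}(G)$ and $\mathcal{CF}(H)$ are isomorphic as partially ordered sets, by an isomorphism $\alpha$ such that $A\cong B$ whenever $\alpha([A])=[B]$; 2. $G$ is torsion-free if and only if $H$ is torsion-free; 3. $G$ has trivial centre if and only if $H$ has trivial centre; 4. $G$ is just infinite if and only if $H$ is just infinite; 5. $G^{\mathrm{ab}}\cong H^{\mathrm{ab}}$; 6. $G$ is symmorphic if and only if $H$ is symmorphic; 7. the point group of $G$ is in the same $\mathbb Q$-class as the point group of $H$. Here the point groups and the splitting may be taken with respect to any realizations of $G$ and $H$ as discrete cocompact groups of isometries of $\mathbb E^n$. -/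

import Mathlib

universe u v

/-! ### Finite quotients and profinite rigidity -/

/-- `G` and `H` have the same set of isomorphism classes of finite quotients. -/
def HasSameFiniteQuotients (G : Type u) [Group G] (H : Type v) [Group H] : Prop :=
  (∀ (N : Subgroup G) (_ : N.Normal), Finite (G ⧸ N) →
    ∃ (M : Subgroup H) (_ : M.Normal), Nonempty ((G ⧸ N) ≃* (H ⧸ M))) ∧
  (∀ (M : Subgroup H) (_ : M.Normal), Finite (H ⧸ M) →
    ∃ (N : Subgroup G) (_ : N.Normal), Nonempty ((H ⧸ M) ≃* (G ⧸ N)))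

/-- `G` is profinitely rigid relative to the class `C` of groups. -/
def ProfinitelyRigidRelativeTo (C : (K : Type u) → [Group K] → Prop)
    (G : Type u) [Group G] : Prop :=
  C G ∧ ∀ (K : Type u) [Group K], C K → HasSameFiniteQuotients G K → Nonempty (G ≃* K)

/-- `G` is profinitely rigid (in the absolute sense): it is finitely generated, residually finite,
and profinitely rigid among all finitely generated residually finite groups. -/
def ProfinitelyRigid (G : Type u) [Group G] : Prop :=
  ProfinitelyRigidRelativeTo (fun (K : Type u) [Group K] => Group.FG K ∧ Group.ResiduallyFinite K) G

/-! ### Conjugacy classes of finite subgroups -/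

/-- The finite subgroups of `G`. -/
abbrev FiniteSubgroup (G : Type u) [Group G] : Type u := {A : Subgroup G // Finite A}

/-- The subgroup `g A g⁻¹`. -/
def conjSubgroup {G : Type u} [Group G] (g : G) (A : Subgroup G) : Subgroup G :=
  A.map (MulAut.conj g).toMonoidHom

theorem conjSubgroup_one {G : Type u} [Group G] (A : Subgroup G) : conjSubgroup 1 A = A := by
  ext x
  simp [conjSubgroup, Subgroup.mem_map]

theorem conjSubgroup_mul {G : Type u} [Group G] (g h : G) (A : Subgroup G) :
    conjSubgroup (g * h) A = conjSubgroup g (conjSubgroup h A) := by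
  ext x
  simp [conjSubgroup, Subgroup.mem_map, mul_assoc]

theorem conjSubgroup_mono {G : Type u} [Group G] (g : G) {A B : Subgroup G} (h : A ≤ B) :
    conjSubgroup g A ≤ conjSubgroup g B := Subgroup.map_mono h

theorem card_conjSubgroup {G : Type u} [Group G] (g : G) (A : Subgroup G) :
    Nat.card (conjSubgroup g A) = Nat.card A :=
  (Nat.card_congr (A.equivMapOfInjective _ (MulAut.conj g).injective).toEquiv).symm

/-- Conjugacy of finite subgroups. -/
instance finiteSubgroupSetoid (G : Type u) [Group G] : Setoid (FiniteSubgroup G) where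
  r A B := ∃ g : G, A.1 = conjSubgroup g B.1
  iseqv :=
    { refl := fun A => ⟨1, (conjSubgroup_one A.1).symm⟩
      symm := by
        rintro A B ⟨g, h⟩
        exact ⟨g⁻¹, by rw [h, ← conjSubgroup_mul, inv_mul_cancel, conjSubgroup_one]⟩
      trans := by
        rintro A B C ⟨g, h⟩ ⟨k, h'⟩
        exact ⟨g * k, by rw [h, h', conjSubgroup_mul]⟩ }

/-- `CF(G)`: the conjugacy classes of finite subgroups of `G`. -/
def ConjFiniteSubgroups (G : Type u) [Group G] : Type u := Quotient (finiteSubgroupSetoid G)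

/-- The conjugacy class of a finite subgroup. -/
def ConjFiniteSubgroups.mk {G : Type u} [Group G] (A : FiniteSubgroup G) :
    ConjFiniteSubgroups G := Quotient.mk (finiteSubgroupSetoid G) A

/-- The order on `CF(G)`: `[A] ≤ [B]` if `A ⊆ g B g⁻¹` for some `g : G`. -/
instance conjFiniteSubgroupsOrder (G : Type u) [Group G] : PartialOrder (ConjFiniteSubgroups G) where
  le := Quotient.lift₂ (fun A B : FiniteSubgroup G => ∃ g : G, A.1 ≤ conjSubgroup g B.1) (by
    rintro A B A' B' ⟨a, ha⟩ ⟨b, hb⟩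
    refine propext ⟨?_, ?_⟩
    · rintro ⟨g, hg⟩
      refine ⟨a⁻¹ * g * b, ?_⟩
      have := conjSubgroup_mono a⁻¹ hg
      rwa [ha, hb, ← conjSubgroup_mul, ← conjSubgroup_mul, ← conjSubgroup_mul, inv_mul_cancel,
        conjSubgroup_one] at this
    · rintro ⟨g, hg⟩
      refine ⟨a * g * b⁻¹, ?_⟩
      have := conjSubgroup_mono a hg
      rwa [ha, hb, ← conjSubgroup_mul, inv_mul_cancel_right, conjSubgroup_mul])
  le_refl := by
    rintro ⟨A⟩
    exact ⟨1, (conjSubgroup_one A.1).ge⟩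
  le_trans := by
    rintro ⟨A⟩ ⟨B⟩ ⟨C⟩ ⟨g, hg⟩ ⟨k, hk⟩
    exact ⟨g * k, by rw [conjSubgroup_mul]; exact hg.trans (conjSubgroup_mono g hk)⟩
  le_antisymm := by
    rintro ⟨A, hA⟩ ⟨B, hB⟩ ⟨g, hg⟩ ⟨k, hk⟩
    refine Quotient.sound ⟨g, ?_⟩
    have hfin : Finite (conjSubgroup g B) :=
      Finite.of_equiv _ (B.equivMapOfInjective _ (MulAut.conj g).injective).toEquiv
    have hfin' : Finite (conjSubgroup k A) :=
      Finite.of_equiv _ (A.equivMapOfInjective _ (MulAut.conj k).injective).toEquiv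
    refine Subgroup.eq_of_le_of_card_ge hg ?_
    rw [card_conjSubgroup]
    have h := Nat.card_le_card_of_injective _ (Subgroup.inclusion_injective hk)
    rwa [card_conjSubgroup] at h

/-! ### Some group properties -/

/-- The only element of finite order is the identity. -/
def TorsionFreeGroup (G : Type u) [Group G] : Prop := ∀ g : G, IsOfFinOrder g → g = 1

/-- The centre is trivial. -/
def CentrelessGroup (G : Type u) [Group G] : Prop := Subgroup.center G = ⊥

/-- `G` is infinite, but all its proper quotients are finite. -/
def JustInfinite (G : Type u) [Group G] : Prop :=
  Infinite G ∧ ∀ N : Subgroup G, N.Normal → N ≠ ⊥ → Finite (G ⧸ N)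

/-! ### Crystallographic groups -/

/-- Euclidean space of dimension `n`. -/
abbrev ESpace (n : ℕ) : Type := EuclideanSpace ℝ (Fin n)

/-- The group of isometries of Euclidean space. -/
abbrev EIsom (n : ℕ) : Type := ESpace n ≃ᵢ ESpace n

/-- The usual topology of the isometry group, i.e. the topology of pointwise convergence
(which coincides on isometries with the compact-open topology). -/
noncomputable instance isometryTopology (n : ℕ) : TopologicalSpace (EIsom n) :=
  TopologicalSpace.induced (fun (γ : EIsom n) (x : ESpace n) => γ x) inferInstance

/-- `Γ` is a discrete and cocompact group of isometries; cocompact means that the translates of some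
compact set cover the space. -/
structure IsCrystallographic {n : ℕ} (Γ : Subgroup (EIsom n)) : Prop where
  discrete : DiscreteTopology Γ
  cocompact : ∃ K : Set (ESpace n), IsCompact K ∧ ∀ x, ∃ γ ∈ Γ, γ x ∈ K

/-- An (abstract) group is an `n`-dimensional crystallographic group if it is isomorphic to a
discrete cocompact group of isometries of `n`-dimensional Euclidean space. -/
def IsCrystallographicGroup (n : ℕ) (G : Type u) [Group G] : Prop :=
  ∃ Γ : Subgroup (EIsom n), IsCrystallographic Γ ∧ Nonempty (G ≃* Γ)

/-- The linear part `x ↦ f x - f 0` of an isometry `f`, as a homomorphism to the orthogonal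
group. -/
noncomputable def linearPart (n : ℕ) : EIsom n →* (ESpace n ≃ₗᵢ[ℝ] ESpace n) where
  toFun f := f.toRealLinearIsometryEquiv
  map_one' := by
    ext1 x
    simp
  map_mul' f g := by
    ext1 x
    have h := map_sub f.toRealLinearIsometryEquiv (g x) (g 0)
    simp only [IsometryEquiv.toRealLinearIsometryEquiv_apply] at h
    change f (g x) - f (g 0) = f (g x - g 0) - f 0
    rw [h]
    abel

/-- The point group of `Γ`: the group of the linear parts of its elements. It is the quotient of `Γ`
by the subgroup of its translations. -/
noncomputable def pointGroup {n : ℕ} (Γ : Subgroup (EIsom n)) :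
    Subgroup (ESpace n ≃ₗᵢ[ℝ] ESpace n) := Γ.map (linearPart n)

/-- The projection of `Γ` onto its point group. -/
noncomputable def toPointGroup {n : ℕ} (Γ : Subgroup (EIsom n)) : Γ →* pointGroup Γ :=
  (linearPart n).subgroupMap Γ

/-- The extension of the point group by the translations splits. -/
def IsSymmorphic {n : ℕ} (Γ : Subgroup (EIsom n)) : Prop :=
  ∃ s : pointGroup Γ →* Γ, (toPointGroup Γ).comp s = MonoidHom.id (pointGroup Γ)

/-- The lattice of translations: all vectors `v` such that the translation `x ↦ x + v` belongs
to `Γ`. -/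
def translationLattice {n : ℕ} (Γ : Subgroup (EIsom n)) : AddSubgroup (ESpace n) where
  carrier := {v | IsometryEquiv.addRight v ∈ Γ}
  zero_mem' := by
    have h : IsometryEquiv.addRight (0 : ESpace n) = 1 := by ext1 x; simp
    change _ ∈ Γ
    rw [h]
    exact Γ.one_mem
  add_mem' {v w} hv hw := by
    have h : IsometryEquiv.addRight (v + w) =
        IsometryEquiv.addRight w * IsometryEquiv.addRight v := by
      ext1 x
      simp [add_assoc]
    change _ ∈ Γ
    rw [h]
    exact Γ.mul_mem hw hv
  neg_mem' {v} hv := by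
    have h : IsometryEquiv.addRight (-v) = (IsometryEquiv.addRight v)⁻¹ := by
      rw [eq_inv_iff_mul_eq_one]
      ext1 x
      simp
    change _ ∈ Γ
    rw [h]
    exact Γ.inv_mem hv

/-- `P ≤ GL_n(ℤ)` is the point group of `Γ`, written in matrices with respect to some `ℤ`-basis of
the lattice of translations (so `P` is determined up to conjugation in `GL_n(ℤ)`). -/
def IsIntegralPointGroup {n : ℕ} (Γ : Subgroup (EIsom n))
    (P : Subgroup (Matrix.GeneralLinearGroup (Fin n) ℤ)) : Prop :=
  ∃ b : Module.Basis (Fin n) ℤ (translationLattice Γ),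
    ∀ M : Matrix.GeneralLinearGroup (Fin n) ℤ, M ∈ P ↔
      ∃ A ∈ pointGroup Γ, ∀ j : Fin n,
        A (b j : ESpace n) = ∑ i : Fin n, (M : Matrix (Fin n) (Fin n) ℤ) i j • (b i : ESpace n)

/-- Two subgroups of `GL_n(ℤ)` are in the same `ℚ`-class if they are conjugate in `GL_n(ℚ)`. -/
def InSameQClass {n : ℕ} (P P' : Subgroup (Matrix.GeneralLinearGroup (Fin n) ℤ)) : Prop :=
  ∃ X : Matrix.GeneralLinearGroup (Fin n) ℚ,
    P'.map (Matrix.GeneralLinearGroup.map (Int.castRingHom ℚ)) =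
      conjSubgroup X (P.map (Matrix.GeneralLinearGroup.map (Int.castRingHom ℚ)))

/-- The point groups of `Γ` and `Γ'` can be written as subgroups of `GL_n(ℤ)`, and whenever they are
so written, they are in the same `ℚ`-class. -/
def PointGroupsInSameQClass {n : ℕ} (Γ Γ' : Subgroup (EIsom n)) : Prop :=
  (∃ P, IsIntegralPointGroup Γ P) ∧ (∃ P', IsIntegralPointGroup Γ' P') ∧
    ∀ P P', IsIntegralPointGroup Γ P → IsIntegralPointGroup Γ' P' → InSameQClass P P'

universe w

/-! ### Bieberbach's first theorem -/

section Bieberbach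

open Filter Topology

/-! By Bieberbach's first theorem (`IsCrystallographic.lin_eq_one_of_linDev_le` is its core) the
translations form a lattice of rank n with finite quotient. Since they span the space, only
translations centralize them. So G contains a normal, self-centralizing copy L of ℤⁿ of finite
index. This is abstracted as `LatticeFrame`; L is unique (`LatticeFrame.lattice_eq`). Conversely
every group with such a subgroup is crystallographic (`LatticeFrame.isCrystallographicGroup`), so
the rest is algebra.

To find the lattice of H, compare G and H modulo the intersection of all kernels of homomorphisms to
a fixed finite group; these quotients are isomorphic (`HasSameFiniteQuotients.exists_homKernel`). A
pigeonhole argument gives one χ : H → G/L compatible with arbitrarily deep common quotients. Its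
kernel is abelian because H is residually finite, isomorphic to ℤⁿ because a finitely generated
abelian group A is determined by the groups A/mA, and self-centralizing because the action on L is
visible modulo every m. The outcome, `HasSameFiniteQuotients.exists_latticeFrame`, is for every m >
0 a common quotient F of G and H by the m-th multiples of their lattices, matching the lattices: a
`LatticeLink`.

Everything else follows from suitable choices of m. For m = 1, F is the point group P of both. For a
prime m not dividing |P|, averaging over P produces an injective equivariant map of lattices; this
gives the ℚ-class, and the centre (fixed vectors) and just infiniteness (invariant sublattices)
depend only on it. Since |P| annihilates the second cohomology of P, m = |P| suffices for splitting.
For m = N² with |P| dividing N, finite subgroups and their conjugacies lift through F by vanishing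
of classes in degrees 2 and 1. Using all m recovers the abelianization. -/

theorem Set.finite_of_bounded_of_separated {ι X : Type*} [PseudoMetricSpace X] [ProperSpace X]
    {S : Set ι} (f : ι → X) (hb : Bornology.IsBounded (f '' S)) {ε : ℝ} (hε : 0 < ε)
    (hsep : ∀ i ∈ S, ∀ j ∈ S, dist (f i) (f j) < ε → i = j) : S.Finite := by
  have htb : TotallyBounded (f '' S) := hb.isCompact_closure.totallyBounded.subset subset_closure
  obtain ⟨t, ht, hcov⟩ := Metric.totallyBounded_iff.1 htb (ε / 2) (by positivity)
  have h : ∀ i : ι, ∃ y, i ∈ S → y ∈ t ∧ dist (f i) y < ε / 2 := by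
    intro i
    by_cases hi : i ∈ S
    · have := hcov ⟨i, hi, rfl⟩
      simp only [Set.mem_iUnion, Metric.mem_ball] at this
      obtain ⟨y, hy, hd⟩ := this
      exact ⟨y, fun _ => ⟨hy, hd⟩⟩
    · exact ⟨f i, fun h => absurd h hi⟩
  choose y hy using h
  refine Set.Finite.of_finite_image (f := y) (ht.subset ?_) ?_
  · rintro _ ⟨i, hi, rfl⟩
    exact (hy i hi).1
  · intro i hi j hj hij
    refine hsep i hi j hj ?_
    have h1 := (hy i hi).2
    have h2 := (hy j hj).2
    rw [← hij] at h2
    have := dist_triangle_right (f i) (f j) (y i)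
    linarith

variable {n : ℕ}

/-- The linear part of an isometry, as a continuous linear map. -/
noncomputable def lin : EIsom n →* (ESpace n →L[ℝ] ESpace n) where
  toFun γ := (linearPart n γ).toContinuousLinearEquiv.toContinuousLinearMap
  map_one' := by
    ext1 x
    simp
  map_mul' f g := by
    ext1 x
    simp

theorem linearPart_apply (γ : EIsom n) (x : ESpace n) : linearPart n γ x = γ x - γ 0 :=
  IsometryEquiv.toRealLinearIsometryEquiv_apply γ x

theorem lin_eq_linearPart (γ : EIsom n) (x : ESpace n) : lin γ x = linearPart n γ x := rfl

theorem lin_apply (γ : EIsom n) (x : ESpace n) : lin γ x = γ x - γ 0 := linearPart_apply γ x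

theorem apply_eq_lin (γ : EIsom n) (x : ESpace n) : γ x = lin γ x + γ 0 := by
  rw [lin_apply, sub_add_cancel]

@[simp]
theorem norm_lin_apply (γ : EIsom n) (x : ESpace n) : ‖lin γ x‖ = ‖x‖ :=
  (linearPart n γ).norm_map x

theorem inner_lin_lin (γ : EIsom n) (x y : ESpace n) :
    inner ℝ (lin γ x) (lin γ y) = inner ℝ x y := (linearPart n γ).inner_map_map x y

theorem norm_lin_le (γ : EIsom n) : ‖lin γ‖ ≤ 1 :=
  ContinuousLinearMap.opNorm_le_bound _ zero_le_one fun x => by simp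

theorem EIsom.ext_lin {γ δ : EIsom n} (h : lin γ = lin δ) (h0 : γ 0 = δ 0) : γ = δ := by
  ext1 x
  rw [apply_eq_lin γ, apply_eq_lin δ, h, h0]

theorem lin_mul_lin_inv (γ : EIsom n) : lin γ * lin γ⁻¹ = 1 := by
  rw [← map_mul, mul_inv_cancel, map_one]

theorem lin_inv_mul_lin (γ : EIsom n) : lin γ⁻¹ * lin γ = 1 := by
  rw [← map_mul, inv_mul_cancel, map_one]

theorem norm_mul_lin (T : ESpace n →L[ℝ] ESpace n) (γ : EIsom n) : ‖T * lin γ‖ = ‖T‖ := by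
  apply le_antisymm
  · exact (norm_mul_le _ _).trans (mul_le_of_le_one_right (norm_nonneg _) (norm_lin_le γ))
  · have h : T = T * lin γ * lin γ⁻¹ := by rw [mul_assoc, lin_mul_lin_inv, mul_one]
    conv_lhs => rw [h]
    exact (norm_mul_le _ _).trans (mul_le_of_le_one_right (norm_nonneg _) (norm_lin_le _))

/-- The distance of the linear part of an isometry from the identity. -/
noncomputable def linDev (γ : EIsom n) : ℝ := ‖lin γ - 1‖

theorem linDev_nonneg (γ : EIsom n) : 0 ≤ linDev γ := norm_nonneg _

theorem linDev_eq_zero {γ : EIsom n} : linDev γ = 0 ↔ lin γ = 1 := by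
  rw [linDev, norm_eq_zero, sub_eq_zero]

theorem norm_lin_sub_le (γ : EIsom n) (x : ESpace n) : ‖lin γ x - x‖ ≤ linDev γ * ‖x‖ :=
  (lin γ - 1).le_opNorm x

theorem linDev_mul_inv (γ δ : EIsom n) : linDev (γ * δ⁻¹) = ‖lin γ - lin δ‖ := by
  rw [linDev, ← norm_mul_lin _ δ, sub_mul, one_mul, map_mul, mul_assoc, lin_inv_mul_lin, mul_one]

theorem linDev_commutator (α β : EIsom n) :
    linDev (α * β * α⁻¹ * β⁻¹) ≤ 2 * linDev α * linDev β := by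
  have h : α * β * α⁻¹ * β⁻¹ = (α * β) * (β * α)⁻¹ := by group
  rw [h, linDev_mul_inv, map_mul, map_mul]
  have h' : lin α * lin β - lin β * lin α =
      (lin α - 1) * (lin β - 1) - (lin β - 1) * (lin α - 1) := by
    simp only [sub_mul, mul_sub, one_mul, mul_one]
    abel
  rw [h']
  have h1 := norm_mul_le (lin α - 1) (lin β - 1)
  have h2 := norm_mul_le (lin β - 1) (lin α - 1)
  have h3 := norm_sub_le ((lin α - 1) * (lin β - 1)) ((lin β - 1) * (lin α - 1))
  unfold linDev
  linarith

/-- Let A be the linear part and w = Ab - b. As A is orthogonal, the inner product of Aw - w with Ab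
is -‖w‖², and Cauchy–Schwarz applies. Thus the relative displacement under A does not decrease from
b to w. -/
theorem norm_lin_sub_sq_le (γ : EIsom n) (b : ESpace n) :
    ‖lin γ b - b‖ ^ 2 ≤ ‖lin γ (lin γ b - b) - (lin γ b - b)‖ * ‖b‖ := by
  set w := lin γ b - b with hw
  have h : inner ℝ (lin γ w - w) (lin γ b) = -‖w‖ ^ 2 := by
    rw [← real_inner_self_eq_norm_sq, inner_sub_left, inner_lin_lin]
    nth_rw 4 [hw]
    rw [inner_sub_right]
    ring
  have h2 := abs_real_inner_le_norm (lin γ w - w) (lin γ b)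
  rw [h, norm_lin_apply, abs_neg, abs_of_nonneg (by positivity)] at h2
  exact h2

/-- Evaluate κβα = αβ at the origin. The main term is the displacement of β 0 by the linear part of
α; the rest is small when the linear parts of β and κ are near 1. -/
theorem commutator_apply_zero (α β : EIsom n) :
    (α * β * α⁻¹ * β⁻¹) 0 = (lin α (β 0) - β 0) +
      (-(lin (α * β * α⁻¹ * β⁻¹) (β 0) - β 0) - lin α (lin β (lin α⁻¹ (α 0)) - lin α⁻¹ (α 0))) := by
  set κ := α * β * α⁻¹ * β⁻¹ with hκ
  have h1 : κ (β (α 0)) = α (β 0) := by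
    change (κ * β * α) 0 = (α * β) 0
    rw [hκ]
    congr 1
    group
  have h2 : lin κ (lin β (α 0)) = lin α (lin β (lin α⁻¹ (α 0))) := by
    change (lin κ * lin β) (α 0) = (lin α * (lin β * lin α⁻¹)) (α 0)
    rw [← map_mul, ← map_mul, ← map_mul, hκ]
    congr 2
    group
  have h3 : lin α (lin α⁻¹ (α 0)) = α 0 := by
    change (lin α * lin α⁻¹) (α 0) = α 0
    rw [lin_mul_lin_inv]
    rfl
  rw [apply_eq_lin κ, apply_eq_lin β (α 0), map_add, h2, apply_eq_lin α (β 0)] at h1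
  rw [map_sub, h3]
  have h4 : κ 0 = lin α (β 0) + α 0 - (lin α (lin β (lin α⁻¹ (α 0))) + lin κ (β 0)) := by
    rw [← h1]; abel
  rw [h4]
  abel

/-- The displacement condition on β is inherited by the commutator, whose translation is nonzero and
shorter. The term `2 / c * linDev β` is slack: the commutator has at most half the deviation of β,
so half of the slack is released, and it pays for the error terms. -/
theorem commutator_estimate {α β : EIsom n} {c : ℝ} (hc : 0 < c) (hα : linDev α ≤ 1 / 4)
    (hb : β 0 ≠ 0) (hab : linDev β ≠ 0 → ‖α 0‖ ≤ ‖β 0‖)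
    (hS : (c + 2 / c * linDev β) * ‖β 0‖ ≤ ‖lin α (β 0) - β 0‖) :
    (α * β * α⁻¹ * β⁻¹) 0 ≠ 0 ∧ ‖(α * β * α⁻¹ * β⁻¹) 0‖ < ‖β 0‖ ∧
      (c + 2 / c * linDev (α * β * α⁻¹ * β⁻¹)) * ‖(α * β * α⁻¹ * β⁻¹) 0‖ ≤
        ‖lin α ((α * β * α⁻¹ * β⁻¹) 0) - (α * β * α⁻¹ * β⁻¹) 0‖ := by
  have hκ := commutator_apply_zero α β
  have hm := linDev_commutator α β
  set κ := α * β * α⁻¹ * β⁻¹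
  set w := lin α (β 0) - β 0 with hw
  set r := -(lin κ (β 0) - β 0) - lin α (lin β (lin α⁻¹ (α 0)) - lin α⁻¹ (α 0)) with hr
  have hμ := linDev_nonneg β
  have hμα := linDev_nonneg α
  set μ := linDev β
  have hx : 0 < ‖β 0‖ := norm_pos_iff.2 hb
  have hmκ : linDev κ ≤ μ / 2 := by nlinarith
  have hr' : ‖r‖ ≤ 3 / 2 * μ * ‖β 0‖ := by
    have h1 : ‖r‖ ≤ linDev κ * ‖β 0‖ + μ * ‖α 0‖ := by
      refine (norm_sub_le _ _).trans (add_le_add ?_ ?_)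
      · rw [norm_neg]
        exact norm_lin_sub_le κ _
      · rw [norm_lin_apply]
        refine (norm_lin_sub_le β _).trans ?_
        rw [norm_lin_apply]
    have h2 : μ * ‖α 0‖ ≤ μ * ‖β 0‖ := by
      by_cases h0 : μ = 0
      · simp [h0]
      · exact mul_le_mul_of_nonneg_left (hab h0) hμ
    nlinarith
  have hw1 : ‖w‖ ≤ 1 / 4 * ‖β 0‖ :=
    (norm_lin_sub_le α _).trans (mul_le_mul_of_nonneg_right hα hx.le)
  have hw2 := norm_lin_sub_sq_le α (β 0)
  rw [← hw] at hw2
  have hNκ : ‖lin α w - w‖ - 1 / 4 * ‖r‖ ≤ ‖lin α (κ 0) - κ 0‖ := by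
    have h1 : lin α (κ 0) - κ 0 = (lin α w - w) + (lin α r - r) := by
      rw [hκ, map_add]; abel
    have h2 : ‖lin α r - r‖ ≤ 1 / 4 * ‖r‖ :=
      (norm_lin_sub_le α _).trans (mul_le_mul_of_nonneg_right hα (norm_nonneg _))
    rw [h1]
    have := norm_sub_le ((lin α w - w) + (lin α r - r)) (lin α r - r)
    rw [add_sub_cancel_right] at this
    linarith
  have hy1 : ‖κ 0‖ ≤ ‖w‖ + ‖r‖ := by rw [hκ]; exact norm_add_le _ _
  have hy2 : ‖w‖ - ‖r‖ ≤ ‖κ 0‖ := by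
    have := norm_sub_le (w + r) r
    rw [add_sub_cancel_right] at this
    rw [hκ]
    linarith
  set x := ‖β 0‖
  -- Everything is homogeneous in x = ‖β 0‖: q is the relative displacement of β 0 under α, and 2ν
  -- is the slack.
  obtain ⟨q, hq⟩ : ∃ q, ‖w‖ = q * x := ⟨‖w‖ / x, by field_simp⟩
  set ν := μ / c with hν
  have hνc : μ = ν * c := by rw [hν]; field_simp
  have hν0 : 0 ≤ ν := by positivity
  have e1 : 2 / c * μ = 2 * ν := by rw [hν]; ring
  have e2 : 2 / c * linDev κ ≤ ν := by
    rw [hν, div_mul_eq_mul_div]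
    gcongr
    linarith
  rw [e1] at hS
  have hq1 : c + 2 * ν ≤ q := by
    rw [hq] at hS
    exact le_of_mul_le_mul_right hS hx
  have hq2 : q ≤ 1 / 4 := by
    rw [hq] at hw1
    exact le_of_mul_le_mul_right hw1 hx
  have hw3 : q * ‖w‖ ≤ ‖lin α w - w‖ := by
    rw [hq] at hw2 ⊢
    have : q * (q * x) * x ≤ ‖lin α w - w‖ * x := by nlinarith
    exact le_of_mul_le_mul_right this hx
  have hμν : μ ≤ ν / 4 := by rw [hνc]; nlinarith
  have hy3 : c * x ≤ ‖κ 0‖ := by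
    have : 0 ≤ (q - c - 3 / 2 * μ) * x := mul_nonneg (by linarith) hx.le
    linarith
  have hr2 : ‖r‖ ≤ 3 / 2 * ν * ‖κ 0‖ := by
    have : ν * (c * x) ≤ ν * ‖κ 0‖ := mul_le_mul_of_nonneg_left hy3 hν0
    calc ‖r‖ ≤ 3 / 2 * μ * x := hr'
      _ = 3 / 2 * (ν * (c * x)) := by rw [hνc]; ring
      _ ≤ 3 / 2 * ν * ‖κ 0‖ := by linarith
  have hy0 : 0 < ‖κ 0‖ := lt_of_lt_of_le (by positivity) hy3
  refine ⟨norm_pos_iff.1 hy0, ?_, ?_⟩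
  · have : 0 ≤ (1 / 4 - 2 * μ) * x := mul_nonneg (by linarith) hx.le
    linarith
  · have h1 : (c + 2 / c * linDev κ) * ‖κ 0‖ ≤ (c + ν) * ‖κ 0‖ :=
      mul_le_mul_of_nonneg_right (by linarith) hy0.le
    have h2 : q * (‖κ 0‖ - ‖r‖) ≤ q * ‖w‖ :=
      mul_le_mul_of_nonneg_left (by linarith) (by linarith)
    have h3 : q * ‖r‖ ≤ 1 / 4 * ‖r‖ := mul_le_mul_of_nonneg_right hq2 (norm_nonneg _)
    have h4 : (c + 2 * ν) * ‖κ 0‖ ≤ q * ‖κ 0‖ := mul_le_mul_of_nonneg_right hq1 hy0.le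
    have h5 : 0 ≤ ν * ‖κ 0‖ := mul_nonneg hν0 hy0.le
    linarith

end Bieberbach

section Bieberbach

open Filter Topology

variable {n : ℕ} {Γ : Subgroup (EIsom n)}

/-- A neighbourhood of 1 for pointwise convergence is controlled by finitely many points and radii;
ε is the least radius. -/
theorem IsCrystallographic.exists_separating (h : IsCrystallographic Γ) :
    ∃ (I : Finset (ESpace n)) (ε : ℝ), 0 < ε ∧
      ∀ γ ∈ Γ, (∀ x ∈ I, dist (γ x) x < ε) → γ = 1 := by
  have h1 : {(1 : Γ)} ∈ 𝓝 (1 : Γ) := by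
    have := h.discrete
    exact (isOpen_discrete _).mem_nhds rfl
  rw [nhds_induced, mem_comap] at h1
  obtain ⟨s, hs, hs1⟩ := h1
  rw [nhds_induced, mem_comap] at hs
  obtain ⟨t, ht, hts⟩ := hs
  rw [nhds_pi, Filter.mem_pi] at ht
  obtain ⟨I, hI, V, hV, hVt⟩ := ht
  have hball : ∀ x, ∃ ε > 0, Metric.ball x ε ⊆ V x := fun x => Metric.mem_nhds_iff.1 (hV x)
  choose e he hball using hball
  obtain ⟨ε, hε, hεI⟩ : ∃ ε > 0, ∀ x ∈ I, ε ≤ e x := by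
    by_cases hne : I.Nonempty
    · obtain ⟨x, -, hx⟩ := Set.exists_min_image I e hI hne
      exact ⟨e x, he x, hx⟩
    · exact ⟨1, one_pos, fun x hx => absurd ⟨x, hx⟩ hne⟩
  refine ⟨hI.toFinset, ε, hε, fun γ hγ hd => ?_⟩
  have hmem : (⟨γ, hγ⟩ : Γ) ∈ ({1} : Set Γ) := by
    apply hs1
    apply hts
    apply hVt
    intro x hx
    exact hball x (Metric.mem_ball.2 ((hd x (hI.mem_toFinset.2 hx)).trans_le (hεI x hx)))
  exact congrArg Subtype.val hmem

/-- Evaluation on the finite separating set is bounded when ‖γ 0‖ is, and left invariance makes its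
values uniformly separated. -/
theorem IsCrystallographic.finite_norm_le (h : IsCrystallographic Γ) (R : ℝ) :
    {γ : EIsom n | γ ∈ Γ ∧ ‖γ 0‖ ≤ R}.Finite := by
  obtain ⟨I, ε, hε, hI⟩ := h.exists_separating
  refine Set.finite_of_bounded_of_separated (fun γ (x : I) => γ x) ?_ hε ?_
  · rw [Bornology.forall_isBounded_image_eval_iff.symm]
    intro x
    refine (Metric.isBounded_closedBall (x := (0 : ESpace n)) (r := ‖(x : ESpace n)‖ + R)).subset ?_
    rintro _ ⟨_, ⟨γ, hγ, rfl⟩, rfl⟩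
    rw [mem_closedBall_zero_iff]
    change ‖γ x‖ ≤ _
    rw [apply_eq_lin]
    refine (norm_add_le _ _).trans ?_
    rw [norm_lin_apply]
    linarith [hγ.2]
  · intro γ hγ δ hδ hd
    rw [dist_pi_lt_iff hε] at hd
    refine (inv_mul_eq_one.1 (hI (δ⁻¹ * γ) (Γ.mul_mem (Γ.inv_mem hδ.1) hγ.1) fun x hx => ?_)).symm
    have h1 : dist ((δ⁻¹ * γ) x) x = dist (γ x) (δ x) := by
      rw [← δ.dist_eq]
      change dist ((δ * (δ⁻¹ * γ)) x) _ = _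
      rw [mul_inv_cancel_left]
    rw [h1]
    exact hd ⟨x, hx⟩

theorem IsCrystallographic.exists_min_norm (h : IsCrystallographic Γ) {S : Set (EIsom n)}
    (hS : S ⊆ Γ) (hne : S.Nonempty) : ∃ γ ∈ S, ∀ δ ∈ S, ‖γ 0‖ ≤ ‖δ 0‖ := by
  obtain ⟨s, hs⟩ := hne
  obtain ⟨γ, hγ, hmin⟩ := Set.exists_min_image {γ : EIsom n | γ ∈ S ∧ ‖γ 0‖ ≤ ‖s 0‖}
    (fun γ => ‖γ 0‖) ((h.finite_norm_le ‖s 0‖).subset fun γ hγ => ⟨hS hγ.1, hγ.2⟩) ⟨s, hs, le_rfl⟩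
  refine ⟨γ, hγ.1, fun δ hδ => ?_⟩
  rcases le_total ‖δ 0‖ ‖s 0‖ with h1 | h1
  · exact hmin δ ⟨hδ, h1⟩
  · exact hγ.2.trans h1

theorem IsCrystallographic.exists_orbit_near (h : IsCrystallographic Γ) :
    ∃ D : ℝ, ∀ x, ∃ γ ∈ Γ, ‖γ 0 - x‖ ≤ D := by
  obtain ⟨K, hK, hcov⟩ := h.cocompact
  obtain ⟨D, hD⟩ := hK.isBounded.exists_norm_le
  refine ⟨D, fun x => ?_⟩
  obtain ⟨γ, hγ, hx⟩ := hcov x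
  refine ⟨γ⁻¹, Γ.inv_mem hγ, ?_⟩
  rw [← dist_eq_norm, ← γ.dist_eq]
  change dist ((γ * γ⁻¹) 0) _ ≤ D
  rw [mul_inv_cancel]
  simpa using hD _ hx

theorem isBounded_lin (S : Set (EIsom n)) : Bornology.IsBounded (lin '' S) :=
  (Metric.isBounded_closedBall (x := (0 : ESpace n →L[ℝ] ESpace n)) (r := 1)).subset (by
    rintro _ ⟨γ, -, rfl⟩
    rw [mem_closedBall_zero_iff]
    exact norm_lin_le γ)

/-- Take elements moving 0 near ku, pass to a subsequence with convergent linear parts, and divide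
by one fixed late term: the linear parts nearly cancel and the translation changes by a bounded
amount. -/
theorem IsCrystallographic.exists_direction (h : IsCrystallographic Γ) (u : ESpace n) {ε : ℝ}
    (hε : 0 < ε) : ∃ D : ℝ, ∀ T : ℝ, ∃ β ∈ Γ, linDev β ≤ ε ∧ ∃ t ≥ T, ‖β 0 - t • u‖ ≤ D := by
  obtain ⟨D, hD⟩ := h.exists_orbit_near
  choose γ hγ hγu using fun k : ℕ => hD ((k : ℝ) • u)
  obtain ⟨A, -, φ, hφ, hlim⟩ := tendsto_subseq_of_bounded (isBounded_lin (Set.range γ))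
    (x := fun k => lin (γ k)) fun k => ⟨_, ⟨k, rfl⟩, rfl⟩
  obtain ⟨k₀, hk₀⟩ := Metric.tendsto_atTop.1 hlim (ε / 2) (by positivity)
  refine ⟨D + ‖γ (φ k₀) 0‖, fun T => ?_⟩
  obtain ⟨k₁, hk₁⟩ := exists_nat_ge T
  set k := max k₀ k₁
  refine ⟨γ (φ k) * (γ (φ k₀))⁻¹, Γ.mul_mem (hγ _) (Γ.inv_mem (hγ _)), ?_, (φ k : ℕ), ?_, ?_⟩
  · rw [linDev_mul_inv, ← dist_eq_norm]
    have h1 := hk₀ k (le_max_left _ _)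
    have h2 := hk₀ k₀ le_rfl
    have := dist_triangle_right (lin (γ (φ k))) (lin (γ (φ k₀))) A
    simp only [Function.comp] at h1 h2
    linarith
  · refine hk₁.trans ?_
    exact_mod_cast (le_max_right k₀ k₁).trans hφ.le_apply
  · set a := γ (φ k)
    set b := γ (φ k₀)
    have h1 : dist ((a * b⁻¹) 0) (a 0) ≤ ‖b 0‖ := by
      change dist (a (b⁻¹ 0)) (a 0) ≤ _
      rw [a.dist_eq, ← b.dist_eq]
      change dist ((b * b⁻¹) 0) _ ≤ _
      rw [mul_inv_cancel]
      simp
    have h2 := hγu (φ k)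
    rw [← dist_eq_norm] at h2 ⊢
    have := dist_triangle ((a * b⁻¹) 0) (a 0) (((φ k : ℕ) : ℝ) • u)
    linarith

/-- Double minimality: α has the shortest translation among counterexamples, β the shortest among
elements which α displaces enough relative to their own deviation. The commutator of α and β
contradicts the choice of β. -/
theorem IsCrystallographic.lin_eq_one_of_linDev_le (h : IsCrystallographic Γ) {γ : EIsom n}
    (hγ : γ ∈ Γ) (hd : linDev γ ≤ 1 / 4) : lin γ = 1 := by
  by_contra hne
  obtain ⟨α, ⟨hαΓ, hα, hα1⟩, hmin⟩ := h.exists_min_norm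
    (S := {γ | γ ∈ Γ ∧ linDev γ ≤ 1 / 4 ∧ linDev γ ≠ 0}) (fun γ hγ => hγ.1)
    ⟨γ, hγ, hd, fun h0 => hne (linDev_eq_zero.1 h0)⟩
  obtain ⟨u, hu⟩ : ∃ u, lin α u - u ≠ 0 := by
    by_contra! hcon
    apply hα1
    rw [linDev_eq_zero]
    ext1 x
    exact sub_eq_zero.1 (hcon x)
  have hu0 : u ≠ 0 := by
    rintro rfl
    simp at hu
  have hup : 0 < ‖u‖ := norm_pos_iff.2 hu0
  have hNu : 0 < ‖lin α u - u‖ := norm_pos_iff.2 hu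
  -- Half of the relative displacement of u, which leaves room for the slack and for the bounded
  -- error D.
  set c := ‖lin α u - u‖ / (2 * ‖u‖) with hc
  have hc0 : 0 < c := by positivity
  have hcu : ‖lin α u - u‖ = 2 * c * ‖u‖ := by rw [hc]; field_simp
  have hc4 : c ≤ 1 / 8 := by
    have := (norm_lin_sub_le α u).trans (mul_le_mul_of_nonneg_right hα hup.le)
    rw [hcu] at this
    have := le_of_mul_le_mul_right this hup
    linarith
  obtain ⟨β, ⟨hβΓ, hβ0, hβ⟩, hβmin⟩ := h.exists_min_norm
    (S := {β | β ∈ Γ ∧ β 0 ≠ 0 ∧ (c + 2 / c * linDev β) * ‖β 0‖ ≤ ‖lin α (β 0) - β 0‖})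
    (fun β hβ => hβ.1) (by
      obtain ⟨D, hD⟩ := h.exists_direction u (ε := c ^ 2 / 8) (by positivity)
      -- The bound c²/8 makes the slack at most c/4; the threshold for t makes D negligible against
      -- the gap between 5c/4 and 2c.
      obtain ⟨β, hβ, hdev, t, ht, htu⟩ := hD (max (2 * (D + 1) / (c * ‖u‖)) 1)
      have hD0 : 0 ≤ D := (norm_nonneg _).trans htu
      have ht0 : 0 < t := lt_of_lt_of_le one_pos ((le_max_right _ _).trans ht)
      have ht1 : 2 * (D + 1) ≤ t * (c * ‖u‖) := by
        rw [← div_le_iff₀ (by positivity)]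
        exact (le_max_left _ _).trans ht
      set e := β 0 - t • u with he
      have hβe : β 0 = t • u + e := by rw [he]; abel
      have hn1 : ‖β 0‖ ≤ t * ‖u‖ + D := by
        rw [hβe]
        refine (norm_add_le _ _).trans ?_
        rw [norm_smul, Real.norm_of_nonneg ht0.le]
        linarith
      have hn2 : t * (2 * c * ‖u‖) - D / 4 ≤ ‖lin α (β 0) - β 0‖ := by
        have h1 : lin α (β 0) - β 0 = t • (lin α u - u) + (lin α e - e) := by
          rw [hβe, map_add, map_smul, smul_sub]; abel
        have h2 : ‖lin α e - e‖ ≤ 1 / 4 * D :=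
          (norm_lin_sub_le α _).trans
            (mul_le_mul hα htu (norm_nonneg _) (by norm_num))
        have h3 := norm_sub_le (t • (lin α u - u) + (lin α e - e)) (lin α e - e)
        rw [add_sub_cancel_right, norm_smul, Real.norm_of_nonneg ht0.le, hcu] at h3
        rw [h1]
        linarith
      refine ⟨β, hβ, ?_, ?_⟩
      · intro h0
        rw [h0] at hn2
        simp only [map_zero, sub_zero, norm_zero] at hn2
        linarith
      · have h1 : 2 / c * linDev β ≤ c / 4 := by
          calc 2 / c * linDev β ≤ 2 / c * (c ^ 2 / 8) := by gcongr
            _ = c / 4 := by field_simp; ring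
        calc (c + 2 / c * linDev β) * ‖β 0‖ ≤ (5 / 4 * c) * (t * ‖u‖ + D) := by
              gcongr
              linarith
          _ ≤ t * (2 * c * ‖u‖) - D / 4 := by nlinarith
          _ ≤ _ := hn2)
  -- So β, unless it is a translation, competes with α, whose minimality bounds ‖α 0‖ by ‖β 0‖.
  have hβdev : linDev β ≤ 1 / 4 := by
    have h1 := hβ.trans ((norm_lin_sub_le α _).trans
      (mul_le_mul_of_nonneg_right hα (norm_nonneg _)))
    have h2 := le_of_mul_le_mul_right h1 (norm_pos_iff.2 hβ0)
    have h3 : 1 * linDev β ≤ 2 / c * linDev β := by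
      refine mul_le_mul_of_nonneg_right ?_ (linDev_nonneg _)
      rw [le_div_iff₀ hc0]
      linarith
    linarith
  obtain ⟨h1, h2, h3⟩ := commutator_estimate hc0 hα hβ0
    (fun h0 => hmin β ⟨hβΓ, hβdev, h0⟩) hβ
  exact absurd (hβmin _ ⟨Γ.mul_mem (Γ.mul_mem (Γ.mul_mem hαΓ hβΓ) (Γ.inv_mem hαΓ))
    (Γ.inv_mem hβΓ), h1, h3⟩) (not_le.2 h2)

theorem IsCrystallographic.finite_lin (h : IsCrystallographic Γ) :
    (lin '' (Γ : Set (EIsom n))).Finite := by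
  refine Set.finite_of_bounded_of_separated id (by simpa using isBounded_lin _)
    (ε := 1 / 4) (by norm_num) ?_
  rintro _ ⟨γ, hγ, rfl⟩ _ ⟨δ, hδ, rfl⟩ hd
  have h1 := h.lin_eq_one_of_linDev_le (Γ.mul_mem hγ (Γ.inv_mem hδ)) (by
    rw [linDev_mul_inv, ← dist_eq_norm]
    exact hd.le)
  rw [map_mul] at h1
  calc lin γ = lin γ * lin δ⁻¹ * lin δ := by rw [mul_assoc, lin_inv_mul_lin, mul_one]
    _ = lin δ := by rw [h1, one_mul]

theorem mem_translationLattice {v : ESpace n} :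
    v ∈ translationLattice Γ ↔ IsometryEquiv.addRight v ∈ Γ := Iff.rfl

theorem lin_addRight (v : ESpace n) : lin (IsometryEquiv.addRight v) = 1 := by
  ext1 x
  rw [lin_apply]
  simp

theorem eq_addRight_of_lin_eq_one {γ : EIsom n} (h : lin γ = 1) :
    γ = IsometryEquiv.addRight (γ 0) :=
  EIsom.ext_lin (by rw [h, lin_addRight]) (by simp)

/-- Divide an element moving 0 near x by a fixed representative of its linear part. There are
finitely many representatives, so the error stays bounded. -/
theorem IsCrystallographic.exists_lattice_near (h : IsCrystallographic Γ) :
    ∃ D : ℝ, ∀ x, ∃ v ∈ translationLattice Γ, ‖v - x‖ ≤ D := by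
  obtain ⟨D, hD⟩ := h.exists_orbit_near
  choose! s hsΓ hs using fun A (hA : A ∈ lin '' (Γ : Set (EIsom n))) => hA
  obtain ⟨E, hE⟩ := (h.finite_lin.image fun A => s A 0).isBounded.exists_norm_le
  refine ⟨D + E, fun x => ?_⟩
  obtain ⟨γ, hγ, hx⟩ := hD x
  have hmem : lin γ ∈ lin '' (Γ : Set (EIsom n)) := ⟨γ, hγ, rfl⟩
  have h1 : lin (γ * (s (lin γ))⁻¹) = 1 := by
    rw [map_mul]
    nth_rw 1 [← hs _ hmem]
    rw [lin_mul_lin_inv]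
  refine ⟨(γ * (s (lin γ))⁻¹) 0, ?_, ?_⟩
  · rw [mem_translationLattice, ← eq_addRight_of_lin_eq_one h1]
    exact Γ.mul_mem hγ (Γ.inv_mem (hsΓ _ hmem))
  · have h2 : γ 0 = s (lin γ) 0 + (γ * (s (lin γ))⁻¹) 0 := by
      conv_lhs => rw [← inv_mul_cancel_right γ (s (lin γ)), eq_addRight_of_lin_eq_one h1]
      rfl
    have h3 : (γ * (s (lin γ))⁻¹) 0 - x = (γ 0 - x) - s (lin γ) 0 := by rw [h2]; abel
    rw [h3]
    exact (norm_sub_le _ _).trans (add_le_add hx (hE _ ⟨_, hmem, rfl⟩))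

theorem IsCrystallographic.span_translationLattice (h : IsCrystallographic Γ) :
    Submodule.span ℝ (translationLattice Γ : Set (ESpace n)) = ⊤ := by
  obtain ⟨D, hD⟩ := h.exists_lattice_near
  rw [← Submodule.orthogonal_eq_bot_iff, Submodule.eq_bot_iff]
  intro u hu
  by_contra hne
  have hup : 0 < ‖u‖ := norm_pos_iff.2 hne
  -- A vector of length D + 1 orthogonal to the lattice has distance at least D + 1 from every
  -- lattice vector.
  obtain ⟨v, hv, hvu⟩ := hD (((D + 1) / ‖u‖) • u)
  have h1 : inner ℝ v u = 0 := (Submodule.mem_orthogonal _ _).1 hu v (Submodule.subset_span hv)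
  have h2 := abs_real_inner_le_norm (v - ((D + 1) / ‖u‖) • u) u
  rw [inner_sub_left, h1, inner_smul_left, real_inner_self_eq_norm_sq] at h2
  have hD0 := (norm_nonneg _).trans hvu
  have h3 : (D + 1) / ‖u‖ * ‖u‖ ^ 2 = (D + 1) * ‖u‖ := by field_simp
  simp only [conj_trivial, h3, zero_sub, abs_neg] at h2
  rw [abs_of_nonneg (by positivity)] at h2
  have := le_of_mul_le_mul_right h2 hup
  linarith

theorem IsCrystallographic.discreteTopology_translationLattice (h : IsCrystallographic Γ) :
    DiscreteTopology (translationLattice Γ) := by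
  rw [discreteTopology_iff_isOpen_singleton]
  intro v
  refine isOpen_singleton_of_finite_mem_nhds v (Metric.ball_mem_nhds v one_pos) ?_
  refine Set.Finite.of_finite_image (f := fun w => IsometryEquiv.addRight (w : ESpace n))
    ((h.finite_norm_le (‖(v : ESpace n)‖ + 1)).subset ?_) ?_
  · rintro _ ⟨w, hw, rfl⟩
    refine ⟨w.2, ?_⟩
    rw [Metric.mem_ball, Subtype.dist_eq, dist_eq_norm] at hw
    have := norm_add_le ((w : ESpace n) - v) v
    rw [sub_add_cancel] at this
    simp only [IsometryEquiv.addRight_apply, zero_add]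
    linarith
  · intro w _ w' _ hww
    have := congrArg (fun γ : EIsom n => γ 0) hww
    simpa using this

theorem IsCrystallographic.nonempty_basis (h : IsCrystallographic Γ) :
    Nonempty (Module.Basis (Fin n) ℤ (translationLattice Γ)) := by
  have : DiscreteTopology (AddSubgroup.toIntSubmodule (translationLattice Γ)) :=
    h.discreteTopology_translationLattice
  have : IsZLattice ℝ (AddSubgroup.toIntSubmodule (translationLattice Γ)) :=
    ⟨h.span_translationLattice⟩
  have hfree := ZLattice.module_free ℝ (AddSubgroup.toIntSubmodule (translationLattice Γ))
  have hfin := ZLattice.module_finite ℝ (AddSubgroup.toIntSubmodule (translationLattice Γ))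
  have hrank := ZLattice.rank ℝ (AddSubgroup.toIntSubmodule (translationLattice Γ))
  rw [finrank_euclideanSpace_fin] at hrank
  exact ⟨Module.finBasisOfFinrankEq ℤ (AddSubgroup.toIntSubmodule (translationLattice Γ)) hrank⟩

end Bieberbach

/-! ### Groups with a self-centralizing lattice of finite index -/

section Frame

open Matrix

/-- A normal subgroup of finite index that contains its centralizer, together with an isomorphism
`ι` to `ℤⁿ`; the action of the group on this subgroup is recorded as `R`. -/
structure LatticeFrame (n : ℕ) (G : Type u) [Group G] where
  ι : Multiplicative (Fin n → ℤ) →* G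
  R : G →* GL (Fin n) ℤ
  ι_injective : Function.Injective ι
  conj : ∀ g a, g * ι (Multiplicative.ofAdd a) * g⁻¹ =
    ι (Multiplicative.ofAdd ((R g : Matrix (Fin n) (Fin n) ℤ) *ᵥ a))
  finiteIndex : ι.range.FiniteIndex
  mem_range : ∀ g, R g = 1 → g ∈ ι.range

namespace LatticeFrame

variable {n : ℕ} {G : Type u} [Group G] (𝔤 : LatticeFrame n G)

/-- The translation by `a`. -/
def t (a : Fin n → ℤ) : G := 𝔤.ι (Multiplicative.ofAdd a)

/-- The action of `g` on the lattice. -/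
def act (g : G) : (Fin n → ℤ) →ₗ[ℤ] (Fin n → ℤ) :=
  Matrix.mulVecLin (𝔤.R g : Matrix (Fin n) (Fin n) ℤ)

theorem act_apply (g : G) (a : Fin n → ℤ) :
    𝔤.act g a = (𝔤.R g : Matrix (Fin n) (Fin n) ℤ) *ᵥ a := rfl

theorem act_mul (g h : G) (a : Fin n → ℤ) : 𝔤.act (g * h) a = 𝔤.act g (𝔤.act h a) := by
  simp [act_apply, mulVec_mulVec]

@[simp]
theorem act_one (a : Fin n → ℤ) : 𝔤.act 1 a = a := by
  simp [act_apply]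

@[simp]
theorem act_act_inv (g : G) (a : Fin n → ℤ) : 𝔤.act g (𝔤.act g⁻¹ a) = a := by
  rw [← act_mul, mul_inv_cancel, act_one]

@[simp]
theorem act_inv_act (g : G) (a : Fin n → ℤ) : 𝔤.act g⁻¹ (𝔤.act g a) = a := by
  rw [← act_mul, inv_mul_cancel, act_one]

theorem t_add (a b : Fin n → ℤ) : 𝔤.t (a + b) = 𝔤.t a * 𝔤.t b := map_mul 𝔤.ι _ _

@[simp]
theorem t_zero : 𝔤.t 0 = 1 := map_one 𝔤.ι

theorem t_neg (a : Fin n → ℤ) : 𝔤.t (-a) = (𝔤.t a)⁻¹ := map_inv 𝔤.ι _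

theorem t_sub (a b : Fin n → ℤ) : 𝔤.t (a - b) = 𝔤.t a * (𝔤.t b)⁻¹ := by
  rw [sub_eq_add_neg, t_add, t_neg]

theorem t_nsmul (k : ℕ) (a : Fin n → ℤ) : 𝔤.t (k • a) = 𝔤.t a ^ k := map_pow 𝔤.ι _ _

theorem t_injective : Function.Injective 𝔤.t := fun _ _ h =>
  Multiplicative.ofAdd.injective (𝔤.ι_injective h)

@[simp]
theorem t_eq_one {a : Fin n → ℤ} : 𝔤.t a = 1 ↔ a = 0 := by
  rw [← 𝔤.t_zero, 𝔤.t_injective.eq_iff]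

theorem conj_t (g : G) (a : Fin n → ℤ) : g * 𝔤.t a * g⁻¹ = 𝔤.t (𝔤.act g a) := 𝔤.conj g a

theorem mul_t (g : G) (a : Fin n → ℤ) : g * 𝔤.t a = 𝔤.t (𝔤.act g a) * g := by
  rw [← conj_t, inv_mul_cancel_right]

theorem R_eq_one_iff {g : G} : 𝔤.R g = 1 ↔ ∀ a, 𝔤.act g a = a := by
  constructor
  · intro h a
    simp [act_apply, h]
  · intro h
    apply Units.ext
    apply Matrix.toLin'.injective
    refine LinearMap.ext fun a => ?_
    rw [Units.val_one, Matrix.toLin'_one]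
    exact h a

theorem R_t (a : Fin n → ℤ) : 𝔤.R (𝔤.t a) = 1 := by
  rw [R_eq_one_iff]
  intro b
  apply 𝔤.t_injective
  rw [← conj_t, ← t_add, ← t_neg, ← t_add]
  congr 1
  abel

/-- The lattice as a subgroup. -/
def lattice : Subgroup G := 𝔤.R.ker

instance : 𝔤.lattice.Normal := inferInstanceAs 𝔤.R.ker.Normal

theorem mem_lattice {g : G} : g ∈ 𝔤.lattice ↔ ∃ a, g = 𝔤.t a := by
  constructor
  · intro h
    obtain ⟨a, rfl⟩ := 𝔤.mem_range g h
    exact ⟨a.toAdd, rfl⟩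
  · rintro ⟨a, rfl⟩
    exact 𝔤.R_t a

theorem t_mem (a : Fin n → ℤ) : 𝔤.t a ∈ 𝔤.lattice := 𝔤.R_t a

theorem lattice_eq_range : 𝔤.lattice = 𝔤.ι.range := by
  ext g
  rw [mem_lattice]
  constructor
  · rintro ⟨a, rfl⟩
    exact ⟨_, rfl⟩
  · rintro ⟨a, rfl⟩
    exact ⟨a.toAdd, rfl⟩

instance : 𝔤.lattice.FiniteIndex := by
  rw [lattice_eq_range]
  exact 𝔤.finiteIndex

theorem R_eq_of_inv_mul_mem {g h : G} (hgh : g⁻¹ * h ∈ 𝔤.lattice) : 𝔤.R g = 𝔤.R h := by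
  have h1 : 𝔤.R (g⁻¹ * h) = 1 := hgh
  rw [map_mul, map_inv, inv_mul_eq_one] at h1
  exact h1

theorem eq_of_nsmul_eq {k : ℕ} (hk : k ≠ 0) {a b : Fin n → ℤ} (h : k • a = k • b) : a = b := by
  funext i
  have := congrFun h i
  simp only [Pi.smul_apply, nsmul_eq_mul] at this
  exact mul_left_cancel₀ (by exact_mod_cast hk) this

theorem eq_one_of_isOfFinOrder_of_mem {g : G} (hg : IsOfFinOrder g) (hm : g ∈ 𝔤.lattice) :
    g = 1 := by
  obtain ⟨a, rfl⟩ := 𝔤.mem_lattice.1 hm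
  obtain ⟨k, hk, hk1⟩ := isOfFinOrder_iff_pow_eq_one.1 hg
  rw [← t_nsmul, t_eq_one] at hk1
  have : a = 0 := eq_of_nsmul_eq hk.ne' (by rw [hk1, smul_zero])
  rw [this, t_zero]

/-- A power of each translation of the first frame lies in the second lattice, hence commutes with
x. So x fixes a nonzero multiple of every vector, and therefore every vector. -/
theorem lattice_le {n' : ℕ} (𝔤' : LatticeFrame n' G) : 𝔤'.lattice ≤ 𝔤.lattice := by
  intro x hx
  change 𝔤.R x = 1
  rw [R_eq_one_iff]
  intro a
  have hN := 𝔤'.lattice.pow_index_mem (𝔤.t a)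
  rw [← t_nsmul] at hN
  obtain ⟨b, hb⟩ := 𝔤'.mem_lattice.1 hN
  obtain ⟨c, rfl⟩ := 𝔤'.mem_lattice.1 hx
  refine eq_of_nsmul_eq (k := 𝔤'.lattice.index) Subgroup.FiniteIndex.index_ne_zero ?_
  rw [← map_nsmul]
  apply 𝔤.t_injective
  rw [← conj_t, hb, ← t_add, ← t_neg, ← t_add]
  congr 1
  abel

/-- The lattice is uniquely determined. -/
theorem lattice_eq {n' : ℕ} (𝔤' : LatticeFrame n' G) : 𝔤.lattice = 𝔤'.lattice :=
  le_antisymm (𝔤'.lattice_le 𝔤) (𝔤.lattice_le 𝔤')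

/-- Frames can be transported along isomorphisms. -/
def map {H : Type v} [Group H] (e : G ≃* H) : LatticeFrame n H where
  ι := e.toMonoidHom.comp 𝔤.ι
  R := 𝔤.R.comp e.symm.toMonoidHom
  ι_injective := e.injective.comp 𝔤.ι_injective
  conj h a := by
    have := congrArg e (𝔤.conj (e.symm h) a)
    simpa using this
  finiteIndex := by
    have := 𝔤.finiteIndex
    rw [MonoidHom.range_comp]
    constructor
    have := Subgroup.index_map_equiv 𝔤.ι.range e
    change (Subgroup.map (e : G →* H) 𝔤.ι.range).index ≠ 0
    rw [this]
    exact Subgroup.FiniteIndex.index_ne_zero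
  mem_range h hh := by
    obtain ⟨a, ha⟩ := 𝔤.mem_range (e.symm h) hh
    exact ⟨a, by simp [ha]⟩

/-- The conjugation action on a normal subgroup isomorphic to `ℤⁿ`. -/
def conjLinear (L : Subgroup G) [L.Normal] (e : Multiplicative (Fin n → ℤ) ≃* L) (g : G) :
    (Fin n → ℤ) →ₗ[ℤ] (Fin n → ℤ) :=
  AddMonoidHom.toIntLinearMap
    { toFun := fun a => (e.symm (MulAut.conjNormal g (e (Multiplicative.ofAdd a)))).toAdd
      map_zero' := by simp
      map_add' := fun a b => by simp }

theorem conjLinear_apply (L : Subgroup G) [L.Normal] (e : Multiplicative (Fin n → ℤ) ≃* L) (g : G)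
    (a : Fin n → ℤ) : conjLinear L e g a =
      (e.symm (MulAut.conjNormal g (e (Multiplicative.ofAdd a)))).toAdd := rfl

/-- The frame of a normal self-centralizing subgroup of finite index isomorphic to `ℤⁿ`. -/
noncomputable def ofSubgroup (L : Subgroup G) [L.Normal] [hfi : L.FiniteIndex]
    (e : Multiplicative (Fin n → ℤ) ≃* L) (hc : ∀ g, (∀ x ∈ L, g * x * g⁻¹ = x) → g ∈ L) :
    LatticeFrame n G :=
  let R : G →* Matrix (Fin n) (Fin n) ℤ :=
    { toFun := fun g => LinearMap.toMatrix' (conjLinear L e g)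
      map_one' := by
        rw [← LinearMap.toMatrix'_id]
        congr 1
        refine LinearMap.ext fun a => ?_
        simp [conjLinear_apply]
      map_mul' := fun g h => by
        rw [← LinearMap.toMatrix'_mul]
        congr 1
        refine LinearMap.ext fun a => ?_
        simp [conjLinear_apply] }
  have hR : ∀ g a, R g *ᵥ a = conjLinear L e g a := fun g a =>
    LinearMap.toMatrix'_mulVec _ _
  have hconj : ∀ g a, g * (e (Multiplicative.ofAdd a) : G) * g⁻¹ =
      e (Multiplicative.ofAdd (conjLinear L e g a)) := fun g a => by
    rw [conjLinear_apply, ofAdd_toAdd, MulEquiv.apply_symm_apply, MulAut.conjNormal_apply]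
  have hrange : (L.subtype.comp e.toMonoidHom).range = L := by
    ext x
    constructor
    · rintro ⟨a, rfl⟩
      exact (e a).2
    · intro hx
      exact ⟨e.symm ⟨x, hx⟩, by simp⟩
  { ι := L.subtype.comp e.toMonoidHom
    R := R.toHomUnits
    ι_injective := Subtype.val_injective.comp e.injective
    conj := fun g a => by
      rw [MonoidHom.coe_toHomUnits, hR]
      exact hconj g a
    finiteIndex := by rw [hrange]; exact hfi
    mem_range := fun g hg => by
      rw [hrange]
      refine hc g fun x hx => ?_
      have h1 := hconj g (e.symm ⟨x, hx⟩).toAdd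
      have h2 : R g = 1 := by
        rw [← MonoidHom.coe_toHomUnits, hg, Units.val_one]
      rw [← hR, h2, one_mulVec, ofAdd_toAdd, MulEquiv.apply_symm_apply] at h1
      exact h1 }

theorem ofSubgroup_t (L : Subgroup G) [L.Normal] [L.FiniteIndex]
    (e : Multiplicative (Fin n → ℤ) ≃* L) (hc : ∀ g, (∀ x ∈ L, g * x * g⁻¹ = x) → g ∈ L)
    (a : Fin n → ℤ) : (ofSubgroup L e hc).t a = e (Multiplicative.ofAdd a) := rfl

theorem ofSubgroup_lattice (L : Subgroup G) [L.Normal] [L.FiniteIndex]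
    (e : Multiplicative (Fin n → ℤ) ≃* L) (hc : ∀ g, (∀ x ∈ L, g * x * g⁻¹ = x) → g ∈ L) :
    (ofSubgroup L e hc).lattice = L := by
  ext x
  rw [mem_lattice]
  constructor
  · rintro ⟨a, rfl⟩
    exact (e _).2
  · intro hx
    exact ⟨(e.symm ⟨x, hx⟩).toAdd, by simp [ofSubgroup_t]⟩

theorem sum_act {Q : Type*} (s : Finset Q) (g : G) (c : Q → Fin n → ℤ) :
    ∑ z ∈ s, 𝔤.act g (c z) = 𝔤.act g (∑ z ∈ s, c z) := (map_sum _ _ _).symm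

/-- Homomorphisms from a finite group to a quotient of `G` by a multiple of the lattice can be
lifted, up to a smaller multiple. -/
theorem exists_lift {F Q : Type*} [Group F] [Group Q] [Finite Q] (q : G →* F) {k : ℕ} (hk : k ≠ 0)
    (hq : ∀ g, q g = 1 → ∃ a, g = 𝔤.t ((Nat.card Q * k) • a)) (σ : Q →* F)
    (hσ : ∀ x, ∃ g, q g = σ x) :
    ∃ τ : Q →* G, ∀ x, ∃ a, q (τ x) = q (𝔤.t (k • a)) * σ x := by
  cases nonempty_fintype Q
  choose s hs using hσ
  -- The factor set of the set-theoretic lift s is |Q|k times the integral cochain c.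
  have hc : ∀ x y, ∃ a, s x * s y = 𝔤.t ((Nat.card Q * k) • a) * s (x * y) := by
    intro x y
    obtain ⟨a, ha⟩ := hq (s x * s y * (s (x * y))⁻¹) (by simp [hs])
    exact ⟨a, by rw [← ha, inv_mul_cancel_right]⟩
  choose c hc using hc
  have hm : Nat.card Q * k ≠ 0 := mul_ne_zero Nat.card_pos.ne' hk
  have hcoc : ∀ x y z, c x y + c (x * y) z = 𝔤.act (s x) (c y z) + c x (y * z) := by
    intro x y z
    apply eq_of_nsmul_eq hm
    apply 𝔤.t_injective
    rw [smul_add, smul_add, t_add, t_add]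
    apply mul_right_cancel (b := s (x * y * z))
    calc 𝔤.t _ * 𝔤.t _ * s (x * y * z) = (s x * s y) * s z := by
          rw [mul_assoc, ← hc, ← mul_assoc, ← hc]
      _ = s x * (s y * s z) := mul_assoc _ _ _
      _ = 𝔤.t _ * 𝔤.t _ * s (x * y * z) := by
          rw [hc, ← mul_assoc, mul_t, mul_assoc, hc, map_nsmul, mul_assoc x y z, ← mul_assoc]
  -- Summing the cocycle identity over the last argument shows that |Q|·c is the coboundary of f.
  -- Hence k•f corrects s to a homomorphism and only moves it by k times the lattice.
  set f : Q → Fin n → ℤ := fun x => ∑ z, c x z with hf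
  have hsum : ∀ x y, Nat.card Q • c x y + f (x * y) = 𝔤.act (s x) (f y) + f x := by
    intro x y
    have h1 : ∑ z, c x (y * z) = f x := Equiv.sum_comp (Equiv.mulLeft y) (c x)
    rw [← h1, hf, ← sum_act, ← Finset.sum_add_distrib, ← Finset.sum_congr rfl fun z _ => hcoc x y z,
      Finset.sum_add_distrib, Finset.sum_const, Finset.card_univ, Nat.card_eq_fintype_card]
  refine ⟨MonoidHom.mk' (fun x => 𝔤.t (-(k • f x)) * s x) fun x y => ?_, fun x => ⟨-f x, ?_⟩⟩
  · symm
    calc 𝔤.t (-(k • f x)) * s x * (𝔤.t (-(k • f y)) * s y)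
        = 𝔤.t (-(k • f x)) * (s x * 𝔤.t (-(k • f y))) * s y := by simp only [mul_assoc]
      _ = 𝔤.t (-(k • f x) + 𝔤.act (s x) (-(k • f y)) + (Nat.card Q * k) • c x y) * s (x * y) := by
          rw [mul_t, t_add, t_add]
          simp only [mul_assoc]
          rw [hc]
      _ = 𝔤.t (-(k • f (x * y))) * s (x * y) := by
          congr 2
          have h2 := congrArg (k • ·) (hsum x y)
          simp only [smul_add, smul_smul] at h2
          rw [mul_comm k] at h2
          rw [map_neg, map_nsmul, ← sub_eq_zero]
          rw [← sub_eq_zero] at h2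
          rw [← h2]
          abel
  · simp only [MonoidHom.mk'_apply, map_mul, hs, smul_neg]

/-- Two homomorphisms from a finite group which agree modulo a multiple of the lattice are
conjugate. -/
theorem exists_conj {Q : Type*} [Group Q] [Finite Q] (τ₁ τ₂ : Q →* G)
    (h : ∀ x, ∃ a, τ₂ x = 𝔤.t (Nat.card Q • a) * τ₁ x) :
    ∃ g, ∀ x, τ₂ x = g * τ₁ x * g⁻¹ := by
  cases nonempty_fintype Q
  choose d hd using h
  have hQ : Nat.card Q ≠ 0 := Nat.card_pos.ne'
  have hcoc : ∀ x y, d (x * y) = d x + 𝔤.act (τ₁ x) (d y) := by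
    intro x y
    apply eq_of_nsmul_eq hQ
    apply 𝔤.t_injective
    apply mul_right_cancel (b := τ₁ (x * y))
    rw [← hd, map_mul, map_mul, hd, hd, smul_add, t_add, ← map_nsmul]
    simp only [mul_assoc]
    rw [← mul_assoc (τ₁ x), mul_t]
    simp only [mul_assoc]
  -- The crossed homomorphism d becomes principal after multiplication by |Q|, and |Q|·d is exactly
  -- the discrepancy of the two homomorphisms.
  set e := ∑ y, d y with he
  have hsum : ∀ x, Nat.card Q • d x = e - 𝔤.act (τ₁ x) e := by
    intro x
    have h1 : ∑ y, d (x * y) = e := Equiv.sum_comp (Equiv.mulLeft x) d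
    rw [Finset.sum_congr rfl fun y _ => hcoc x y, Finset.sum_add_distrib, sum_act,
      Finset.sum_const, Finset.card_univ, ← Nat.card_eq_fintype_card, ← he] at h1
    exact eq_sub_of_add_eq h1
  refine ⟨𝔤.t e, fun x => ?_⟩
  rw [hd, hsum, ← t_neg, mul_assoc, mul_t, ← mul_assoc, ← t_add, map_neg, ← sub_eq_add_neg]

end LatticeFrame
end Frame

/-! ### Common finite quotients of groups with lattices -/

section Link

open Matrix

/-- A common quotient of two groups by the `m`-th multiples of their lattices, in which the lattices
have the same image. -/
structure LatticeLink {n : ℕ} {G : Type u} [Group G] {H : Type v} [Group H] (𝔤 : LatticeFrame n G)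
    (𝔥 : LatticeFrame n H) (m : ℕ) (F : Type w) [Group F] where
  p : G →* F
  q : H →* F
  p_surjective : Function.Surjective p
  q_surjective : Function.Surjective q
  p_eq_one : ∀ g, p g = 1 ↔ ∃ a, g = 𝔤.t (m • a)
  q_eq_one : ∀ h, q h = 1 ↔ ∃ a, h = 𝔥.t (m • a)
  exists_right : ∀ a, ∃ b, p (𝔤.t a) = q (𝔥.t b)
  exists_left : ∀ b, ∃ a, p (𝔤.t a) = q (𝔥.t b)

namespace LatticeLink

variable {n : ℕ} {G : Type u} [Group G] {H : Type v} [Group H] {𝔤 : LatticeFrame n G}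
  {𝔥 : LatticeFrame n H} {m : ℕ} {F : Type w} [Group F] (l : LatticeLink 𝔤 𝔥 m F)

/-- Exchange the two groups. -/
def symm : LatticeLink 𝔥 𝔤 m F where
  p := l.q
  q := l.p
  p_surjective := l.q_surjective
  q_surjective := l.p_surjective
  p_eq_one := l.q_eq_one
  q_eq_one := l.p_eq_one
  exists_right a := (l.exists_left a).imp fun _ h => h.symm
  exists_left a := (l.exists_right a).imp fun _ h => h.symm

include l in
theorem mem_lattice_right {g : G} {h : H} (hgh : l.p g = l.q h) (hg : g ∈ 𝔤.lattice) :
    h ∈ 𝔥.lattice := by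
  obtain ⟨a, rfl⟩ := 𝔤.mem_lattice.1 hg
  obtain ⟨b, hb⟩ := l.exists_right a
  obtain ⟨c, hc⟩ := (l.q_eq_one (h * (𝔥.t b)⁻¹)).1 (by rw [map_mul, map_inv, ← hb, hgh,
    mul_inv_cancel])
  rw [← inv_mul_cancel_right h (𝔥.t b), hc]
  exact mul_mem (𝔥.t_mem _) (𝔥.t_mem _)

theorem mem_lattice_iff {g : G} {h : H} (hgh : l.p g = l.q h) :
    g ∈ 𝔤.lattice ↔ h ∈ 𝔥.lattice :=
  ⟨l.mem_lattice_right hgh, l.symm.mem_lattice_right hgh.symm⟩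

theorem ker_p_le : l.p.ker ≤ (QuotientGroup.mk' 𝔤.lattice).ker := fun g hg => by
  obtain ⟨a, rfl⟩ := (l.p_eq_one g).1 hg
  rw [QuotientGroup.ker_mk']
  exact 𝔤.t_mem _

/-- The projection of `H` to the point group of `G`. -/
noncomputable def toQuotient : H →* G ⧸ 𝔤.lattice :=
  (l.p.liftOfSurjective l.p_surjective ⟨QuotientGroup.mk' 𝔤.lattice, l.ker_p_le⟩).comp l.q

theorem toQuotient_eq {g : G} {h : H} (hgh : l.p g = l.q h) :
    l.toQuotient h = (g : G ⧸ 𝔤.lattice) := by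
  change (l.p.liftOfSurjective l.p_surjective ⟨QuotientGroup.mk' 𝔤.lattice, l.ker_p_le⟩) (l.q h) = _
  rw [← hgh]
  exact l.p.liftOfRightInverse_comp_apply _ (Function.rightInverse_surjInv l.p_surjective)
    ⟨QuotientGroup.mk' 𝔤.lattice, l.ker_p_le⟩ g

theorem toQuotient_eq_one {h : H} : l.toQuotient h = 1 ↔ h ∈ 𝔥.lattice := by
  obtain ⟨g, hg⟩ := l.p_surjective (l.q h)
  rw [l.toQuotient_eq hg, QuotientGroup.eq_one_iff, l.mem_lattice_iff hg]

/-- The pairs of vectors whose translations have the same image. -/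
def pairs : AddSubgroup ((Fin n → ℤ) × (Fin n → ℤ)) where
  carrier := {x | l.p (𝔤.t x.1) = l.q (𝔥.t x.2)}
  zero_mem' := by simp
  add_mem' {x y} hx hy := by
    simp only [Set.mem_ofPred_eq] at hx hy ⊢
    rw [Prod.fst_add, Prod.snd_add, 𝔤.t_add, 𝔥.t_add, map_mul, map_mul, hx, hy]
  neg_mem' {x} hx := by
    simp only [Set.mem_ofPred_eq] at hx ⊢
    rw [Prod.fst_neg, Prod.snd_neg, 𝔤.t_neg, 𝔥.t_neg, map_inv, map_inv, hx]

theorem mem_pairs {a b : Fin n → ℤ} : (a, b) ∈ l.pairs ↔ l.p (𝔤.t a) = l.q (𝔥.t b) := Iff.rfl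

theorem act_mem_pairs {a b : Fin n → ℤ} {g : G} {h : H} (hgh : l.p g = l.q h)
    (hab : (a, b) ∈ l.pairs) : (𝔤.act g a, 𝔥.act h b) ∈ l.pairs := by
  rw [mem_pairs] at hab ⊢
  rw [← 𝔤.conj_t, ← 𝔥.conj_t]
  simp [hgh, hab]

/-- The lattice is free and `pairs` is a subgroup, so it suffices to choose partners of the basis
vectors. -/
theorem exists_linearMap : ∃ X : (Fin n → ℤ) →ₗ[ℤ] (Fin n → ℤ), ∀ a, (a, X a) ∈ l.pairs := by
  choose b hb using fun i : Fin n => l.exists_right (Pi.single i 1)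
  refine ⟨(Pi.basisFun ℤ (Fin n)).constr ℤ b, fun a => ?_⟩
  have h : (a, (Pi.basisFun ℤ (Fin n)).constr ℤ b a) =
      ∑ i, a i • ((Pi.single i 1 : Fin n → ℤ), b i) := by
    ext1
    · rw [Prod.fst_sum]
      simp only [Prod.smul_fst]
      exact pi_eq_sum_univ' a
    · rw [Prod.snd_sum]
      simp only [Prod.smul_snd]
      rw [Module.Basis.constr_apply_fintype]
      simp
  rw [h]
  exact sum_mem fun i _ => zsmul_mem (hb i) _

/-- For a prime `m` which does not divide the order of the point group there is an injective
equivariant homomorphism between the lattices. -/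
theorem exists_intertwiner (hm : m.Prime) (hmP : ¬ m ∣ 𝔤.lattice.index) :
    ∃ X : (Fin n → ℤ) →ₗ[ℤ] (Fin n → ℤ), Function.Injective X ∧
      ∀ g h, l.p g = l.q h → ∀ a, X (𝔤.act g a) = 𝔥.act h (X a) := by
  classical
  obtain ⟨Y, hY⟩ := l.exists_linearMap
  have : Fintype (G ⧸ 𝔤.lattice) := Subgroup.fintypeQuotientOfFiniteIndex
  let r : G ⧸ 𝔤.lattice → G := Quotient.out
  have hr : ∀ x : G ⧸ 𝔤.lattice, ((r x : G) : G ⧸ 𝔤.lattice) = x := fun x => Quotient.out_eq' x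
  choose s hs using fun x => l.q_surjective (l.p (r x))
  -- Averaging Y over the point group turns equivariance modulo m into true equivariance. Modulo m,
  -- X is a partner of |P| times the identity.
  let X : (Fin n → ℤ) →ₗ[ℤ] (Fin n → ℤ) := ∑ x, (𝔥.act (s x) ∘ₗ Y ∘ₗ 𝔤.act (r x)⁻¹)
  have hX : ∀ a, X a = ∑ x, 𝔥.act (s x) (Y (𝔤.act (r x)⁻¹ a)) := fun a => by
    simp [X, LinearMap.sum_apply]
  have hpairs : ∀ a, (𝔤.lattice.index • a, X a) ∈ l.pairs := by
    intro a
    have h1 : (𝔤.lattice.index • a, X a) =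
        ∑ x : G ⧸ 𝔤.lattice, (a, 𝔥.act (s x) (Y (𝔤.act (r x)⁻¹ a))) := by
      ext1
      · rw [Prod.fst_sum, Finset.sum_const, Finset.card_univ, ← Nat.card_eq_fintype_card]
        rfl
      · rw [Prod.snd_sum, hX]
    rw [h1]
    refine sum_mem fun x _ => ?_
    have h2 := l.act_mem_pairs (hs x).symm (hY (𝔤.act (r x)⁻¹ a))
    rwa [𝔤.act_act_inv] at h2
  refine ⟨X, ?_, ?_⟩
  -- Infinite descent: if X a = 0, then m divides |P|a, hence a, and the quotient is again in the
  -- kernel.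
  · have hdiv : ∀ a, X a = 0 → ∃ b, X b = 0 ∧ a = m • b := by
      intro a ha
      have h1 := hpairs a
      rw [ha, mem_pairs, 𝔥.t_zero, map_one, l.p_eq_one] at h1
      obtain ⟨c, hc⟩ := h1
      have hc := 𝔤.t_injective hc
      have hcop : IsCoprime (m : ℤ) (𝔤.lattice.index : ℤ) :=
        Nat.isCoprime_iff_coprime.2 ((Nat.Prime.coprime_iff_not_dvd hm).2 hmP)
      obtain ⟨x, y, hxy⟩ := hcop
      refine ⟨x • a + y • c, ?_, ?_⟩
      · apply LatticeFrame.eq_of_nsmul_eq hm.ne_zero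
        rw [← map_nsmul, smul_add, smul_comm m y, ← hc, map_add, map_nsmul, map_zsmul, map_zsmul,
          map_nsmul, ha]
        simp
      · rw [smul_add, smul_comm m y, ← hc, ← natCast_zsmul a, ← natCast_zsmul (x • a), smul_smul,
          smul_smul, ← add_smul, mul_comm (m : ℤ), hxy, one_smul]
    have hpow : ∀ k : ℕ, ∀ a, X a = 0 → ∃ b, a = m ^ k • b := by
      intro k
      induction k with
      | zero => exact fun a _ => ⟨a, by simp⟩
      | succ k ih =>
        intro a ha
        obtain ⟨b, hb, rfl⟩ := hdiv a ha
        obtain ⟨c, rfl⟩ := ih b hb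
        exact ⟨c, by rw [smul_smul, pow_succ']⟩
    rw [injective_iff_map_eq_zero]
    intro a ha
    funext i
    -- The exponent |aᵢ| is enough, as k < m^k.
    obtain ⟨b, hb⟩ := hpow (a i).natAbs a ha
    refine Int.eq_zero_of_abs_lt_dvd (m := (m : ℤ) ^ (a i).natAbs) ?_ ?_
    · refine ⟨b i, ?_⟩
      conv_lhs => rw [hb]
      simp
    · rw [Int.abs_eq_natAbs]
      exact_mod_cast Nat.lt_pow_self hm.one_lt
  · intro g h hgh a
    rw [hX, hX, map_sum]
    symm
    -- Reindex by x ↦ gx: the representatives change only by lattice elements, which act trivially.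
    refine Fintype.sum_equiv (MulAction.toPerm g) _ _ fun x => ?_
    rw [MulAction.toPerm_apply]
    have h1 : (g * r x)⁻¹ * r (g • x) ∈ 𝔤.lattice := by
      rw [← QuotientGroup.eq, hr]
      conv_rhs => rw [← hr x]
      rfl
    have h2 : (h * s x)⁻¹ * s (g • x) ∈ 𝔥.lattice := by
      refine l.mem_lattice_right ?_ h1
      rw [map_mul, map_mul, map_inv, map_inv, map_mul, map_mul, hs, hs, hgh]
    have h3 : 𝔤.R (r x)⁻¹ = 𝔤.R ((r (g • x))⁻¹ * g) := by
      have := 𝔤.R_eq_of_inv_mul_mem h1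
      rw [map_mul] at this
      rw [map_mul, map_inv, map_inv, ← this, _root_.mul_inv_rev, inv_mul_cancel_right]
    have h4 := 𝔥.R_eq_of_inv_mul_mem h2
    rw [← 𝔥.act_mul, 𝔥.act_apply (h * s x), h4, ← 𝔥.act_apply, 𝔤.act_apply (r x)⁻¹, h3,
      ← 𝔤.act_apply, 𝔤.act_mul]

include l in
/-- The lattices of linked groups split off simultaneously. -/
theorem exists_retraction (hm : m = 𝔤.lattice.index)
    (h : ∃ r : G →* G, (∀ g ∈ 𝔤.lattice, r g = 1) ∧ ∀ g, r g * g⁻¹ ∈ 𝔤.lattice) :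
    ∃ r : H →* H, (∀ g ∈ 𝔥.lattice, r g = 1) ∧ ∀ g, r g * g⁻¹ ∈ 𝔥.lattice := by
  obtain ⟨r, hr1, hr2⟩ := h
  -- The splitting of G, seen in F. Since m is the order of the point group, `exists_lift` with k =
  -- 1 lifts it to H.
  let σ : G ⧸ 𝔤.lattice →* F := QuotientGroup.lift 𝔤.lattice (l.p.comp r) fun g hg => by
    simp [hr1 g hg]
  obtain ⟨τ, hτ⟩ := 𝔥.exists_lift l.q (Q := G ⧸ 𝔤.lattice) one_ne_zero (fun h hh => by
    obtain ⟨a, ha⟩ := (l.q_eq_one h).1 hh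
    refine ⟨a, ?_⟩
    rw [ha, hm, mul_one]
    rfl) σ fun x => l.q_surjective _
  refine ⟨τ.comp l.toQuotient, fun h hh => ?_, fun h => ?_⟩
  · rw [MonoidHom.comp_apply, l.toQuotient_eq_one.2 hh, map_one]
  · obtain ⟨g, hg⟩ := l.p_surjective (l.q h)
    rw [MonoidHom.comp_apply, l.toQuotient_eq hg]
    obtain ⟨a, ha⟩ := hτ g
    have h1 : r g * g⁻¹ ∈ 𝔤.lattice := hr2 g
    have h2 : l.p (r g * g⁻¹) = l.q ((𝔥.t (1 • a))⁻¹ * τ g * h⁻¹) := by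
      rw [map_mul, map_mul, map_mul, ha, map_inv, map_inv, map_inv, inv_mul_cancel_left, hg]
      rfl
    have h3 := l.mem_lattice_right h2 h1
    have h4 := mul_mem (𝔥.t_mem (1 • a)) h3
    rwa [← mul_assoc, mul_inv_cancel_left] at h4

end LatticeLink

namespace LatticeFrame

variable {n : ℕ} {G : Type u} [Group G] (𝔤 : LatticeFrame n G)

include 𝔤 in
theorem infinite {H : Type v} [Group H] (𝔥 : LatticeFrame n H) (h : Infinite G) : Infinite H := by
  by_contra hH
  rw [not_infinite_iff_finite] at hH
  have hA : Finite (Fin n → ℤ) := Finite.of_injective _ 𝔥.t_injective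
  have hL : Finite 𝔤.lattice := by
    refine Finite.of_surjective (fun a : Fin n → ℤ => (⟨𝔤.t a, 𝔤.t_mem a⟩ : 𝔤.lattice)) ?_
    rintro ⟨g, hg⟩
    obtain ⟨a, rfl⟩ := 𝔤.mem_lattice.1 hg
    exact ⟨a, rfl⟩
  have : Finite G := Finite.of_equiv _
    (Subgroup.groupEquivQuotientProdSubgroup (s := 𝔤.lattice)).symm
  exact not_finite G

/-- Central elements centralize the lattice, hence lie in it; the centre consists of the
translations by fixed vectors. -/
theorem centreless_iff : CentrelessGroup G ↔ ∀ a, (∀ g, 𝔤.act g a = a) → a = 0 := by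
  constructor
  · intro h a ha
    rw [← 𝔤.t_eq_one, ← Subgroup.mem_bot, ← (h : Subgroup.center G = ⊥), Subgroup.mem_center_iff]
    intro g
    rw [𝔤.mul_t, ha]
  · intro h
    refine (Subgroup.eq_bot_iff_forall _).2 fun x hx => ?_
    rw [Subgroup.mem_center_iff] at hx
    have hx1 : 𝔤.R x = 1 := by
      rw [R_eq_one_iff]
      intro a
      apply 𝔤.t_injective
      rw [← 𝔤.conj_t, ← hx, mul_inv_cancel_right]
    obtain ⟨a, rfl⟩ := 𝔤.mem_lattice.1 (show x ∈ 𝔤.lattice from hx1)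
    rw [t_eq_one]
    refine h a fun g => 𝔤.t_injective ?_
    rw [← 𝔤.conj_t, hx, mul_inv_cancel_right]

/-- The index of N serves as k. Conversely, modulo the k-th multiples of the lattice every element
is a coset representative times a translation with coordinates in [0, k). -/
theorem finite_quotient_iff {N : Subgroup G} (hN : N.Normal) :
    Finite (G ⧸ N) ↔ ∃ k : ℕ, k ≠ 0 ∧ ∀ a, 𝔤.t (k • a) ∈ N := by
  constructor
  · intro h
    have : N.FiniteIndex := Subgroup.finiteIndex_of_finite_quotient
    refine ⟨N.index, Subgroup.FiniteIndex.index_ne_zero, fun a => ?_⟩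
    rw [t_nsmul]
    exact N.pow_index_mem _
  · rintro ⟨k, hk, h⟩
    have : NeZero k := ⟨hk⟩
    suffices hf : Finite (G ⧸ N) from hf
    have hfin : Finite ((G ⧸ 𝔤.lattice) × (Fin n → ZMod k)) := inferInstance
    have hsurj : Function.Surjective (fun x : (G ⧸ 𝔤.lattice) × (Fin n → ZMod k) =>
        ((Quotient.out x.1 * 𝔤.t fun i => ((x.2 i).val : ℤ) : G) : G ⧸ N)) := by
      intro y
      obtain ⟨g, rfl⟩ := QuotientGroup.mk_surjective y
      obtain ⟨⟨y, hy⟩, hgy⟩ := QuotientGroup.mk_out_eq_mul 𝔤.lattice g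
      obtain ⟨a, rfl⟩ := 𝔤.mem_lattice.1 hy
      refine ⟨((g : G ⧸ 𝔤.lattice), fun i => ((-a i : ℤ) : ZMod k)), ?_⟩
      have h2 : ∀ i, ∃ b : ℤ, (((-a i : ℤ) : ZMod k).val : ℤ) = -a i + k * b := fun i => by
        rw [ZMod.val_intCast, Int.emod_def]
        exact ⟨-(-a i / k), by ring⟩
      choose b hb using h2
      have h3 : (fun i => ((((-a i : ℤ) : ZMod k)).val : ℤ)) = -a + k • b := by
        funext i
        simp only [Pi.add_apply, Pi.neg_apply, nsmul_eq_mul]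
        exact hb i
      change ((Quotient.out (g : G ⧸ 𝔤.lattice) * 𝔤.t _ : G) : G ⧸ N) = g
      simp only [h3]
      have hgy' : Quotient.out (g : G ⧸ 𝔤.lattice) = g * 𝔤.t a := hgy
      rw [hgy', 𝔤.t_add, 𝔤.t_neg, mul_assoc, mul_inv_cancel_left]
      exact QuotientGroup.mk_mul_of_mem g (h b)
    exact Finite.of_surjective _ hsurj

/-- A nontrivial normal subgroup meets the lattice nontrivially, so only invariant sublattices
matter, and these can be moved along an intertwiner. -/
theorem justInfinite_iff : JustInfinite G ↔ Infinite G ∧ ∀ K : AddSubgroup (Fin n → ℤ),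
    (∀ g, ∀ a ∈ K, 𝔤.act g a ∈ K) → K ≠ ⊥ → ∃ k : ℕ, k ≠ 0 ∧ ∀ a, k • a ∈ K := by
  refine and_congr_right fun _ => ⟨fun h K hK hne => ?_, fun h N hN hne => ?_⟩
  · let N : Subgroup G :=
      { carrier := {g | ∃ a ∈ K, g = 𝔤.t a}
        one_mem' := ⟨0, K.zero_mem, by simp⟩
        mul_mem' := by
          rintro _ _ ⟨a, ha, rfl⟩ ⟨b, hb, rfl⟩
          exact ⟨a + b, K.add_mem ha hb, (𝔤.t_add a b).symm⟩
        inv_mem' := by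
          rintro _ ⟨a, ha, rfl⟩
          exact ⟨-a, K.neg_mem ha, (𝔤.t_neg a).symm⟩ }
    have hN : N.Normal := ⟨by
      rintro _ ⟨a, ha, rfl⟩ g
      exact ⟨𝔤.act g a, hK g a ha, 𝔤.conj_t g a⟩⟩
    have hNK : ∀ a, 𝔤.t a ∈ N ↔ a ∈ K := fun a =>
      ⟨fun ⟨b, hb, hab⟩ => by rwa [𝔤.t_injective hab], fun ha => ⟨a, ha, rfl⟩⟩
    have hfin := h N hN fun hbot => hne ((AddSubgroup.eq_bot_iff_forall _).2 fun a ha => by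
      have := (hNK a).2 ha
      rwa [hbot, Subgroup.mem_bot, t_eq_one] at this)
    obtain ⟨k, hk, hk1⟩ := (𝔤.finite_quotient_iff hN).1 hfin
    exact ⟨k, hk, fun a => (hNK _).1 (hk1 a)⟩
  · rw [𝔤.finite_quotient_iff hN]
    let K : AddSubgroup (Fin n → ℤ) :=
      { carrier := {a | 𝔤.t a ∈ N}
        zero_mem' := by simp
        add_mem' := fun {a b} ha hb => by
          change 𝔤.t (a + b) ∈ N
          rw [𝔤.t_add]
          exact N.mul_mem ha hb
        neg_mem' := fun {a} ha => by
          change 𝔤.t (-a) ∈ N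
          rw [𝔤.t_neg]
          exact N.inv_mem ha }
    refine h K (fun g a ha => ?_) fun hbot => hne ?_
    · change 𝔤.t _ ∈ N
      rw [← 𝔤.conj_t]
      exact hN.conj_mem _ ha g
    · have hK : ∀ a, 𝔤.t a ∈ N → a = 0 := fun a ha => by
        have : a ∈ K := ha
        rwa [hbot, AddSubgroup.mem_bot] at this
      refine (Subgroup.eq_bot_iff_forall _).2 fun x hx => ?_
      -- The commutators of x with translations lie both in N and in the lattice; if they vanish, x
      -- centralizes the lattice.
      have hx1 : 𝔤.R x = 1 := by
        rw [R_eq_one_iff]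
        intro a
        rw [← sub_eq_zero]
        apply hK
        rw [𝔤.t_sub, ← 𝔤.conj_t, mul_assoc, mul_assoc]
        refine N.mul_mem hx ?_
        rw [← mul_assoc]
        exact hN.conj_mem _ (N.inv_mem hx) _
      obtain ⟨a, rfl⟩ := 𝔤.mem_lattice.1 (show x ∈ 𝔤.lattice from hx1)
      rw [hK a hx, t_zero]

end LatticeFrame

/-- Two groups with lattices whose rational representations are equivalent. -/
structure RationallyEquivalent {n : ℕ} {G : Type u} [Group G] {H : Type v} [Group H]
    (𝔤 : LatticeFrame n G) (𝔥 : LatticeFrame n H) (rel : G → H → Prop) : Prop where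
  left_total : ∀ g, ∃ h, rel g h
  right_total : ∀ h, ∃ g, rel g h
  intertwiner : ∃ X : (Fin n → ℤ) →ₗ[ℤ] (Fin n → ℤ), Function.Injective X ∧
    ∀ g h, rel g h → ∀ a, X (𝔤.act g a) = 𝔥.act h (X a)
  intertwiner' : ∃ X : (Fin n → ℤ) →ₗ[ℤ] (Fin n → ℤ), Function.Injective X ∧
    ∀ g h, rel g h → ∀ a, X (𝔥.act h a) = 𝔤.act g (X a)

namespace RationallyEquivalent

variable {n : ℕ} {G : Type u} [Group G] {H : Type v} [Group H] {𝔤 : LatticeFrame n G}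
  {𝔥 : LatticeFrame n H} {rel : G → H → Prop} (e : RationallyEquivalent 𝔤 𝔥 rel)

include e

theorem symm : RationallyEquivalent 𝔥 𝔤 fun h g => rel g h where
  left_total := e.right_total
  right_total := e.left_total
  intertwiner := e.intertwiner'.imp fun _ hX => ⟨hX.1, fun h g hr => hX.2 g h hr⟩
  intertwiner' := e.intertwiner.imp fun _ hX => ⟨hX.1, fun h g hr => hX.2 g h hr⟩

theorem centreless (h : CentrelessGroup G) : CentrelessGroup H := by
  rw [𝔥.centreless_iff]
  rw [𝔤.centreless_iff] at h
  obtain ⟨X, hX, hXe⟩ := e.intertwiner'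
  intro a ha
  refine hX ?_
  rw [map_zero]
  refine h _ fun g => ?_
  obtain ⟨k, hk⟩ := e.left_total g
  rw [← hXe g k hk, ha]

/-- Move an invariant sublattice K to the lattice of G by the injective Y. If Y(K) contains all k-th
multiples, it contains k•Y a, so K contains k•a. -/
theorem justInfinite (hinf : Infinite G → Infinite H) (h : JustInfinite G) : JustInfinite H := by
  rw [𝔥.justInfinite_iff]
  rw [𝔤.justInfinite_iff] at h
  refine ⟨hinf h.1, fun K hK hne => ?_⟩
  obtain ⟨X, hX, hXe⟩ := e.intertwiner
  obtain ⟨Y, hY, hYe⟩ := e.intertwiner'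
  obtain ⟨k, hk, hk1⟩ := h.2 (K.map Y.toAddMonoidHom) (by
    rintro g _ ⟨a, ha, rfl⟩
    obtain ⟨k, hgk⟩ := e.left_total g
    exact ⟨𝔥.act k a, hK k a ha, hYe g k hgk a⟩) (by
    rwa [Ne, AddSubgroup.map_eq_bot_iff_of_injective _ hY])
  refine ⟨k, hk, fun a => ?_⟩
  obtain ⟨b, hb, hab⟩ := hk1 (Y a)
  have : b = k • a := hY (by rw [map_nsmul]; exact hab)
  rwa [← this]

end RationallyEquivalent

theorem LatticeLink.rationallyEquivalent {n : ℕ} {G : Type u} [Group G] {H : Type v} [Group H]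
    {𝔤 : LatticeFrame n G} {𝔥 : LatticeFrame n H} {m : ℕ} {F : Type w} [Group F]
    (l : LatticeLink 𝔤 𝔥 m F) (hm : m.Prime) (hmG : ¬ m ∣ 𝔤.lattice.index)
    (hmH : ¬ m ∣ 𝔥.lattice.index) : RationallyEquivalent 𝔤 𝔥 fun g h => l.p g = l.q h where
  left_total g := (l.q_surjective (l.p g)).imp fun _ h => h.symm
  right_total h := l.p_surjective (l.q h)
  intertwiner := l.exists_intertwiner hm hmG
  intertwiner' := by
    obtain ⟨X, hX, hXe⟩ := l.symm.exists_intertwiner hm hmH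
    exact ⟨X, hX, fun g h hgh => hXe h g hgh.symm⟩

end Link

/-! ### Finite subgroups and their conjugacy classes -/

section FiniteSubgroups

/-- The lattice is torsion-free, so finite subgroups embed in the point group. -/
theorem LatticeFrame.card_dvd_index {n : ℕ} {G : Type u} [Group G] (𝔤 : LatticeFrame n G)
    (A : Subgroup G) [Finite A] : Nat.card A ∣ 𝔤.lattice.index := by
  refine Subgroup.card_dvd_of_injective ((QuotientGroup.mk' 𝔤.lattice).comp A.subtype) ?_
  rw [injective_iff_map_eq_one]
  intro x hx
  have h1 : (x : G) ∈ 𝔤.lattice := (QuotientGroup.eq_one_iff _).1 hx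
  exact Subtype.ext (𝔤.eq_one_of_isOfFinOrder_of_mem
    ((Submonoid.isOfFinOrder_coe (H := A.toSubmonoid)).2 (isOfFinOrder_of_finite x)) h1)

namespace LatticeLink

variable {n : ℕ} {G : Type u} [Group G] {H : Type v} [Group H] {𝔤 : LatticeFrame n G}
  {𝔥 : LatticeFrame n H} {m : ℕ} {F : Type w} [Group F] (l : LatticeLink 𝔤 𝔥 m F) {N : ℕ}

/-- The subgroups `A` and `B` are isomorphic, compatibly with the common quotient modulo `N` times
the lattice. -/
def Corresponds (N : ℕ) (A : Subgroup G) (B : Subgroup H) : Prop :=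
  ∃ e : A ≃* B, ∀ x : A, ∃ a, l.q (e x) = l.q (𝔥.t (N • a)) * l.p x

variable {l}

theorem Corresponds.symm {A : Subgroup G} {B : Subgroup H} (h : l.Corresponds N A B) :
    l.symm.Corresponds N B A := by
  obtain ⟨e, he⟩ := h
  refine ⟨e.symm, fun y => ?_⟩
  obtain ⟨a, ha⟩ := he (e.symm y)
  obtain ⟨c, hc⟩ := l.exists_left (-a)
  refine ⟨c, ?_⟩
  change l.p _ = l.p _ * l.q y
  rw [𝔤.t_nsmul, map_pow, hc, ← map_pow, ← 𝔥.t_nsmul, ← e.apply_symm_apply y, ha, ← mul_assoc,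
    ← map_mul, ← 𝔥.t_add, smul_neg, neg_add_cancel, 𝔥.t_zero, map_one, one_mul,
    e.apply_symm_apply]

variable (l)

/-- With N = |A|j one has m = |A|(jN), so the inclusion of A into G lifts from F to H up to jN times
the lattice. The lift is injective, since an element of its kernel would be torsion in the lattice
of G. -/
theorem exists_corresponds (hm : m = N * N) (hN : N ≠ 0) (hG : 𝔤.lattice.index ∣ N)
    (A : Subgroup G) [Finite A] : ∃ B : Subgroup H, l.Corresponds N A B := by
  obtain ⟨j, hj⟩ := (𝔤.card_dvd_index A).trans hG
  have hj0 : j ≠ 0 := by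
    rintro rfl
    exact hN (by rw [hj, mul_zero])
  obtain ⟨τ, hτ⟩ := 𝔥.exists_lift l.q (Q := A) (mul_ne_zero hj0 hN) (fun h hh => by
    obtain ⟨a, ha⟩ := (l.q_eq_one h).1 hh
    exact ⟨a, by rw [ha, hm, ← mul_assoc, ← hj]⟩) (l.p.comp A.subtype) fun x => l.q_surjective _
  have hinj : Function.Injective τ := by
    rw [injective_iff_map_eq_one]
    intro x hx
    obtain ⟨a, ha⟩ := hτ x
    rw [hx, map_one] at ha
    have h1 : (x : G) ∈ 𝔤.lattice := by
      refine (l.mem_lattice_iff (h := (𝔥.t ((j * N) • a))⁻¹) ?_).2 (inv_mem (𝔥.t_mem _))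
      rw [map_inv]
      exact eq_inv_of_mul_eq_one_right ha.symm
    exact Subtype.ext (𝔤.eq_one_of_isOfFinOrder_of_mem
      ((Submonoid.isOfFinOrder_coe (H := A.toSubmonoid)).2 (isOfFinOrder_of_finite x)) h1)
  refine ⟨τ.range, MonoidHom.ofInjective hinj, fun x => ?_⟩
  obtain ⟨a, ha⟩ := hτ x
  refine ⟨j • a, ?_⟩
  rw [smul_smul, mul_comm N]
  exact ha

variable {l}

/-- Map A to H through B, and also through conjugation into A', then B', then conjugation by a
partner k of g. The two maps agree up to N times the lattice; |A| divides N, so `exists_conj` makes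
them conjugate. -/
theorem Corresponds.le_conj (hm : m = N * N) (hG : 𝔤.lattice.index ∣ N)
    {A A' : Subgroup G} {B B' : Subgroup H} [Finite A] (h : l.Corresponds N A B)
    (h' : l.Corresponds N A' B') (hle : ∃ g, A ≤ conjSubgroup g A') :
    ∃ g, B ≤ conjSubgroup g B' := by
  obtain ⟨e, he⟩ := h
  obtain ⟨e', he'⟩ := h'
  obtain ⟨g, hg⟩ := hle
  obtain ⟨k, hk⟩ := l.q_surjective (l.p g)
  obtain ⟨j, hj⟩ := (𝔤.card_dvd_index A).trans hG
  have hmem : ∀ x : A, g⁻¹ * x * g ∈ A' := by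
    intro x
    obtain ⟨y, hy, hyx⟩ := hg x.2
    have : (x : G) = g * y * g⁻¹ := hyx.symm
    rw [this]
    have h2 : g⁻¹ * (g * y * g⁻¹) * g = y := by group
    rw [h2]
    exact hy
  let c : A →* A' := MonoidHom.mk' (fun x => ⟨g⁻¹ * x * g, hmem x⟩) fun x y => by
    ext
    simp [mul_assoc]
  let τ₁ : A →* H := B.subtype.comp e.toMonoidHom
  let τ₂ : A →* H := (MulAut.conj k).toMonoidHom.comp (B'.subtype.comp (e'.toMonoidHom.comp c))
  have hτ₁ : ∀ x, τ₁ x = e x := fun _ => rfl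
  have hτ₂ : ∀ x, τ₂ x = k * e' (c x) * k⁻¹ := fun _ => rfl
  obtain ⟨y, hy⟩ := 𝔥.exists_conj τ₂ τ₁ (fun x => by
    obtain ⟨a, ha⟩ := he x
    obtain ⟨a', ha'⟩ := he' (c x)
    have h1 : l.q (τ₂ x) = l.q (𝔥.t (N • 𝔥.act k a')) * l.p x := by
      rw [hτ₂, map_mul, map_mul, ha', map_inv, hk, ← map_nsmul, ← 𝔥.conj_t, map_mul, map_mul,
        map_inv, hk]
      have : (c x : G) = g⁻¹ * x * g := rfl
      rw [this]
      simp [mul_assoc]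
    have h2 : l.q (τ₁ x * (τ₂ x)⁻¹ * (𝔥.t (N • (a - 𝔥.act k a')))⁻¹) = 1 := by
      have h3 : l.q (τ₁ x * (τ₂ x)⁻¹) = l.q (𝔥.t (N • (a - 𝔥.act k a'))) := by
        rw [map_mul, map_inv, h1, hτ₁, ha, smul_sub, 𝔥.t_sub, map_mul, map_inv]
        simp [mul_assoc]
      rw [map_mul, h3, map_inv, mul_inv_cancel]
    obtain ⟨b, hb⟩ := (l.q_eq_one _).1 h2
    refine ⟨j • (N • b + (a - 𝔥.act k a')), ?_⟩
    rw [smul_smul, ← hj, smul_add, smul_smul, ← hm, 𝔥.t_add, ← hb]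
    group)
  refine ⟨y * k, fun b hb => ?_⟩
  have h1 := hy (e.symm ⟨b, hb⟩)
  rw [hτ₁, hτ₂, e.apply_symm_apply] at h1
  refine ⟨e' (c (e.symm ⟨b, hb⟩)), SetLike.coe_mem _, ?_⟩
  change y * k * _ * (y * k)⁻¹ = b
  change b = _ at h1
  refine Eq.trans ?_ h1.symm
  group

theorem mk_le_mk {G : Type u} [Group G] {A B : FiniteSubgroup G} :
    ConjFiniteSubgroups.mk A ≤ ConjFiniteSubgroups.mk B ↔ ∃ g, A.1 ≤ conjSubgroup g B.1 := Iff.rfl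

theorem Corresponds.le_iff (hm : m = N * N) (hG : 𝔤.lattice.index ∣ N) (hH : 𝔥.lattice.index ∣ N)
    {A A' : FiniteSubgroup G} {B B' : FiniteSubgroup H} (h : l.Corresponds N A.1 B.1)
    (h' : l.Corresponds N A'.1 B'.1) : ConjFiniteSubgroups.mk A ≤ ConjFiniteSubgroups.mk A' ↔
      ConjFiniteSubgroups.mk B ≤ ConjFiniteSubgroups.mk B' := by
  rw [mk_le_mk, mk_le_mk]
  have := A.2
  have := B.2
  exact ⟨h.le_conj hm hG h', h.symm.le_conj (l := l.symm) hm hH h'.symm⟩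

theorem Corresponds.eq_iff (hm : m = N * N) (hG : 𝔤.lattice.index ∣ N) (hH : 𝔥.lattice.index ∣ N)
    {A A' : FiniteSubgroup G} {B B' : FiniteSubgroup H} (h : l.Corresponds N A.1 B.1)
    (h' : l.Corresponds N A'.1 B'.1) : ConjFiniteSubgroups.mk A = ConjFiniteSubgroups.mk A' ↔
      ConjFiniteSubgroups.mk B = ConjFiniteSubgroups.mk B' := by
  rw [le_antisymm_iff, le_antisymm_iff, h.le_iff hm hG hH h', h'.le_iff hm hG hH h]

variable (l)

theorem exists_corresponds_finite (hm : m = N * N) (hN : N ≠ 0) (hG : 𝔤.lattice.index ∣ N)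
    (A : FiniteSubgroup G) : ∃ B : FiniteSubgroup H, l.Corresponds N A.1 B.1 := by
  have := A.2
  obtain ⟨B, hB⟩ := l.exists_corresponds hm hN hG A.1
  exact ⟨⟨B, Finite.of_equiv _ hB.choose.toEquiv⟩, hB⟩

theorem nonempty_mulEquiv_of_mk_eq {G : Type u} [Group G] {A B : FiniteSubgroup G}
    (h : ConjFiniteSubgroups.mk A = ConjFiniteSubgroups.mk B) : Nonempty (A.1 ≃* B.1) := by
  obtain ⟨g, hg⟩ := Quotient.exact h
  rw [hg]
  exact ⟨(B.1.equivMapOfInjective _ (MulAut.conj g).injective).symm⟩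

include l in
-- Chosen partners preserve and reflect the order by `Corresponds.le_iff`; surjectivity comes from
-- the reversed link.
theorem exists_orderIso (hm : m = N * N) (hN : N ≠ 0) (hG : 𝔤.lattice.index ∣ N)
    (hH : 𝔥.lattice.index ∣ N) : ∃ α : ConjFiniteSubgroups G ≃o ConjFiniteSubgroups H,
      ∀ (A : FiniteSubgroup G) (B : FiniteSubgroup H),
        α (ConjFiniteSubgroups.mk A) = ConjFiniteSubgroups.mk B → Nonempty (A.1 ≃* B.1) := by
  have hex : ∀ a : ConjFiniteSubgroups G, ∃ (A : FiniteSubgroup G) (B : FiniteSubgroup H),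
      ConjFiniteSubgroups.mk A = a ∧ l.Corresponds N A.1 B.1 := by
    rintro ⟨A⟩
    obtain ⟨B, hB⟩ := l.exists_corresponds_finite hm hN hG A
    exact ⟨A, B, rfl, hB⟩
  choose A B hA hAB using hex
  have hle : ∀ a b, ConjFiniteSubgroups.mk (B a) ≤ ConjFiniteSubgroups.mk (B b) ↔ a ≤ b := by
    intro a b
    rw [← (hAB a).le_iff hm hG hH (hAB b), hA, hA]
  have hsurj : Function.Surjective fun a => ConjFiniteSubgroups.mk (B a) := by
    rintro ⟨C⟩
    obtain ⟨D, hD⟩ := l.symm.exists_corresponds_finite hm hN hH C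
    refine ⟨ConjFiniteSubgroups.mk D, ?_⟩
    have hD' : l.Corresponds N D.1 C.1 := hD.symm
    exact ((hAB _).eq_iff hm hG hH hD').1 (hA _)
  refine ⟨RelIso.ofSurjective (OrderEmbedding.ofMapLEIff _ hle) hsurj, fun C D hCD => ?_⟩
  change ConjFiniteSubgroups.mk (B _) = _ at hCD
  obtain ⟨e₁⟩ := nonempty_mulEquiv_of_mk_eq (hA (ConjFiniteSubgroups.mk C))
  obtain ⟨e₂⟩ := nonempty_mulEquiv_of_mk_eq hCD
  obtain ⟨e, -⟩ := hAB (ConjFiniteSubgroups.mk C)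
  exact ⟨(e₁.symm.trans e).trans e₂⟩

end LatticeLink

/-- A torsion element generates a finite cyclic subgroup, which is isomorphic to a finite, hence
trivial, subgroup of G. -/
theorem TorsionFreeGroup.of_orderIso {G : Type u} [Group G] {H : Type v} [Group H]
    (α : ConjFiniteSubgroups G ≃o ConjFiniteSubgroups H)
    (hα : ∀ (A : FiniteSubgroup G) (B : FiniteSubgroup H),
      α (ConjFiniteSubgroups.mk A) = ConjFiniteSubgroups.mk B → Nonempty (A.1 ≃* B.1))
    (h : TorsionFreeGroup G) : TorsionFreeGroup H := by
  intro x hx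
  let B : FiniteSubgroup H := ⟨Subgroup.zpowers x, finite_zpowers.2 hx⟩
  obtain ⟨⟨A⟩, hA⟩ := α.surjective (ConjFiniteSubgroups.mk B)
  obtain ⟨e⟩ := hα A B hA
  have := A.2
  have h1 : (e.symm ⟨x, Subgroup.mem_zpowers x⟩ : G) = 1 :=
    h _ ((Submonoid.isOfFinOrder_coe (H := A.1.toSubmonoid)).2
      (isOfFinOrder_of_finite (G := A.1) (e.symm ⟨x, Subgroup.mem_zpowers x⟩)))
  have h2 : e.symm ⟨x, Subgroup.mem_zpowers x⟩ = 1 := Subtype.ext h1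
  rw [EmbeddingLike.map_eq_one_iff] at h2
  exact congrArg Subtype.val h2

end FiniteSubgroups

/-! ### Finitely generated abelian groups with common quotients -/

section Abelian

/-- `S` is the graph of an isomorphism `A / mA ≃ B / mB`. -/
structure IsModGraph {A : Type u} {B : Type v} [AddCommGroup A] [AddCommGroup B] (m : ℕ)
    (S : AddSubgroup (A × B)) : Prop where
  left_total : ∀ a, ∃ b, (a, b) ∈ S
  right_total : ∀ b, ∃ a, (a, b) ∈ S
  left_zero : ∀ a, (a, 0) ∈ S ↔ ∃ a', a = m • a'
  zero_right : ∀ b, (0, b) ∈ S ↔ ∃ b', b = m • b'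

namespace IsModGraph

theorem symm {A : Type u} {B : Type v} [AddCommGroup A] [AddCommGroup B] {m : ℕ}
    {S : AddSubgroup (A × B)} (h : IsModGraph m S) :
    IsModGraph m (S.comap (AddEquiv.prodComm : B × A ≃+ A × B).toAddMonoidHom) where
  left_total := h.right_total
  right_total := h.left_total
  left_zero := h.zero_right
  zero_right := h.left_zero

theorem congr {A A' : Type*} {B B' : Type*} [AddCommGroup A] [AddCommGroup B] [AddCommGroup A']
    [AddCommGroup B'] {m : ℕ} {S : AddSubgroup (A × B)} (h : IsModGraph m S) (e : A' ≃+ A)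
    (f : B' ≃+ B) : IsModGraph m (S.comap (e.toAddMonoidHom.prodMap f.toAddMonoidHom)) where
  left_total a := by
    obtain ⟨b, hb⟩ := h.left_total (e a)
    exact ⟨f.symm b, by simpa using hb⟩
  right_total b := by
    obtain ⟨a, ha⟩ := h.right_total (f b)
    exact ⟨e.symm a, by simpa using ha⟩
  left_zero a := by
    have := h.left_zero (e a)
    simp only [AddSubgroup.mem_comap, AddMonoidHom.prodMap_def, AddMonoidHom.prod_apply]
    simp only [AddMonoidHom.comp_apply, AddMonoidHom.coe_fst, AddMonoidHom.coe_snd, map_zero]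
    refine this.trans ⟨fun ⟨a', ha⟩ => ⟨e.symm a', ?_⟩, fun ⟨a', ha⟩ => ⟨e a', ?_⟩⟩
    · rw [← map_nsmul, ← ha, e.symm_apply_apply]
    · rw [← map_nsmul, ← ha]
  zero_right a := by
    have := h.zero_right (f a)
    simp only [AddSubgroup.mem_comap, AddMonoidHom.prodMap_def, AddMonoidHom.prod_apply]
    simp only [AddMonoidHom.comp_apply, AddMonoidHom.coe_fst, AddMonoidHom.coe_snd, map_zero]
    refine this.trans ⟨fun ⟨a', ha⟩ => ⟨f.symm a', ?_⟩, fun ⟨a', ha⟩ => ⟨f a', ?_⟩⟩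
    · rw [← map_nsmul, ← ha, f.symm_apply_apply]
    · rw [← map_nsmul, ← ha]

variable {r s : ℕ} {T : Type u} {T' : Type v} [AddCommGroup T] [AddCommGroup T'] {t : ℕ}

/-- Working modulo t² rather than t identifies torsion: modulo t², an element killed by t differs
from a torsion element by a multiple of t, and multiples of t have no torsion component. -/
theorem exists_torsion_hom (ht : t ≠ 0) (hT : ∀ y : T, t • y = 0) (hT' : ∀ y : T', t • y = 0)
    {S : AddSubgroup (((Fin r → ℤ) × T) × ((Fin s → ℤ) × T'))} (h : IsModGraph (t * t) S) :
    ∃ φ : T →+ T', Function.Injective φ := by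
  -- The relation induced by S on the torsion parts, the first entry being allowed to change by a
  -- multiple of t.
  let P : AddSubgroup (T × T') :=
    { carrier := {x | ∃ c, (t • c + (0, x.1), (0, x.2)) ∈ S}
      zero_mem' := ⟨0, by
        convert S.zero_mem using 1
        rw [smul_zero, zero_add]
        rfl⟩
      add_mem' := by
        rintro x y ⟨c, hc⟩ ⟨d, hd⟩
        refine ⟨c + d, ?_⟩
        convert S.add_mem hc hd using 1
        ext1
        · change t • (c + d) + (0, x.1 + y.1) = (t • c + (0, x.1)) + (t • d + (0, y.1))
          rw [smul_add, add_add_add_comm]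
          congr 1
        · simp
      neg_mem' := by
        rintro x ⟨c, hc⟩
        refine ⟨-c, ?_⟩
        convert S.neg_mem hc using 1
        ext1
        · simp [add_comm]
        · simp }
  have hex : ∀ y, ∃ y', (y, y') ∈ P := by
    intro y
    obtain ⟨b, hb⟩ := h.left_total (0, y)
    have h1 := S.nsmul_mem hb t
    have h2 : ((0 : (Fin r → ℤ) × T), t • b) ∈ S := by
      convert h1 using 1
      ext1
      · ext1
        · simp
        · exact (hT y).symm
      · rfl
    obtain ⟨b', hb'⟩ := (h.zero_right _).1 h2
    obtain ⟨a', ha'⟩ := h.right_total b'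
    refine ⟨b.2, -a', ?_⟩
    have h3 : b.1 = t • b'.1 := by
      apply LatticeFrame.eq_of_nsmul_eq ht
      rw [smul_smul]
      exact congrArg Prod.fst hb'
    convert S.sub_mem hb (S.nsmul_mem ha' t) using 1
    ext1
    · simp only [smul_neg, Prod.fst_sub, Prod.smul_fst]
      rw [neg_add_eq_sub]
    · ext1
      · simp [h3]
      · simp [hT']
  have hfun : ∀ y', ((0 : T), y') ∈ P → y' = 0 := by
    rintro y' ⟨c, hc⟩
    obtain ⟨b, hb⟩ := h.left_total c
    have h1 := S.sub_mem hc (S.nsmul_mem hb t)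
    have h2 : ((0 : (Fin r → ℤ) × T), ((0, y') - t • b : (Fin s → ℤ) × T')) ∈ S := by
      convert h1 using 1
      ext1
      · simp only [Prod.fst_sub, Prod.smul_fst]
        change 0 = t • c + (0 : (Fin r → ℤ) × T) - t • c
        simp
      · rfl
    obtain ⟨b', hb'⟩ := (h.zero_right _).1 h2
    have h3 := congrArg Prod.snd hb'
    simpa [mul_smul, hT'] using h3
  have hinj : ∀ y, (y, (0 : T')) ∈ P → y = 0 := by
    rintro y ⟨c, hc⟩
    obtain ⟨a, ha⟩ := (h.left_zero _).1 hc
    have h3 := congrArg Prod.snd ha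
    simpa [mul_smul, hT] using h3
  choose φ hφ using hex
  refine ⟨AddMonoidHom.mk' φ fun x y => ?_, ?_⟩
  · have h1 := P.sub_mem (hφ (x + y)) (P.add_mem (hφ x) (hφ y))
    simp only [Prod.mk_add_mk, Prod.mk_sub_mk, sub_self] at h1
    exact sub_eq_zero.1 (hfun _ h1)
  · rw [injective_iff_map_eq_zero]
    intro y hy
    have := hφ y
    rw [AddMonoidHom.mk'_apply] at hy
    rw [hy] at this
    exact hinj y this

/-- Standard representatives of A/tA are sent by S to distinct classes of B/tB, where A and B are
the two products. -/
theorem card_le [Finite T] [Finite T'] [NeZero t] (hT : ∀ y : T, t • y = 0)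
    {S : AddSubgroup (((Fin r → ℤ) × T) × ((Fin s → ℤ) × T'))} (h : IsModGraph t S) :
    t ^ r * Nat.card T ≤ t ^ s * Nat.card T' := by
  choose φ hφ using h.left_total
  let lift : (Fin r → ZMod t) × T → (Fin r → ℤ) × T := fun x => (fun i => (x.1 i).val, x.2)
  let red : (Fin s → ℤ) × T' → (Fin s → ZMod t) × T' := fun x => (fun i => x.1 i, x.2)
  have hinj : Function.Injective (red ∘ φ ∘ lift) := by
    intro x y hxy
    have h1 := congrArg (fun z => z.1) hxy
    have h2 : (φ (lift x)).2 = (φ (lift y)).2 := congrArg (fun z => z.2) hxy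
    have h3 : ∀ i, ∃ b, (φ (lift x)).1 i - (φ (lift y)).1 i = t * b := fun i => by
      have := congrFun h1 i
      exact (ZMod.intCast_eq_intCast_iff_dvd_sub _ _ t).1 this.symm
    choose b hb using h3
    have h4 : φ (lift x) - φ (lift y) = t • (b, 0) := by
      ext1
      · funext i
        simpa using hb i
      · simp [h2]
    have h5 := S.sub_mem (S.sub_mem (hφ (lift x)) (hφ (lift y))) ((h.zero_right _).2 ⟨_, h4⟩)
    have h6 : (lift x - lift y, (0 : (Fin s → ℤ) × T')) ∈ S := by
      convert h5 using 1
      ext1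
      · simp
      · simp
    obtain ⟨a, ha⟩ := (h.left_zero _).1 h6
    ext1
    · funext i
      have h7 := congrFun (congrArg Prod.fst ha) i
      have h8 : (((x.1 i).val : ℤ) : ZMod t) = (((y.1 i).val : ℤ) : ZMod t) := by
        rw [eq_comm, ZMod.intCast_eq_intCast_iff_dvd_sub]
        exact ⟨a.1 i, by simpa [lift] using h7⟩
      simpa using h8
    · have h7 := congrArg Prod.snd ha
      simp only [Prod.snd_sub, Prod.smul_snd, hT] at h7
      exact sub_eq_zero.1 h7
  have := Nat.card_le_card_of_injective _ hinj
  simpa [Nat.card_prod, Nat.card_pi] using this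

end IsModGraph

theorem AddCommGroup.exists_addEquiv_free_prod_finite
    (A : Type u) [AddCommGroup A] [AddGroup.FG A] :
    ∃ (r : ℕ) (T : Type) (_ : AddCommGroup T), Finite T ∧ Nonempty (A ≃+ (Fin r → ℤ) × T) := by
  obtain ⟨r, ι, hι, p, hp, e, ⟨f⟩⟩ := AddCommGroup.equiv_free_prod_directSum_zmod A
  have : ∀ i, NeZero (p i ^ e i) := fun i => ⟨pow_ne_zero _ (hp i).ne_zero⟩
  classical
  exact ⟨r, ∀ i, ZMod (p i ^ e i), inferInstance, inferInstance, ⟨f.trans (AddEquiv.prodCongr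
    (Finsupp.linearEquivFunOnFinite ℤ ℤ (Fin r)).toAddEquiv (DirectSum.addEquivProd _))⟩⟩

/-- Finitely generated abelian groups with the same quotients `A / mA` are isomorphic. -/
theorem AddCommGroup.nonempty_addEquiv_of_isModGraph {A : Type u} {B : Type v} [AddCommGroup A]
    [AddCommGroup B] [AddGroup.FG A] [AddGroup.FG B]
    (h : ∀ m : ℕ, m ≠ 0 → ∃ S : AddSubgroup (A × B), IsModGraph m S) : Nonempty (A ≃+ B) := by
  obtain ⟨r, T, hT, hTf, ⟨e⟩⟩ := AddCommGroup.exists_addEquiv_free_prod_finite A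
  obtain ⟨s, T', hT', hTf', ⟨f⟩⟩ := AddCommGroup.exists_addEquiv_free_prod_finite B
  -- This t annihilates both torsion groups; the factor 2 makes t > 1, so that t^r determines r.
  set t := 2 * (Nat.card T * Nat.card T') with ht
  have ht0 : t ≠ 0 := mul_ne_zero two_ne_zero (mul_ne_zero Nat.card_pos.ne' Nat.card_pos.ne')
  have ht1 : 1 < t := by
    have : 0 < Nat.card T * Nat.card T' := mul_pos Nat.card_pos Nat.card_pos
    omega
  have : NeZero t := ⟨ht0⟩
  have hkT : ∀ y : T, t • y = 0 := fun y => by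
    rw [ht, mul_left_comm, mul_smul, card_nsmul_eq_zero']
  have hkT' : ∀ y : T', t • y = 0 := fun y => by
    rw [ht, ← mul_assoc, mul_smul, card_nsmul_eq_zero', smul_zero]
  obtain ⟨S, hS⟩ := h t ht0
  obtain ⟨S₂, hS₂⟩ := h (t * t) (mul_ne_zero ht0 ht0)
  obtain ⟨φ, hφ⟩ := (hS₂.congr e.symm f.symm).exists_torsion_hom ht0 hkT hkT'
  obtain ⟨ψ, hψ⟩ := (hS₂.congr e.symm f.symm).symm.exists_torsion_hom ht0 hkT' hkT
  have hcard : Nat.card T = Nat.card T' :=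
    le_antisymm (Nat.card_le_card_of_injective φ hφ) (Nat.card_le_card_of_injective ψ hψ)
  have hpow : t ^ r = t ^ s := by
    have h1 := (hS.congr e.symm f.symm).card_le hkT
    have h2 := (hS.congr e.symm f.symm).symm.card_le hkT'
    rw [hcard] at h1 h2
    exact le_antisymm (Nat.le_of_mul_le_mul_right h1 Nat.card_pos)
      (Nat.le_of_mul_le_mul_right h2 Nat.card_pos)
  obtain rfl := Nat.pow_right_injective ht1 hpow
  have hbij : Function.Bijective φ := (Nat.bijective_iff_injective_and_card φ).2 ⟨hφ, hcard⟩
  exact ⟨(e.trans (AddEquiv.prodCongr (AddEquiv.refl _) (AddEquiv.ofBijective φ hbij))).trans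
    f.symm⟩

end Abelian

/-! ### Passing from finite quotients to linked lattices -/

section Transfer

/-- The intersection of the kernels of all homomorphisms to `Q`. -/
def homKernel (Q : Type w) [Group Q] (G : Type u) [Group G] : Subgroup G := ⨅ f : G →* Q, f.ker

theorem mem_homKernel {Q : Type w} [Group Q] {G : Type u} [Group G] {g : G} :
    g ∈ homKernel Q G ↔ ∀ f : G →* Q, f g = 1 := by
  simp [homKernel, Subgroup.mem_iInf, MonoidHom.mem_ker]

instance (Q : Type w) [Group Q] (G : Type u) [Group G] : (homKernel Q G).Normal :=
  Subgroup.normal_iInf_normal fun f => f.normal_ker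

theorem finite_monoidHom_of_fg {G : Type u} [Group G] (hG : Group.FG G)
    (Q : Type w) [Group Q] [Finite Q] :
    Finite (G →* Q) := by
  obtain ⟨S, hS⟩ := hG.out
  refine Finite.of_injective (fun (f : G →* Q) (s : S) => f s) fun f g hfg => ?_
  exact MonoidHom.eq_of_eqOn_dense hS fun s hs => congrFun hfg ⟨s, hs⟩

theorem finiteIndex_homKernel {G : Type u} [Group G] (hG : Group.FG G) (Q : Type w) [Group Q]
    [Finite Q] : (homKernel Q G).FiniteIndex := by
  have := finite_monoidHom_of_fg hG Q
  exact Subgroup.finiteIndex_iInf fun f => inferInstance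

/-- The action on G/N embeds into permutations of j points, and its kernel lies in N. Hence these
kernels become arbitrarily small. -/
theorem homKernel_perm_le {G : Type u} [Group G] (N : Subgroup G) [N.FiniteIndex] {j : ℕ}
    (hj : N.index ≤ j) : homKernel (Equiv.Perm (Fin j)) G ≤ N := by
  intro g hg
  have : Finite (G ⧸ N) := Subgroup.finite_quotient_of_finiteIndex
  have : Fintype (G ⧸ N) := Fintype.ofFinite _
  have hcard : Fintype.card (G ⧸ N) ≤ Fintype.card (Fin j) := by
    rw [Fintype.card_fin, ← Nat.card_eq_fintype_card]
    exact hj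
  obtain ⟨ι⟩ := Function.Embedding.nonempty_of_card_le hcard
  have h1 := mem_homKernel.1 hg ((Equiv.Perm.viaEmbeddingHom ι).comp
    (MulAction.toPermHom G (G ⧸ N)))
  rw [MonoidHom.comp_apply, map_eq_one_iff _ (Equiv.Perm.viaEmbeddingHom_injective ι)] at h1
  have h2 := congrArg (fun σ : Equiv.Perm (G ⧸ N) => σ ((1 : G) : G ⧸ N)) h1
  have h3 : ((g * 1 : G) : G ⧸ N) = ((1 : G) : G ⧸ N) := h2
  rw [mul_one] at h3
  simpa using QuotientGroup.eq.1 h3.symm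

theorem HasSameFiniteQuotients.symm {G : Type u} [Group G] {H : Type v} [Group H]
    (h : HasSameFiniteQuotients G H) : HasSameFiniteQuotients H G := ⟨h.2, h.1⟩

/-- Homomorphisms to Q separate the points of G/`homKernel Q G`, hence those of H/M. -/
theorem homKernel_le_of_mulEquiv {G : Type u} [Group G] {H : Type v} [Group H]
    {Q : Type w} [Group Q]
    (M : Subgroup H) [M.Normal] (e : (G ⧸ homKernel Q G) ≃* (H ⧸ M)) : homKernel Q H ≤ M := by
  intro h hh
  obtain ⟨g, hg⟩ := QuotientGroup.mk_surjective (e.symm h)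
  have h1 : g ∈ homKernel Q G := by
    rw [mem_homKernel]
    intro f
    have hf : homKernel Q G ≤ f.ker := fun x hx => mem_homKernel.1 hx f
    have h2 := mem_homKernel.1 hh
      (((QuotientGroup.lift (homKernel Q G) f hf).comp e.symm.toMonoidHom).comp
        (QuotientGroup.mk' M))
    change QuotientGroup.lift (homKernel Q G) f hf (e.symm h) = 1 at h2
    rw [← hg] at h2
    exact h2
  rw [(QuotientGroup.eq_one_iff g).2 h1, eq_comm, EmbeddingLike.map_eq_one_iff] at hg
  exact (QuotientGroup.eq_one_iff h).1 hg

/-- The quotient of G by its kernel is a quotient of H by some M containing the kernel of H; the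
symmetric statement forces equal indices, hence equality. -/
theorem HasSameFiniteQuotients.exists_homKernel {G : Type u} [Group G] {H : Type v} [Group H]
    (hs : HasSameFiniteQuotients G H) (hG : Group.FG G) (hH : Group.FG H) (Q : Type w) [Group Q]
    [Finite Q] : ∃ (F : Type v) (_ : Group F) (p : G →* F) (q : H →* F), Function.Surjective p ∧
      Function.Surjective q ∧ p.ker = homKernel Q G ∧ q.ker = homKernel Q H := by
  have hGi := finiteIndex_homKernel hG Q
  have hHi := finiteIndex_homKernel hH Q
  obtain ⟨M, hM, ⟨e⟩⟩ := hs.1 (homKernel Q G) inferInstance Subgroup.finite_quotient_of_finiteIndex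
  obtain ⟨N, hN, ⟨f⟩⟩ := hs.2 (homKernel Q H) inferInstance Subgroup.finite_quotient_of_finiteIndex
  have hMle := homKernel_le_of_mulEquiv M e
  have hNle := homKernel_le_of_mulEquiv N f
  have h1 : (homKernel Q G).index = M.index := Nat.card_congr e.toEquiv
  have h2 : (homKernel Q H).index = N.index := Nat.card_congr f.toEquiv
  have h3 := Subgroup.index_dvd_of_le hMle
  have h4 := Subgroup.index_dvd_of_le hNle
  have h5 : M.index = (homKernel Q H).index := by
    refine Nat.dvd_antisymm h3 ?_
    rw [← h1, h2]
    exact h4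
  have h6 : M = homKernel Q H := by
    refine le_antisymm ?_ hMle
    have h7 := Subgroup.relIndex_mul_index hMle
    rw [h5, mul_eq_right₀ hHi.index_ne_zero, Subgroup.relIndex_eq_one] at h7
    exact h7
  refine ⟨H ⧸ M, inferInstance, e.toMonoidHom.comp (QuotientGroup.mk' _), QuotientGroup.mk' M,
    e.surjective.comp (QuotientGroup.mk'_surjective _), QuotientGroup.mk'_surjective _, ?_, ?_⟩
  · ext x
    simp
  · rw [QuotientGroup.ker_mk', h6]

/-- Common finite quotients of two groups, with arbitrarily small kernels, such that the projection
of `G` to `G ⧸ L` corresponds to a fixed homomorphism from `H`. -/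
theorem HasSameFiniteQuotients.exists_coherent {G : Type u} [Group G] {H : Type v} [Group H]
    (hs : HasSameFiniteQuotients G H) (hG : Group.FG G) (hH : Group.FG H) (L : Subgroup G)
    [L.Normal] [L.FiniteIndex] : ∃ χ : H →* G ⧸ L, ∀ (N : Subgroup G) (M : Subgroup H),
      N.FiniteIndex → M.FiniteIndex → ∃ (F : Type v) (_ : Group F) (p : G →* F) (q : H →* F),
        Function.Surjective p ∧ Function.Surjective q ∧ p.ker ≤ N ∧ q.ker ≤ M ∧
        ∀ g h, p g = q h → χ h = g := by
  let Good (j : ℕ) (χ : H →* G ⧸ L) : Prop :=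
    ∃ (F : Type v) (_ : Group F) (p : G →* F) (q : H →* F),
      Function.Surjective p ∧ Function.Surjective q ∧ p.ker = homKernel (Equiv.Perm (Fin j)) G ∧
      q.ker = homKernel (Equiv.Perm (Fin j)) H ∧ ∀ g h, p g = q h → χ h = g
  have hgood : ∀ j, L.index ≤ j → ∃ χ, Good j χ := by
    intro j hj
    obtain ⟨F, _, p, q, hp, hq, hpk, hqk⟩ := hs.exists_homKernel hG hH (Equiv.Perm (Fin j))
    have hle : p.ker ≤ (QuotientGroup.mk' L).ker := by
      rw [hpk, QuotientGroup.ker_mk']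
      exact homKernel_perm_le L hj
    refine ⟨(p.liftOfSurjective hp ⟨QuotientGroup.mk' L, hle⟩).comp q, F, inferInstance, p, q, hp,
      hq,
      hpk, hqk, fun g h hgh => ?_⟩
    rw [MonoidHom.comp_apply, ← hgh]
    exact p.liftOfRightInverse_comp_apply _ (Function.rightInverse_surjInv hp)
      ⟨QuotientGroup.mk' L, hle⟩ g
  have hfin := finite_monoidHom_of_fg hH (G ⧸ L)
  -- Pigeonhole: Hom(H, G/L) is finite, so one χ occurs for arbitrarily large j. This replaces a
  -- limit over all finite quotients.
  obtain ⟨χ, hχ⟩ : ∃ χ, ∀ J, ∃ j ≥ J, Good j χ := by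
    by_contra! hcon
    choose J hJ using hcon
    cases nonempty_fintype (H →* G ⧸ L)
    obtain ⟨χ, hχ⟩ := hgood (Finset.univ.sup J + L.index) (by omega)
    exact hJ χ _ ((Finset.le_sup (Finset.mem_univ χ)).trans (Nat.le_add_right _ _)) hχ
  refine ⟨χ, fun N M hN hM => ?_⟩
  obtain ⟨j, hj, F, _, p, q, hp, hq, hpk, hqk, hc⟩ := hχ (N.index + M.index)
  refine ⟨F, inferInstance, p, q, hp, hq, ?_, ?_, hc⟩
  · rw [hpk]
    exact homKernel_perm_le N (by omega)
  · rw [hqk]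
    exact homKernel_perm_le M (by omega)

/-- The subgroup of `m`-th powers of elements of an abelian normal subgroup. -/
def powSubgroup {G : Type u} [Group G] (M : Subgroup G) (hM : ∀ x ∈ M, ∀ y ∈ M, x * y = y * x)
    (m : ℕ) : Subgroup G where
  carrier := {g | ∃ x ∈ M, g = x ^ m}
  one_mem' := ⟨1, M.one_mem, (one_pow m).symm⟩
  mul_mem' := by
    rintro _ _ ⟨x, hx, rfl⟩ ⟨y, hy, rfl⟩
    exact ⟨x * y, M.mul_mem hx hy, (Commute.mul_pow (hM x hx y hy) m).symm⟩
  inv_mem' := by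
    rintro _ ⟨x, hx, rfl⟩
    exact ⟨x⁻¹, M.inv_mem hx, (inv_pow x m).symm⟩

theorem mem_powSubgroup {G : Type u} [Group G] {M : Subgroup G}
    {hM : ∀ x ∈ M, ∀ y ∈ M, x * y = y * x} {m : ℕ} {g : G} :
    g ∈ powSubgroup M hM m ↔ ∃ x ∈ M, g = x ^ m := Iff.rfl

theorem powSubgroup_le {G : Type u} [Group G] {M : Subgroup G}
    {hM : ∀ x ∈ M, ∀ y ∈ M, x * y = y * x} {m : ℕ} : powSubgroup M hM m ≤ M := by
  rintro _ ⟨x, hx, rfl⟩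
  exact M.pow_mem hx m

theorem powSubgroup_normal {G : Type u} [Group G] {M : Subgroup G} [hN : M.Normal]
    (hM : ∀ x ∈ M, ∀ y ∈ M, x * y = y * x) (m : ℕ) : (powSubgroup M hM m).Normal where
  conj_mem := by
    rintro _ ⟨x, hx, rfl⟩ g
    exact ⟨g * x * g⁻¹, hN.conj_mem x hx g, conj_pow.symm⟩

/-- M is finitely generated, having finite index in G, so the quotient by its m-th powers is a
finitely generated torsion abelian group. -/
theorem finiteIndex_powSubgroup {G : Type u} [Group G] (hG : Group.FG G) {M : Subgroup G} [M.Normal]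
    [M.FiniteIndex] (hM : ∀ x ∈ M, ∀ y ∈ M, x * y = y * x) {m : ℕ} (hm : m ≠ 0) :
    (powSubgroup M hM m).FiniteIndex := by
  have hfg : Group.FG M := inferInstance
  let _ : CommGroup M := { mul_comm := fun x y => Subtype.ext (hM x x.2 y y.2) }
  have hfin : Finite (M ⧸ (powMonoidHom m : M →* M).range) := by
    refine CommGroup.finite_of_fg_isMulTorsion _ fun x => ?_
    obtain ⟨y, rfl⟩ := QuotientGroup.mk_surjective x
    refine isOfFinOrder_iff_pow_eq_one.2 ⟨m, Nat.pos_of_ne_zero hm, ?_⟩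
    rw [← QuotientGroup.mk_pow, QuotientGroup.eq_one_iff]
    exact ⟨y, rfl⟩
  have h1 : (powSubgroup M hM m).subgroupOf M = (powMonoidHom m : M →* M).range := by
    ext x
    rw [Subgroup.mem_subgroupOf]
    constructor
    · rintro ⟨y, hy, hxy⟩
      exact ⟨⟨y, hy⟩, Subtype.ext hxy.symm⟩
    · rintro ⟨y, rfl⟩
      exact ⟨y, y.2, rfl⟩
  have h2 : ((powSubgroup M hM m).subgroupOf M).FiniteIndex := by
    rw [h1]
    exact Subgroup.finiteIndex_of_finite_quotient
  constructor
  rw [← Subgroup.relIndex_mul_index (powSubgroup_le (hM := hM) (m := m))]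
  exact mul_ne_zero h2.index_ne_zero Subgroup.FiniteIndex.index_ne_zero

end Transfer

/-! ### The lattice of the second group and the abelianization -/

section Transfer

namespace LatticeFrame

variable {n : ℕ} {G : Type u} [Group G] (𝔤 : LatticeFrame n G)

theorem eq_zero_of_forall_nsmul {a : Fin n → ℤ} (h : ∀ m : ℕ, m ≠ 0 → ∃ b, a = m • b) : a = 0 := by
  funext i
  obtain ⟨b, hb⟩ := h ((a i).natAbs + 1) (Nat.succ_ne_zero _)
  refine Int.eq_zero_of_abs_lt_dvd (m := ((a i).natAbs + 1 : ℕ)) ⟨b i, ?_⟩ ?_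
  · conv_lhs => rw [hb]
    simp
  · rw [Int.abs_eq_natAbs]
    exact_mod_cast Nat.lt_succ_self _

theorem eq_sum_single (a : Fin n → ℤ) : a = ∑ i, a i • Pi.single i (1 : ℤ) :=
  pi_eq_sum_univ' a

include 𝔤 in
theorem fg : Group.FG G := by
  let S : Set G := (Set.range fun i => 𝔤.t (Pi.single i 1)) ∪
    Set.range fun x : G ⧸ 𝔤.lattice => Quotient.out x
  have : Finite (G ⧸ 𝔤.lattice) := Subgroup.finite_quotient_of_finiteIndex
  refine Group.fg_iff.2 ⟨S, (Subgroup.eq_top_iff' _).2 fun g => ?_,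
    (Set.finite_range _).union (Set.finite_range _)⟩
  have ht : ∀ a, 𝔤.t a ∈ Subgroup.closure S := by
    intro a
    change Multiplicative.ofAdd a ∈ (Subgroup.closure S).comap 𝔤.ι
    rw [eq_sum_single a, ofAdd_sum]
    refine prod_mem fun i _ => ?_
    rw [ofAdd_zsmul]
    refine zpow_mem ?_ _
    exact Subgroup.mem_comap.2 (Subgroup.subset_closure (Or.inl ⟨i, rfl⟩))
  obtain ⟨⟨y, hy⟩, hgy⟩ := QuotientGroup.mk_out_eq_mul 𝔤.lattice g
  obtain ⟨a, rfl⟩ := 𝔤.mem_lattice.1 hy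
  have h1 : g = Quotient.out (g : G ⧸ 𝔤.lattice) * (𝔤.t a)⁻¹ := by
    have hgy' : Quotient.out (g : G ⧸ 𝔤.lattice) = g * 𝔤.t a := hgy
    rw [hgy', mul_inv_cancel_right]
  rw [h1]
  exact mul_mem (Subgroup.subset_closure (Or.inr ⟨_, rfl⟩)) (inv_mem (ht a))

theorem mul_comm_of_mem : ∀ x ∈ 𝔤.lattice, ∀ y ∈ 𝔤.lattice, x * y = y * x := by
  intro x hx y hy
  obtain ⟨a, rfl⟩ := 𝔤.mem_lattice.1 hx
  obtain ⟨b, rfl⟩ := 𝔤.mem_lattice.1 hy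
  rw [← t_add, ← t_add, add_comm]

theorem mem_powSubgroup_lattice {m : ℕ} {g : G} :
    g ∈ powSubgroup 𝔤.lattice 𝔤.mul_comm_of_mem m ↔ ∃ a, g = 𝔤.t (m • a) := by
  rw [mem_powSubgroup]
  constructor
  · rintro ⟨x, hx, rfl⟩
    obtain ⟨a, rfl⟩ := 𝔤.mem_lattice.1 hx
    exact ⟨a, (𝔤.t_nsmul _ _).symm⟩
  · rintro ⟨a, rfl⟩
    exact ⟨𝔤.t a, 𝔤.t_mem a, 𝔤.t_nsmul _ _⟩

include 𝔤 in
theorem residuallyFinite : Group.ResiduallyFinite G := by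
  rw [Group.residuallyFinite_iff_forall_finiteIndex]
  intro g hg
  have h1 : ∀ m : ℕ, m ≠ 0 → ∃ a, g = 𝔤.t (m • a) := fun m hm => by
    have := finiteIndex_powSubgroup 𝔤.fg 𝔤.mul_comm_of_mem hm
    exact 𝔤.mem_powSubgroup_lattice.1 (hg _)
  obtain ⟨a, rfl⟩ := h1 1 one_ne_zero
  rw [t_eq_one]
  exact eq_zero_of_forall_nsmul fun m hm => (h1 m hm).imp fun b hb => 𝔤.t_injective hb

end LatticeFrame

namespace HasSameFiniteQuotients

variable {n : ℕ} {G : Type u} [Group G] {H : Type v} [Group H] {𝔤 : LatticeFrame n G}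

/-- Common quotients in which the kernels are the `m`-th powers of the lattices. -/
theorem exists_powers_ker {χ : H →* G ⧸ 𝔤.lattice}
    (hχ : ∀ (N : Subgroup G) (M : Subgroup H), N.FiniteIndex → M.FiniteIndex →
      ∃ (F : Type v) (_ : Group F) (p : G →* F) (q : H →* F),
        Function.Surjective p ∧ Function.Surjective q ∧ p.ker ≤ N ∧ q.ker ≤ M ∧
        ∀ g h, p g = q h → χ h = g)
    (hM : ∀ x ∈ χ.ker, ∀ y ∈ χ.ker, x * y = y * x) {m : ℕ}
    (hfi : (powSubgroup χ.ker hM m).FiniteIndex) (hm : m ≠ 0) :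
    ∃ (F : Type v) (_ : Group F) (p : G →* F) (q : H →* F),
      Function.Surjective p ∧ Function.Surjective q ∧ (∀ g, p g = 1 ↔ ∃ a, g = 𝔤.t (m • a)) ∧
      (∀ h, q h = 1 ↔ ∃ x ∈ χ.ker, h = x ^ m) ∧
      (∀ a, ∃ x ∈ χ.ker, p (𝔤.t a) = q x) ∧ (∀ x ∈ χ.ker, ∃ a, p (𝔤.t a) = q x) ∧
      ∀ h, ∃ g, p g = q h ∧ χ h = g := by
  obtain ⟨F, _, p, q, hp, hq, hpk, hqk, hc⟩ := hχ (powSubgroup 𝔤.lattice 𝔤.mul_comm_of_mem m)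
    (powSubgroup χ.ker hM m) (finiteIndex_powSubgroup 𝔤.fg 𝔤.mul_comm_of_mem hm) hfi
  have hex₁ : ∀ a, ∃ x ∈ χ.ker, p (𝔤.t a) = q x := fun a => by
    obtain ⟨x, hx⟩ := hq (p (𝔤.t a))
    refine ⟨x, ?_, hx.symm⟩
    rw [MonoidHom.mem_ker, hc _ x hx.symm, QuotientGroup.eq_one_iff]
    exact 𝔤.t_mem a
  have hex₂ : ∀ x ∈ χ.ker, ∃ a, p (𝔤.t a) = q x := fun x hx => by
    obtain ⟨g, hg⟩ := hp (q x)
    have h1 := hc g x hg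
    rw [MonoidHom.mem_ker.1 hx, eq_comm, QuotientGroup.eq_one_iff] at h1
    obtain ⟨a, rfl⟩ := 𝔤.mem_lattice.1 h1
    exact ⟨a, hg⟩
  have hN := powSubgroup_normal 𝔤.mul_comm_of_mem m
  -- The kernels of p and q are only contained in the subgroups of m-th powers; dividing F by the
  -- common image of these subgroups makes them equal.
  let K : Subgroup F := (powSubgroup 𝔤.lattice 𝔤.mul_comm_of_mem m).map p
  have hK : K.Normal := hN.map p hp
  refine ⟨F ⧸ K, inferInstance, (QuotientGroup.mk' K).comp p, (QuotientGroup.mk' K).comp q,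
    (QuotientGroup.mk'_surjective K).comp hp, (QuotientGroup.mk'_surjective K).comp hq,
    fun g => ?_, fun h => ?_, fun a => ?_, fun x hx => ?_, fun h => ?_⟩
  · rw [MonoidHom.comp_apply, QuotientGroup.mk'_apply, QuotientGroup.eq_one_iff,
      ← 𝔤.mem_powSubgroup_lattice, ← Subgroup.mem_comap, Subgroup.comap_map_eq,
      sup_eq_left.2 hpk]
  · rw [MonoidHom.comp_apply, QuotientGroup.mk'_apply, QuotientGroup.eq_one_iff]
    constructor
    · rintro ⟨g, hg, hgh⟩
      obtain ⟨a, rfl⟩ := 𝔤.mem_powSubgroup_lattice.1 hg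
      obtain ⟨x, hx, hxa⟩ := hex₁ a
      have h1 : h * (x ^ m)⁻¹ ∈ q.ker := by
        rw [MonoidHom.mem_ker, map_mul, map_inv, map_pow, ← hxa, ← map_pow, ← 𝔤.t_nsmul, hgh,
          mul_inv_cancel]
      obtain ⟨y, hy, hyx⟩ := hqk h1
      refine ⟨y * x, mul_mem hy hx, ?_⟩
      rw [Commute.mul_pow (hM y hy x hx), ← hyx, inv_mul_cancel_right]
    · rintro ⟨x, hx, rfl⟩
      obtain ⟨a, ha⟩ := hex₂ x hx
      exact ⟨𝔤.t (m • a), 𝔤.mem_powSubgroup_lattice.2 ⟨a, rfl⟩, by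
        rw [𝔤.t_nsmul, map_pow, ha, map_pow]⟩
  · obtain ⟨x, hx, hxa⟩ := hex₁ a
    exact ⟨x, hx, congrArg (QuotientGroup.mk' K) hxa⟩
  · obtain ⟨a, ha⟩ := hex₂ x hx
    exact ⟨a, congrArg (QuotientGroup.mk' K) ha⟩
  · obtain ⟨g, hg⟩ := hp (q h)
    exact ⟨g, congrArg (QuotientGroup.mk' K) hg, hc g h hg⟩

/-- If `G` has a self-centralizing lattice of finite index, then so has every finitely generated
residually finite group with the same finite quotients. -/
theorem exists_latticeFrame (𝔤 : LatticeFrame n G) (hs : HasSameFiniteQuotients G H)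
    (hH : Group.FG H) (hrf : Group.ResiduallyFinite H) :
    ∃ 𝔥 : LatticeFrame n H, ∀ m : ℕ, m ≠ 0 →
      ∃ (F : Type v) (_ : Group F), Nonempty (LatticeLink 𝔤 𝔥 m F) := by
  obtain ⟨χ, hχ⟩ := hs.exists_coherent 𝔤.fg hH 𝔤.lattice
  have : Finite (G ⧸ 𝔤.lattice) := Subgroup.finite_quotient_of_finiteIndex
  -- In every common quotient `χ.ker` lands in the image of the abelian lattice of G; by residual
  -- finiteness its commutators vanish.
  have hM : ∀ x ∈ χ.ker, ∀ y ∈ χ.ker, x * y = y * x := by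
    intro x hx y hy
    rw [← mul_inv_eq_one]
    refine Group.residuallyFinite_iff_forall_finiteIndex.1 hrf _ fun N _ => ?_
    obtain ⟨F, _, p, q, hp, hq, -, hqk, hc⟩ := hχ ⊤ N inferInstance inferInstance
    refine hqk ?_
    obtain ⟨g, hg⟩ := hp (q x)
    obtain ⟨k, hk⟩ := hp (q y)
    have hg1 := hc g x hg
    have hk1 := hc k y hk
    rw [MonoidHom.mem_ker.1 hx, eq_comm, QuotientGroup.eq_one_iff] at hg1
    rw [MonoidHom.mem_ker.1 hy, eq_comm, QuotientGroup.eq_one_iff] at hk1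
    rw [MonoidHom.mem_ker, map_mul, map_inv, map_mul, map_mul, ← hg, ← hk, ← map_mul,
      𝔤.mul_comm_of_mem g hg1 k hk1, map_mul, mul_inv_cancel]
  have hpow := fun (m : ℕ) (hm : m ≠ 0) =>
    exists_powers_ker hχ hM (finiteIndex_powSubgroup hH hM hm) hm
  have hiso : Nonempty (Multiplicative (Fin n → ℤ) ≃* χ.ker) := by
    have hfg : Group.FG χ.ker := inferInstance
    let _ : CommGroup χ.ker := { mul_comm := fun x y => Subtype.ext (hM x x.2 y y.2) }
    have : AddGroup.FG (Additive χ.ker) := inferInstance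
    have : AddGroup.FG (Fin n → ℤ) := inferInstance
    obtain ⟨e⟩ := AddCommGroup.nonempty_addEquiv_of_isModGraph (A := Fin n → ℤ)
      (B := Additive χ.ker) fun m hm => by
        obtain ⟨F, _, p, q, hp, hq, hp1, hq1, hex₁, hex₂, -⟩ := hpow m hm
        refine ⟨{ carrier := {x | p (𝔤.t x.1) = q (x.2.toMul : χ.ker)}
                  zero_mem' := ?_
                  add_mem' := ?_
                  neg_mem' := ?_ }, ?_, ?_, ?_, ?_⟩
        · intro x y hx hy
          change p (𝔤.t (x.1 + y.1)) = q ((x.2.toMul : χ.ker) * (y.2.toMul : χ.ker))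
          rw [𝔤.t_add, map_mul, map_mul]
          exact congrArg₂ _ hx hy
        · change p (𝔤.t 0) = q 1
          simp
        · intro x hx
          change p (𝔤.t (-x.1)) = q ((x.2.toMul : χ.ker)⁻¹)
          rw [𝔤.t_neg, map_inv, map_inv]
          exact congrArg _ hx
        · intro a
          obtain ⟨x, hx, hxa⟩ := hex₁ a
          exact ⟨Additive.ofMul ⟨x, hx⟩, hxa⟩
        · intro b
          exact hex₂ b.toMul b.toMul.2
        · intro a
          change p (𝔤.t a) = q 1 ↔ _
          rw [map_one, hp1]
          exact exists_congr fun b => 𝔤.t_injective.eq_iff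
        · intro b
          change p (𝔤.t 0) = q (b.toMul : χ.ker) ↔ _
          rw [𝔤.t_zero, map_one, eq_comm, hq1]
          constructor
          · rintro ⟨x, hx, hbx⟩
            exact ⟨Additive.ofMul ⟨x, hx⟩, Subtype.ext hbx⟩
          · rintro ⟨c, rfl⟩
            exact ⟨c.toMul, c.toMul.2, rfl⟩
    exact ⟨AddEquiv.toMultiplicativeLeft e⟩
  obtain ⟨e⟩ := hiso
  -- An element g over χ h acts trivially on the lattice of G modulo every m, hence trivially, hence
  -- lies in that lattice.
  have hcent : ∀ h, (∀ x ∈ χ.ker, h * x * h⁻¹ = x) → h ∈ χ.ker := by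
    intro h hh
    obtain ⟨g, hg⟩ := QuotientGroup.mk_surjective (χ h)
    rw [MonoidHom.mem_ker, ← hg, QuotientGroup.eq_one_iff]
    change 𝔤.R g = 1
    rw [𝔤.R_eq_one_iff]
    intro a
    rw [← sub_eq_zero]
    refine LatticeFrame.eq_zero_of_forall_nsmul fun m hm => ?_
    obtain ⟨F, _, p, q, hp, hq, hp1, hq1, hex₁, hex₂, hlift⟩ := hpow m hm
    obtain ⟨g', hg', hχg'⟩ := hlift h
    obtain ⟨x, hx, hxa⟩ := hex₁ a
    have h1 : 𝔤.R g = 𝔤.R g' := 𝔤.R_eq_of_inv_mul_mem (by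
      rw [← QuotientGroup.eq, ← hχg']
      exact hg)
    have h2 : p (𝔤.t (𝔤.act g a - a)) = 1 := by
      rw [𝔤.t_sub, 𝔤.act_apply, h1, ← 𝔤.act_apply, ← 𝔤.conj_t, map_mul, map_mul, map_mul, map_inv,
        map_inv, hxa, hg', ← map_inv, ← map_mul, ← map_mul, hh x hx, mul_inv_cancel]
    obtain ⟨b, hb⟩ := (hp1 _).1 h2
    exact ⟨b, 𝔤.t_injective hb⟩
  refine ⟨LatticeFrame.ofSubgroup χ.ker e hcent, fun m hm => ?_⟩
  have hmem : ∀ x, x ∈ χ.ker ↔ ∃ a, x = (LatticeFrame.ofSubgroup χ.ker e hcent).t a := fun x => by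
    rw [← LatticeFrame.mem_lattice, LatticeFrame.ofSubgroup_lattice]
  obtain ⟨F, _, p, q, hp, hq, hp1, hq1, hex₁, hex₂, -⟩ := hpow m hm
  refine ⟨F, inferInstance, ⟨⟨p, q, hp, hq, hp1, fun h => ?_, fun a => ?_, fun b => ?_⟩⟩⟩
  · rw [hq1]
    constructor
    · rintro ⟨x, hx, rfl⟩
      obtain ⟨a, rfl⟩ := (hmem x).1 hx
      exact ⟨a, (LatticeFrame.t_nsmul _ _ _).symm⟩
    · rintro ⟨a, rfl⟩
      exact ⟨_, (hmem _).2 ⟨a, rfl⟩, LatticeFrame.t_nsmul _ _ _⟩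
  · obtain ⟨x, hx, hxa⟩ := hex₁ a
    obtain ⟨b, rfl⟩ := (hmem x).1 hx
    exact ⟨b, hxa⟩
  · exact hex₂ _ ((hmem _).2 ⟨b, rfl⟩)

end HasSameFiniteQuotients

theorem abelianization_of_surjective {G : Type u} [Group G] :
    Function.Surjective (Abelianization.of : G →* Abelianization G) := QuotientGroup.mk_surjective

/-- Both the commutator subgroup of F and c lift to G, and the remaining ambiguity in the kernel of
p is an m-th power. -/
theorem exists_abelianization_of_eq_pow {G : Type u} [Group G] {F : Type w} [Group F] {m : ℕ}
    (p : G →* F) (hp : Function.Surjective p) (hpk : ∀ g, p g = 1 → ∃ y, g = y ^ m) (x : G) (c : F)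
    (hx : Abelianization.of (p x) = Abelianization.of c ^ m) :
    ∃ y, Abelianization.of x = Abelianization.of y ^ m := by
  obtain ⟨d, rfl⟩ := hp c
  have h1 : p (x * (d ^ m)⁻¹) ∈ _root_.commutator F := by
    rw [← Abelianization.ker_of, MonoidHom.mem_ker, map_mul, map_inv, map_mul, map_inv, hx,
      map_pow, map_pow, mul_inv_cancel]
  have h2 : _root_.commutator F = (_root_.commutator G).map p := by
    rw [commutator_def, commutator_def, Subgroup.map_commutator, ← MonoidHom.range_eq_map,
      MonoidHom.range_eq_top.2 hp]
  rw [h2] at h1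
  obtain ⟨k, hk, hkx⟩ := h1
  obtain ⟨y, hy⟩ := hpk (x * (d ^ m)⁻¹ * k⁻¹) (by
    rw [map_mul _ _ k⁻¹, map_inv, hkx, mul_inv_cancel])
  have hk' : Abelianization.of k = 1 := by
    rw [← MonoidHom.mem_ker, Abelianization.ker_of]
    exact hk
  refine ⟨d * y, ?_⟩
  have h3 := congrArg Abelianization.of hy
  rw [map_mul, map_mul, map_inv, map_inv, hk', map_pow, map_pow, inv_one, mul_one] at h3
  rw [map_mul, mul_pow, ← h3, mul_comm, inv_mul_cancel_right]

/-- Linked groups have abelianizations with the same quotients modulo `m`. -/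
theorem LatticeLink.exists_isModGraph {n : ℕ} {G : Type u} [Group G] {H : Type v} [Group H]
    {𝔤 : LatticeFrame n G} {𝔥 : LatticeFrame n H} {m : ℕ} {F : Type w} [Group F]
    (l : LatticeLink 𝔤 𝔥 m F) : ∃ S : AddSubgroup (Additive (Abelianization G) ×
      Additive (Abelianization H)), IsModGraph m S := by
  let f : Additive (Abelianization G) →+ Additive (Abelianization F) :=
    MonoidHom.toAdditive (Abelianization.map l.p)
  let g : Additive (Abelianization H) →+ Additive (Abelianization F) :=
    MonoidHom.toAdditive (Abelianization.map l.q)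
  have hp1 : ∀ g, l.p g = 1 → ∃ y, g = y ^ m := fun g hg => by
    obtain ⟨a, rfl⟩ := (l.p_eq_one g).1 hg
    exact ⟨_, 𝔤.t_nsmul _ _⟩
  have hq1 : ∀ h, l.q h = 1 → ∃ y, h = y ^ m := fun h hh => by
    obtain ⟨a, rfl⟩ := (l.q_eq_one h).1 hh
    exact ⟨_, 𝔥.t_nsmul _ _⟩
  let Z := (nsmulAddMonoidHom m : Additive (Abelianization F) →+ _).range
  have hZ : ∀ z, z ∈ Z ↔ ∃ c, m • c = z := fun z => Iff.rfl
  have hfs : ∀ z, ∃ a, f a = z := fun z => by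
    obtain ⟨c, rfl⟩ := abelianization_of_surjective z
    obtain ⟨x, rfl⟩ := l.p_surjective c
    exact ⟨Additive.ofMul (Abelianization.of x), rfl⟩
  have hgs : ∀ z, ∃ a, g a = z := fun z => by
    obtain ⟨c, rfl⟩ := abelianization_of_surjective z
    obtain ⟨x, rfl⟩ := l.q_surjective c
    exact ⟨Additive.ofMul (Abelianization.of x), rfl⟩
  -- Two classes are related when their images in the abelianization of F agree modulo m-th
  -- multiples.
  refine ⟨Z.comap ((f.comp (AddMonoidHom.fst _ _)) - (g.comp (AddMonoidHom.snd _ _))), ?_, ?_, ?_,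
    ?_⟩
  · intro a
    obtain ⟨b, hb⟩ := hgs (f a)
    refine ⟨b, ?_⟩
    change f a - g b ∈ Z
    rw [hb, sub_self]
    exact Z.zero_mem
  · intro b
    obtain ⟨a, ha⟩ := hfs (g b)
    refine ⟨a, ?_⟩
    change f a - g b ∈ Z
    rw [ha, sub_self]
    exact Z.zero_mem
  · intro a
    change f a - g 0 ∈ Z ↔ _
    rw [map_zero, sub_zero, hZ]
    constructor
    · rintro ⟨c, hc⟩
      obtain ⟨x, rfl⟩ := abelianization_of_surjective a
      obtain ⟨c, rfl⟩ := abelianization_of_surjective c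
      obtain ⟨y, hy⟩ := exists_abelianization_of_eq_pow l.p l.p_surjective hp1 x c hc.symm
      exact ⟨Additive.ofMul (Abelianization.of y), hy⟩
    · rintro ⟨c, rfl⟩
      exact ⟨f c, (map_nsmul _ _ _).symm⟩
  · intro b
    change f 0 - g b ∈ Z ↔ _
    rw [map_zero, zero_sub, neg_mem_iff, hZ]
    constructor
    · rintro ⟨c, hc⟩
      obtain ⟨x, rfl⟩ := abelianization_of_surjective b
      obtain ⟨c, rfl⟩ := abelianization_of_surjective c
      obtain ⟨y, hy⟩ := exists_abelianization_of_eq_pow l.q l.q_surjective hq1 x c hc.symm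
      exact ⟨Additive.ofMul (Abelianization.of y), hy⟩
    · rintro ⟨c, rfl⟩
      exact ⟨g c, (map_nsmul _ _ _).symm⟩

end Transfer

/-! ### Realization as a crystallographic group -/

section Realization

open Matrix Topology

/-- The isometries δ with δ 0 within 1 of γ 0 form a neighbourhood of γ meeting Γ in a finite set,
and the topology is Hausdorff. -/
theorem isCrystallographic_of_finite {n : ℕ} {Γ : Subgroup (EIsom n)}
    (hfin : ∀ R : ℝ, {γ : EIsom n | γ ∈ Γ ∧ ‖γ 0‖ ≤ R}.Finite)
    (hK : ∃ K : Set (ESpace n), IsCompact K ∧ ∀ x, ∃ γ ∈ Γ, γ x ∈ K) : IsCrystallographic Γ := by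
  refine ⟨?_, hK⟩
  have hind : IsInducing fun (γ : EIsom n) (x : ESpace n) => γ x := ⟨rfl⟩
  have hemb : IsEmbedding fun (γ : EIsom n) (x : ESpace n) => γ x :=
    ⟨hind, fun γ δ h => IsometryEquiv.ext fun x => congrFun h x⟩
  have : T2Space (EIsom n) := hemb.t2Space
  rw [discreteTopology_iff_isOpen_singleton]
  intro γ
  have hcont : Continuous fun δ : Γ => (δ : EIsom n) 0 :=
    ((continuous_apply (0 : ESpace n)).comp hind.continuous).comp continuous_subtype_val
  refine isOpen_singleton_of_finite_mem_nhds γ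
    (hcont.continuousAt.preimage_mem_nhds (Metric.ball_mem_nhds _ one_pos)) ?_
  refine Set.Finite.of_finite_image (f := Subtype.val)
    ((hfin (‖(γ : EIsom n) 0‖ + 1)).subset ?_) Subtype.val_injective.injOn
  rintro _ ⟨δ, hδ, rfl⟩
  refine ⟨δ.2, ?_⟩
  rw [Set.mem_preimage, Metric.mem_ball, dist_eq_norm] at hδ
  have := norm_add_le ((δ : EIsom n) 0 - (γ : EIsom n) 0) ((γ : EIsom n) 0)
  rw [sub_add_cancel] at this
  linarith

namespace LatticeFrame

variable {n : ℕ} {G : Type u} [Group G] (𝔤 : LatticeFrame n G)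

/-- A crossed homomorphism which is multiplication by the index on the lattice. -/
theorem exists_crossedHom : ∃ U : G → Fin n → ℤ, (∀ g h, U (g * h) = 𝔤.act g (U h) + U g) ∧
    ∀ a, U (𝔤.t a) = 𝔤.lattice.index • a := by
  classical
  have : Fintype (G ⧸ 𝔤.lattice) := Subgroup.fintypeQuotientOfFiniteIndex
  let s : G ⧸ 𝔤.lattice → G := Quotient.out
  have hs : ∀ x : G ⧸ 𝔤.lattice, ((s x : G) : G ⧸ 𝔤.lattice) = x := fun x => Quotient.out_eq' x
  have hex : ∀ (g : G) (x : G ⧸ 𝔤.lattice), ∃ a, g * s x = 𝔤.t a * s (g • x) := by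
    intro g x
    have h1 : g * s x * (s (g • x))⁻¹ ∈ 𝔤.lattice := by
      rw [← QuotientGroup.eq_one_iff, QuotientGroup.mk_mul, QuotientGroup.mk_inv, hs,
        mul_inv_eq_one]
      conv_rhs => rw [← hs x]
      rfl
    obtain ⟨a, ha⟩ := 𝔤.mem_lattice.1 h1
    exact ⟨a, by rw [← ha, inv_mul_cancel_right]⟩
  choose b hb using hex
  -- A transfer: `b g x` is the lattice defect of g on the representative of x. A translation by a
  -- fixes every coset with defect a.
  refine ⟨fun g => ∑ x, b g x, fun g h => ?_, fun a => ?_⟩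
  · have h1 : ∀ x, b (g * h) x = 𝔤.act g (b h x) + b g (h • x) := by
      intro x
      apply 𝔤.t_injective
      apply mul_right_cancel (b := s ((g * h) • x))
      rw [← hb, mul_assoc, hb, ← mul_assoc, mul_t, mul_assoc, hb, 𝔤.t_add, mul_assoc, mul_smul]
    have h2 : ∑ x, b g (h • x) = ∑ x, b g x := Equiv.sum_comp (MulAction.toPerm h) (b g)
    beta_reduce
    rw [Finset.sum_congr rfl fun x _ => h1 x, Finset.sum_add_distrib, sum_act, h2]
  · have h1 : ∀ x, b (𝔤.t a) x = a := by
      intro x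
      have h2 : 𝔤.t a • x = x := by
        obtain ⟨g, rfl⟩ := QuotientGroup.mk_surjective x
        change ((𝔤.t a * g : G) : G ⧸ 𝔤.lattice) = g
        rw [QuotientGroup.mk_mul, (QuotientGroup.eq_one_iff _).2 (𝔤.t_mem a), one_mul]
      have h3 := hb (𝔤.t a) x
      rw [h2] at h3
      exact (𝔤.t_injective (mul_right_cancel h3)).symm
    beta_reduce
    rw [Finset.sum_congr rfl fun x _ => h1 x, Finset.sum_const, Finset.card_univ,
      ← Nat.card_eq_fintype_card]
    rfl

/-- The real representation on the lattice. -/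
noncomputable def realRep : G →* Matrix (Fin n) (Fin n) ℝ :=
  ((Int.castRingHom ℝ).mapMatrix : Matrix (Fin n) (Fin n) ℤ →+*
    Matrix (Fin n) (Fin n) ℝ).toMonoidHom.comp
    ((Units.coeHom _).comp 𝔤.R)

theorem realRep_apply (g : G) :
    𝔤.realRep g = (𝔤.R g : Matrix (Fin n) (Fin n) ℤ).map (Int.cast : ℤ → ℝ) := rfl

theorem realRep_eq_of_inv_mul_mem {g h : G} (hgh : g⁻¹ * h ∈ 𝔤.lattice) :
    𝔤.realRep g = 𝔤.realRep h := by
  rw [realRep_apply, realRep_apply, 𝔤.R_eq_of_inv_mul_mem hgh]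

theorem realRep_mulVec_intCast (g : G) (a : Fin n → ℤ) :
    𝔤.realRep g *ᵥ (fun i => (a i : ℝ)) = fun i => (𝔤.act g a i : ℝ) := by
  funext i
  simp [realRep_apply, mulVec, dotProduct, act_apply]

/-- The real representation is equivalent to an orthogonal one. -/
theorem exists_orthogonal_model : ∃ T : (Fin n → ℝ) ≃ₗ[ℝ] ESpace n,
    ∀ g v, ‖T (𝔤.realRep g *ᵥ v)‖ = ‖T v‖ := by
  classical
  have : Fintype (G ⧸ 𝔤.lattice) := Subgroup.fintypeQuotientOfFiniteIndex
  let s : G ⧸ 𝔤.lattice → G := Quotient.out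
  have hs : ∀ x : G ⧸ 𝔤.lattice, ((s x : G) : G ⧸ 𝔤.lattice) = x := fun x => Quotient.out_eq' x
  -- Record all translates of v under the finite point group; g permutes the entries, so the
  -- Euclidean norm pulled back along J is invariant.
  let J : (Fin n → ℝ) →ₗ[ℝ] EuclideanSpace ℝ ((G ⧸ 𝔤.lattice) × Fin n) :=
    { toFun := fun v => WithLp.toLp 2 fun x => (𝔤.realRep (s x.1)⁻¹ *ᵥ v) x.2
      map_add' := fun v w => by
        ext x
        simp [mulVec_add]
      map_smul' := fun c v => by
        ext x
        simp [mulVec_smul] }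
  have hJ : ∀ v x, J v x = (𝔤.realRep (s x.1)⁻¹ *ᵥ v) x.2 := fun _ _ => rfl
  have hnorm : ∀ g v, ‖J (𝔤.realRep g *ᵥ v)‖ = ‖J v‖ := by
    intro g v
    rw [EuclideanSpace.norm_eq, EuclideanSpace.norm_eq]
    congr 1
    refine Fintype.sum_equiv ((MulAction.toPerm g⁻¹).prodCongr (Equiv.refl _)) _ _ fun x => ?_
    obtain ⟨x, i⟩ := x
    have h1 : 𝔤.realRep ((s x)⁻¹ * g) = 𝔤.realRep (s (g⁻¹ • x))⁻¹ := by
      apply 𝔤.realRep_eq_of_inv_mul_mem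
      have h2 : s x * (g * s (g⁻¹ • x))⁻¹ ∈ 𝔤.lattice := by
        rw [← QuotientGroup.eq_one_iff, QuotientGroup.mk_mul, QuotientGroup.mk_inv, hs,
          mul_inv_eq_one]
        change x = g • ((s (g⁻¹ • x) : G) : G ⧸ 𝔤.lattice)
        rw [hs, smul_inv_smul]
      have h3 := (inferInstance : 𝔤.lattice.Normal).conj_mem _ h2 g⁻¹
      convert h3 using 1
      group
    have h2 : (𝔤.realRep (s x)⁻¹ *ᵥ (𝔤.realRep g *ᵥ v)) = 𝔤.realRep (s (g⁻¹ • x))⁻¹ *ᵥ v := by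
      rw [mulVec_mulVec, ← map_mul, h1]
    rw [hJ, hJ]
    simp only [h2]
    rfl
  have hinj : Function.Injective J := by
    rw [injective_iff_map_eq_zero]
    intro v hv
    have h1 : 𝔤.realRep (s 1)⁻¹ *ᵥ v = 0 := by
      funext i
      rw [← hJ v (1, i), hv]
      rfl
    have h2 : 𝔤.realRep (s 1) *ᵥ (𝔤.realRep (s 1)⁻¹ *ᵥ v) = v := by
      rw [mulVec_mulVec, ← map_mul, mul_inv_cancel, map_one, one_mulVec]
    rw [← h2, h1, mulVec_zero]
  have hrank : Module.finrank ℝ (LinearMap.range J) = n := by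
    rw [LinearMap.finrank_range_of_inj hinj, Module.finrank_fin_fun]
  let b := (stdOrthonormalBasis ℝ (LinearMap.range J)).reindex (finCongr hrank)
  refine ⟨(LinearEquiv.ofInjective J hinj).trans b.repr.toLinearEquiv, fun g v => ?_⟩
  have hT : ∀ v, ‖((LinearEquiv.ofInjective J hinj).trans b.repr.toLinearEquiv) v‖ = ‖J v‖ :=
    fun v => b.repr.norm_map _
  rw [hT, hT, hnorm]

include 𝔤 in
/-- A group with a self-centralizing lattice of rank `n` of finite index is a crystallographic
group. -/
theorem isCrystallographicGroup : IsCrystallographicGroup n G := by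
  obtain ⟨U, hU, hUt⟩ := 𝔤.exists_crossedHom
  obtain ⟨T, hT⟩ := 𝔤.exists_orthogonal_model
  set N := 𝔤.lattice.index with hNdef
  have hN : (N : ℝ) ≠ 0 := by
    exact_mod_cast (Subgroup.FiniteIndex.index_ne_zero : 𝔤.lattice.index ≠ 0)
  -- Over ℝ the crossed homomorphism can be divided by the index, so that c(t a) = a. Then g acts
  -- affinely by v ↦ ρ(g)v + c(g).
  let c : G → Fin n → ℝ := fun g i => (U g i : ℝ) / N
  have hc : ∀ g h, c (g * h) = 𝔤.realRep g *ᵥ c h + c g := by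
    intro g h
    have h1 : c h = (N : ℝ)⁻¹ • fun i => (U h i : ℝ) := by
      funext i
      simp [c, div_eq_inv_mul]
    rw [h1, mulVec_smul, realRep_mulVec_intCast]
    funext i
    simp only [c, hU, Pi.add_apply, Int.cast_add, Pi.smul_apply, smul_eq_mul]
    ring
  have hct : ∀ a, c (𝔤.t a) = fun i => (a i : ℝ) := by
    intro a
    funext i
    simp only [c, hUt, Pi.smul_apply, nsmul_eq_mul, Int.cast_mul, Int.cast_natCast]
    field_simp
  have hc1 : c 1 = 0 := by
    have h1 := hct 0
    rw [t_zero] at h1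
    rw [h1]
    funext i
    simp
  let f : G → ESpace n → ESpace n := fun g x => T (𝔤.realRep g *ᵥ T.symm x + c g)
  have hf1 : ∀ x, f 1 x = x := fun x => by simp [f, hc1]
  have hfm : ∀ g h x, f (g * h) x = f g (f h x) := fun g h x => by
    simp only [f, hc, T.symm_apply_apply, map_mul, mulVec_add, mulVec_mulVec, add_assoc]
  have hfi : ∀ g, Isometry (f g) := fun g => Isometry.of_dist_eq fun x y => by
    simp only [f, dist_eq_norm]
    rw [← map_sub, add_sub_add_right_eq_sub, ← mulVec_sub, ← map_sub, hT, T.apply_symm_apply]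
  let Φ : G →* EIsom n :=
    { toFun := fun g => IsometryEquiv.mk' (f g) (f g⁻¹)
        (fun x => by rw [← hfm, mul_inv_cancel, hf1]) (hfi g)
      map_one' := IsometryEquiv.ext hf1
      map_mul' := fun g h => IsometryEquiv.ext (hfm g h) }
  have hΦ : ∀ g x, Φ g x = f g x := fun _ _ => rfl
  -- A coset and the integral vector U g determine g; bounded orbits of 0 leave finitely many such
  -- data.
  have hcoset : ∀ g h : G, (g : G ⧸ 𝔤.lattice) = h → U g = U h → g = h := by
    intro g h hgh hUgh
    obtain ⟨a, ha⟩ := 𝔤.mem_lattice.1 (QuotientGroup.eq.1 hgh)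
    have h1 : h = g * 𝔤.t a := by rw [← ha, mul_inv_cancel_left]
    have h2 : N • 𝔤.act g a = N • (0 : Fin n → ℤ) := by
      rw [h1, hU, hUt, map_nsmul] at hUgh
      rw [smul_zero]
      exact (right_eq_add.1 hUgh)
    have h3 := eq_of_nsmul_eq (Subgroup.FiniteIndex.index_ne_zero : 𝔤.lattice.index ≠ 0) h2
    have h4 : a = 0 := by
      rw [← 𝔤.act_inv_act g a, h3, map_zero]
    rw [h1, h4, t_zero, mul_one]
  have hΦi : Function.Injective Φ := by
    rw [injective_iff_map_eq_one]
    intro g hg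
    have h1 : ∀ x, f g x = x := fun x => by rw [← hΦ, hg]; rfl
    have h2 : c g = 0 := by
      have := h1 0
      simpa [f] using this
    have h3 : ∀ v, 𝔤.realRep g *ᵥ v = v := fun v => by
      have := h1 (T v)
      simpa [f, h2] using this
    have h4 : g ∈ 𝔤.lattice := by
      change 𝔤.R g = 1
      rw [R_eq_one_iff]
      intro a
      have h5 := 𝔤.realRep_mulVec_intCast g a
      rw [h3] at h5
      funext i
      exact_mod_cast (congrFun h5 i).symm
    obtain ⟨a, rfl⟩ := 𝔤.mem_lattice.1 h4
    rw [hct] at h2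
    rw [t_eq_one]
    funext i
    have h3 := congrFun h2 i
    simpa using h3
  refine ⟨Φ.range, isCrystallographic_of_finite (fun R => ?_) ?_, ⟨MonoidHom.ofInjective hΦi⟩⟩
  · have hfin : Finite (G ⧸ 𝔤.lattice) := Subgroup.finite_quotient_of_finiteIndex
    let T' := T.symm.toContinuousLinearEquiv
    obtain ⟨B, hB⟩ := exists_nat_ge ((N : ℝ) * (‖(T' : ESpace n →L[ℝ] (Fin n → ℝ))‖ * R))
    have hsub : {γ : EIsom n | γ ∈ Φ.range ∧ ‖γ 0‖ ≤ R} ⊆ Φ '' {g | ‖f g 0‖ ≤ R} := by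
      rintro _ ⟨⟨g, rfl⟩, hg⟩
      exact ⟨g, hg, rfl⟩
    refine Set.Finite.subset (Set.Finite.image _ ?_) hsub
    refine Set.Finite.of_finite_image (f := fun g => ((g : G ⧸ 𝔤.lattice), U g))
      (((Set.finite_univ (α := G ⧸ 𝔤.lattice)).prod
        (Set.finite_Icc (fun _ => -(B : ℤ)) (fun _ => (B : ℤ)))).subset ?_)
      (fun g _ h _ hgh => hcoset g h (congrArg Prod.fst hgh) (congrArg Prod.snd hgh))
    rintro _ ⟨g, hg, rfl⟩
    refine ⟨Set.mem_univ _, ?_⟩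
    have h1 : T' (f g 0) = c g := by
      change T.symm (f g 0) = c g
      simp [f]
    have h2 : ∀ i, |(U g i : ℝ)| ≤ B := by
      intro i
      have h3 : ‖c g‖ ≤ ‖(T' : ESpace n →L[ℝ] (Fin n → ℝ))‖ * R := by
        rw [← h1]
        exact ((T' : ESpace n →L[ℝ] (Fin n → ℝ)).le_opNorm _).trans
          (mul_le_mul_of_nonneg_left hg (norm_nonneg _))
      have h4 : (U g i : ℝ) = N * c g i := by
        simp only [c]
        field_simp
      rw [h4, abs_mul, Nat.abs_cast]
      refine le_trans ?_ hB
      refine mul_le_mul_of_nonneg_left ((norm_le_pi_norm (c g) i).trans h3) (Nat.cast_nonneg _)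
    have h5 : ∀ i, |U g i| ≤ B := fun i => by exact_mod_cast h2 i
    exact ⟨fun i => (abs_le.1 (h5 i)).1, fun i => (abs_le.1 (h5 i)).2⟩
  · refine ⟨T '' Set.Icc 0 1, ?_, fun x => ?_⟩
    · exact isCompact_Icc.image T.toContinuousLinearEquiv.continuous
    · let a : Fin n → ℤ := fun i => -⌊T.symm x i⌋
      refine ⟨Φ (𝔤.t a), ⟨_, rfl⟩, T.symm x + c (𝔤.t a), ?_, ?_⟩
      · rw [hct]
        constructor
        · intro i
          have := Int.floor_le (T.symm x i)
          simp only [Pi.zero_apply, Pi.add_apply, a, Int.cast_neg]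
          linarith
        · intro i
          have := Int.lt_floor_add_one (T.symm x i)
          simp only [Pi.one_apply, Pi.add_apply, a, Int.cast_neg]
          linarith
      · rw [hΦ]
        have h1 : 𝔤.realRep (𝔤.t a) = 1 := by
          rw [realRep_apply, R_t]
          simp
        simp only [f, h1, one_mulVec]

end LatticeFrame

end Realization

/-! ### Crystallographic groups as groups with a lattice frame -/

section Crystallographic

open Matrix

variable {n : ℕ} {Γ : Subgroup (EIsom n)}

theorem toPointGroup_surjective (Γ : Subgroup (EIsom n)) : Function.Surjective (toPointGroup Γ) :=
  (linearPart n).subgroupMap_surjective Γ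

theorem toPointGroup_eq_one {γ : Γ} : toPointGroup Γ γ = 1 ↔ lin (γ : EIsom n) = 1 := by
  rw [Subtype.ext_iff]
  change linearPart n γ = 1 ↔ _
  constructor
  · intro h
    ext1 x
    rw [lin_eq_linearPart, h]
    rfl
  · intro h
    ext1 x
    rw [← lin_eq_linearPart, h]
    rfl

theorem IsCrystallographic.finite_pointGroup (h : IsCrystallographic Γ) :
    Finite (pointGroup Γ) := by
  have := h.finite_lin.to_subtype
  have hmem : ∀ A : pointGroup Γ, ((A : ESpace n ≃ₗᵢ[ℝ] ESpace n).toContinuousLinearEquiv :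
      ESpace n →L[ℝ] ESpace n) ∈ lin '' (Γ : Set (EIsom n)) := by
    rintro ⟨_, γ, hγ, rfl⟩
    exact ⟨γ, hγ, rfl⟩
  refine Finite.of_injective (fun A => (⟨_, hmem A⟩ : lin '' (Γ : Set (EIsom n))))
    fun A B hAB => ?_
  apply Subtype.ext
  ext1 x
  exact DFunLike.congr_fun (congrArg Subtype.val hAB) x

theorem IsCrystallographic.finiteIndex_ker (h : IsCrystallographic Γ) :
    (toPointGroup Γ).ker.FiniteIndex := by
  have : Finite (pointGroup Γ) := h.finite_pointGroup
  have : Finite (toPointGroup Γ).range := inferInstance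
  exact Subgroup.finiteIndex_ker _

/-- Vectors of the lattice correspond to the elements of the group with trivial linear part. -/
noncomputable def latticeEquiv (Γ : Subgroup (EIsom n)) :
    Multiplicative (translationLattice Γ) ≃* (toPointGroup Γ).ker where
  toFun v := ⟨⟨IsometryEquiv.addRight (v.toAdd : ESpace n), v.toAdd.2⟩, by
    rw [MonoidHom.mem_ker, toPointGroup_eq_one]
    exact lin_addRight _⟩
  invFun γ := Multiplicative.ofAdd ⟨(γ : Γ).1 0, by
    rw [mem_translationLattice, ← eq_addRight_of_lin_eq_one (toPointGroup_eq_one.1 γ.2)]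
    exact (γ : Γ).2⟩
  left_inv v := by
    apply Multiplicative.toAdd.injective
    apply Subtype.ext
    simp
  right_inv γ := by
    apply Subtype.ext
    apply Subtype.ext
    exact (eq_addRight_of_lin_eq_one (toPointGroup_eq_one.1 γ.2)).symm
  map_mul' v w := by
    apply Subtype.ext
    apply Subtype.ext
    ext1 x
    change x + ((v.toAdd : ESpace n) + w.toAdd) = x + w.toAdd + v.toAdd
    abel

theorem latticeEquiv_apply (v : translationLattice Γ) :
    ((latticeEquiv Γ (Multiplicative.ofAdd v) : Γ) : EIsom n) =
      IsometryEquiv.addRight (v : ESpace n) := rfl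

theorem conj_addRight (γ : EIsom n) (v : ESpace n) :
    γ * IsometryEquiv.addRight v * γ⁻¹ = IsometryEquiv.addRight (lin γ v) := by
  apply EIsom.ext_lin
  · rw [map_mul, map_mul, lin_addRight, lin_addRight, mul_one, lin_mul_lin_inv]
  · change γ (γ⁻¹ 0 + v) = 0 + lin γ v
    rw [apply_eq_lin, map_add, zero_add, add_right_comm, ← apply_eq_lin γ]
    change (γ * γ⁻¹) 0 + _ = _
    rw [mul_inv_cancel]
    exact zero_add _

/-- Conjugation acts on translations through the linear part, and the lattice spans the space. -/
theorem IsCrystallographic.mem_ker_of_conj_eq (h : IsCrystallographic Γ) (γ : Γ)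
    (hγ : ∀ x ∈ (toPointGroup Γ).ker, γ * x * γ⁻¹ = x) : γ ∈ (toPointGroup Γ).ker := by
  rw [MonoidHom.mem_ker, toPointGroup_eq_one]
  have h1 : ∀ v ∈ translationLattice Γ, lin (γ : EIsom n) v = v := by
    intro v hv
    have h2 := hγ _ (latticeEquiv Γ (Multiplicative.ofAdd ⟨v, hv⟩)).2
    have h3 := congrArg (Subtype.val : Γ → EIsom n) h2
    rw [Subgroup.coe_mul, Subgroup.coe_mul, Subgroup.coe_inv, latticeEquiv_apply,
      conj_addRight] at h3
    have h4 := congrArg (fun δ : EIsom n => δ 0) h3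
    simpa using h4
  have h2 : ((lin (γ : EIsom n) : ESpace n →L[ℝ] ESpace n) : ESpace n →ₗ[ℝ] ESpace n) =
      LinearMap.id := LinearMap.ext_on h.span_translationLattice fun v hv => h1 v hv
  ext1 x
  exact LinearMap.congr_fun h2 x

/-- The frame of a crystallographic group given by a basis of its lattice of translations. -/
noncomputable def IsCrystallographic.frame (h : IsCrystallographic Γ)
    (b : Module.Basis (Fin n) ℤ (translationLattice Γ)) : LatticeFrame n Γ :=
  have := h.finiteIndex_ker
  LatticeFrame.ofSubgroup (toPointGroup Γ).ker
    ((AddEquiv.toMultiplicative b.equivFun.symm.toAddEquiv).trans (latticeEquiv Γ))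
    h.mem_ker_of_conj_eq

theorem IsCrystallographic.frame_lattice (h : IsCrystallographic Γ)
    (b : Module.Basis (Fin n) ℤ (translationLattice Γ)) :
    (h.frame b).lattice = (toPointGroup Γ).ker :=
  have := h.finiteIndex_ker
  LatticeFrame.ofSubgroup_lattice _ _ h.mem_ker_of_conj_eq

theorem IsCrystallographic.frame_t (h : IsCrystallographic Γ)
    (b : Module.Basis (Fin n) ℤ (translationLattice Γ)) (a : Fin n → ℤ) :
    (((h.frame b).t a : Γ) : EIsom n) =
      IsometryEquiv.addRight ((b.equivFun.symm a : translationLattice Γ) : ESpace n) := rfl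

theorem IsCrystallographic.lin_basis (h : IsCrystallographic Γ)
    (b : Module.Basis (Fin n) ℤ (translationLattice Γ)) (γ : Γ) (j : Fin n) :
    lin (γ : EIsom n) (b j : ESpace n) =
      ∑ i, ((h.frame b).R γ : Matrix (Fin n) (Fin n) ℤ) i j • (b i : ESpace n) := by
  have h1 := congrArg (Subtype.val : Γ → EIsom n) ((h.frame b).conj_t γ (Pi.single j 1))
  rw [Subgroup.coe_mul, Subgroup.coe_mul, Subgroup.coe_inv, frame_t, frame_t, conj_addRight] at h1
  have h2 := congrArg (fun δ : EIsom n => δ 0) h1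
  simp only [IsometryEquiv.addRight_apply, zero_add] at h2
  have h3 : b.equivFun.symm (Pi.single j 1) = b j := by
    rw [b.equivFun_symm_apply]
    simp [Pi.single_apply]
  rw [h3, b.equivFun_symm_apply, LatticeFrame.act_apply, mulVec_single_one] at h2
  rw [h2]
  simp [Matrix.col_apply]

theorem IsCrystallographic.mem_range_iff (h : IsCrystallographic Γ)
    (b : Module.Basis (Fin n) ℤ (translationLattice Γ)) (M : GL (Fin n) ℤ) :
    M ∈ (h.frame b).R.range ↔ ∃ A ∈ pointGroup Γ, ∀ j : Fin n,
      A (b j : ESpace n) = ∑ i : Fin n, (M : Matrix (Fin n) (Fin n) ℤ) i j • (b i : ESpace n) := by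
  constructor
  · rintro ⟨γ, rfl⟩
    exact ⟨linearPart n γ, ⟨γ, γ.2, rfl⟩, h.lin_basis b γ⟩
  · rintro ⟨_, ⟨γ, hγ, rfl⟩, hM⟩
    refine ⟨⟨γ, hγ⟩, ?_⟩
    apply Units.ext
    ext i j
    have h1 := h.lin_basis b ⟨γ, hγ⟩ j
    have h2 : ∑ i, ((h.frame b).R ⟨γ, hγ⟩ : Matrix (Fin n) (Fin n) ℤ) i j • b i =
        ∑ i, (M : Matrix (Fin n) (Fin n) ℤ) i j • b i := by
      apply Subtype.ext
      have h4 := h1.symm.trans (hM j)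
      simpa using h4
    have h3 := congrArg (fun v => b.repr v i) h2
    simpa [Finsupp.single_apply] using h3

theorem IsCrystallographic.isIntegralPointGroup_range (h : IsCrystallographic Γ)
    (b : Module.Basis (Fin n) ℤ (translationLattice Γ)) :
    IsIntegralPointGroup Γ (h.frame b).R.range :=
  ⟨b, h.mem_range_iff b⟩

/-- Lets every matrix form of the point group be treated by changing only the basis of the frame. -/
theorem IsIntegralPointGroup.exists_eq_range {P : Subgroup (GL (Fin n) ℤ)}
    (hP : IsIntegralPointGroup Γ P) (h : IsCrystallographic Γ) :
    ∃ b : Module.Basis (Fin n) ℤ (translationLattice Γ), P = (h.frame b).R.range := by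
  obtain ⟨b, hb⟩ := hP
  exact ⟨b, Subgroup.ext fun M => (hb M).trans (h.mem_range_iff b M).symm⟩

/-- A section of the point group is encoded as an endomorphism killing L and trivial modulo L, a
form that does not mention the realization. -/
theorem isSymmorphic_iff {G : Type u} [Group G] (e : G ≃* Γ) (L : Subgroup G)
    (hL : ∀ g, g ∈ L ↔ toPointGroup Γ (e g) = 1) : IsSymmorphic Γ ↔
      ∃ r : G →* G, (∀ g ∈ L, r g = 1) ∧ ∀ g, r g * g⁻¹ ∈ L := by
  constructor
  · rintro ⟨s, hs⟩
    refine ⟨e.symm.toMonoidHom.comp (s.comp ((toPointGroup Γ).comp e.toMonoidHom)),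
      fun g hg => ?_, fun g => ?_⟩
    · have := (hL g).1 hg
      change e.symm (s (toPointGroup Γ (e g))) = 1
      rw [this, map_one, map_one]
    · rw [hL]
      change toPointGroup Γ (e (e.symm (s (toPointGroup Γ (e g))) * g⁻¹)) = 1
      have h1 := DFunLike.congr_fun hs (toPointGroup Γ (e g))
      change toPointGroup Γ (s (toPointGroup Γ (e g))) = toPointGroup Γ (e g) at h1
      rw [map_mul, map_mul, e.apply_symm_apply, h1, map_inv, map_inv, mul_inv_cancel]
  · rintro ⟨r, hr1, hr2⟩
    let π : G →* pointGroup Γ := (toPointGroup Γ).comp e.toMonoidHom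
    have hπ : Function.Surjective π := (toPointGroup_surjective Γ).comp e.surjective
    have hle : π.ker ≤ r.ker := fun g hg => hr1 g ((hL g).2 hg)
    refine ⟨e.toMonoidHom.comp (π.liftOfSurjective hπ ⟨r, hle⟩), ?_⟩
    ext1 A
    obtain ⟨g, rfl⟩ := hπ A
    have h1 : π.liftOfSurjective hπ ⟨r, hle⟩ (π g) = r g :=
      π.liftOfRightInverse_comp_apply _ (Function.rightInverse_surjInv hπ) ⟨r, hle⟩ g
    change toPointGroup Γ (e (π.liftOfSurjective hπ ⟨r, hle⟩ (π g))) = toPointGroup Γ (e g)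
    rw [h1, ← mul_inv_eq_one, ← map_inv, ← map_mul, ← map_inv, ← map_mul]
    exact (hL _).1 (hr2 g)

end Crystallographic

/-! ### Choice of moduli and proof of the proposition -/

section Conclusion

open Matrix

theorem nonempty_mulEquiv_of_ker_eq {G A B : Type*} [Group G] [Group A] [Group B] (f : G →* A)
    (g : G →* B) (hf : Function.Surjective f) (hg : Function.Surjective g)
    (h : ∀ x, f x = 1 ↔ g x = 1) : Nonempty (A ≃* B) :=
  ⟨((QuotientGroup.quotientKerEquivOfSurjective f hf).symm.trans
    (QuotientGroup.quotientMulEquivOfEq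
      (show f.ker = g.ker from Subgroup.ext fun x => by
        rw [MonoidHom.mem_ker, MonoidHom.mem_ker]; exact h x))).trans
    (QuotientGroup.quotientKerEquivOfSurjective g hg)⟩

theorem LatticeFrame.exists_t_smul_iff {n : ℕ} {G : Type u} [Group G] (𝔤 𝔤' : LatticeFrame n G)
    {m : ℕ} {g : G} : (∃ a, g = 𝔤.t (m • a)) ↔ ∃ a, g = 𝔤'.t (m • a) := by
  rw [← mem_powSubgroup_lattice, ← mem_powSubgroup_lattice, mem_powSubgroup, mem_powSubgroup,
    𝔤.lattice_eq 𝔤']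

/-- Replace the frame of the second group. -/
theorem LatticeLink.exists_of_frame {n : ℕ} {G : Type u} [Group G] {H : Type v} [Group H]
    {𝔤 : LatticeFrame n G} {𝔥 : LatticeFrame n H} {m : ℕ} {F : Type w} [Group F]
    (l : LatticeLink 𝔤 𝔥 m F) (𝔥' : LatticeFrame n H) : Nonempty (LatticeLink 𝔤 𝔥' m F) := by
  have h1 : ∀ b, ∃ c, 𝔥.t b = 𝔥'.t c := fun b => by
    rw [← 𝔥'.mem_lattice, 𝔥'.lattice_eq 𝔥]
    exact 𝔥.t_mem b
  have h2 : ∀ b, ∃ c, 𝔥'.t b = 𝔥.t c := fun b => by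
    rw [← 𝔥.mem_lattice, 𝔥.lattice_eq 𝔥']
    exact 𝔥'.t_mem b
  refine ⟨⟨l.p, l.q, l.p_surjective, l.q_surjective, l.p_eq_one,
    fun h => (l.q_eq_one h).trans (𝔥.exists_t_smul_iff 𝔥'), fun a => ?_, fun b => ?_⟩⟩
  · obtain ⟨b, hb⟩ := l.exists_right a
    obtain ⟨c, hc⟩ := h1 b
    exact ⟨c, by rw [hb, hc]⟩
  · obtain ⟨c, hc⟩ := h2 b
    rw [hc]
    exact l.exists_left c

/-- An injective integral intertwiner has nonzero determinant, so it is invertible over ℚ and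
conjugates one image onto the other. -/
theorem RationallyEquivalent.inSameQClass {n : ℕ} {G : Type u} [Group G] {H : Type v} [Group H]
    {𝔤 : LatticeFrame n G} {𝔥 : LatticeFrame n H} {rel : G → H → Prop}
    (e : RationallyEquivalent 𝔤 𝔥 rel) : InSameQClass 𝔤.R.range 𝔥.R.range := by
  obtain ⟨X, hX, hXe⟩ := e.intertwiner
  have hmul : ∀ v, LinearMap.toMatrix' X *ᵥ v = X v := fun v => LinearMap.toMatrix'_mulVec X v
  have hdet : (LinearMap.toMatrix' X).det ≠ 0 := by
    intro h0
    obtain ⟨v, hv, hv0⟩ := Matrix.exists_mulVec_eq_zero_iff.2 h0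
    rw [hmul] at hv0
    exact hv (hX (by rw [hv0, map_zero]))
  let Y : GL (Fin n) ℚ := Matrix.GeneralLinearGroup.mkOfDetNeZero
    ((Int.castRingHom ℚ).mapMatrix (LinearMap.toMatrix' X)) (by
      rw [← RingHom.map_det]
      simpa using hdet)
  have hY : ∀ g h, rel g h → Matrix.GeneralLinearGroup.map (Int.castRingHom ℚ) (𝔥.R h) =
      Y * Matrix.GeneralLinearGroup.map (Int.castRingHom ℚ) (𝔤.R g) * Y⁻¹ := by
    intro g h hgh
    rw [eq_mul_inv_iff_mul_eq]
    apply Units.ext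
    have h1 : (𝔥.R h : Matrix (Fin n) (Fin n) ℤ) * LinearMap.toMatrix' X =
        LinearMap.toMatrix' X * (𝔤.R g : Matrix (Fin n) (Fin n) ℤ) := by
      apply Matrix.toLin'.injective
      refine LinearMap.ext fun a => ?_
      rw [Matrix.toLin'_apply, Matrix.toLin'_apply, ← mulVec_mulVec, ← mulVec_mulVec, hmul, hmul]
      exact (hXe g h hgh a).symm
    have h2 := congrArg (Int.castRingHom ℚ).mapMatrix h1
    rw [map_mul, map_mul] at h2
    exact h2
  refine ⟨Y, ?_⟩
  ext y
  constructor
  · rintro ⟨_, ⟨h, rfl⟩, rfl⟩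
    obtain ⟨g, hg⟩ := e.right_total h
    exact ⟨_, ⟨_, ⟨g, rfl⟩, rfl⟩, (hY g h hg).symm⟩
  · rintro ⟨_, ⟨_, ⟨g, rfl⟩, rfl⟩, rfl⟩
    obtain ⟨h, hh⟩ := e.left_total g
    exact ⟨_, ⟨h, rfl⟩, hY g h hh⟩

theorem IsCrystallographicGroup.nonempty_frame {n : ℕ} {G : Type u} [Group G]
    (hG : IsCrystallographicGroup n G) : Nonempty (LatticeFrame n G) := by
  obtain ⟨Γ, hΓ, ⟨e⟩⟩ := hG
  obtain ⟨b⟩ := hΓ.nonempty_basis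
  exact ⟨(hΓ.frame b).map e.symm⟩

theorem IsCrystallographic.mem_map_frame_lattice {n : ℕ} {G : Type u} [Group G]
    {Γ : Subgroup (EIsom n)} (hΓ : IsCrystallographic Γ)
    (b : Module.Basis (Fin n) ℤ (translationLattice Γ)) (e : G ≃* Γ) (g : G) :
    g ∈ ((hΓ.frame b).map e.symm).lattice ↔ toPointGroup Γ (e g) = 1 := by
  change e g ∈ (hΓ.frame b).lattice ↔ _
  rw [hΓ.frame_lattice]
  rfl

theorem IsCrystallographic.map_frame_range {n : ℕ} {G : Type u} [Group G]
    {Γ : Subgroup (EIsom n)} (hΓ : IsCrystallographic Γ)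
    (b : Module.Basis (Fin n) ℤ (translationLattice Γ)) (e : G ≃* Γ) :
    ((hΓ.frame b).map e.symm).R.range = (hΓ.frame b).R.range := by
  change ((hΓ.frame b).R.comp e.toMonoidHom).range = _
  rw [MonoidHom.range_comp, MonoidHom.range_eq_top.2 e.surjective, MonoidHom.range_eq_map]

/-- The constructed frame of H may be replaced by any given one, since the lattice is unique. Hence
the results hold for all realizations. -/
theorem HasSameFiniteQuotients.exists_link {n : ℕ} {G : Type u} [Group G] {H : Type v} [Group H]
    (hs : HasSameFiniteQuotients G H) (𝔤 : LatticeFrame n G) (𝔥 : LatticeFrame n H)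
    (hrf : Group.ResiduallyFinite H) {m : ℕ} (hm : m ≠ 0) :
    ∃ (F : Type v) (_ : Group F), Nonempty (LatticeLink 𝔤 𝔥 m F) := by
  obtain ⟨𝔥', h⟩ := HasSameFiniteQuotients.exists_latticeFrame 𝔤 hs 𝔥.fg hrf
  obtain ⟨F, _, ⟨l⟩⟩ := h m hm
  exact ⟨F, inferInstance, l.exists_of_frame 𝔥⟩

theorem HasSameFiniteQuotients.exists_rationallyEquivalent {n : ℕ} {G : Type u} [Group G]
    {H : Type v} [Group H] (hs : HasSameFiniteQuotients G H) (𝔤 : LatticeFrame n G)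
    (𝔥 : LatticeFrame n H) (hrf : Group.ResiduallyFinite H) :
    ∃ rel, RationallyEquivalent 𝔤 𝔥 rel := by
  -- A prime exceeding both indices divides neither.
  obtain ⟨m, hm, hmp⟩ := Nat.exists_infinite_primes (𝔤.lattice.index + 𝔥.lattice.index + 1)
  obtain ⟨F, _, ⟨l⟩⟩ := hs.exists_link 𝔤 𝔥 hrf hmp.ne_zero
  have h1 : 𝔤.lattice.index ≠ 0 := Subgroup.FiniteIndex.index_ne_zero
  have h2 : 𝔥.lattice.index ≠ 0 := Subgroup.FiniteIndex.index_ne_zero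
  refine ⟨_, l.rationallyEquivalent hmp (fun h => ?_) fun h => ?_⟩
  · have := Nat.le_of_dvd (Nat.pos_of_ne_zero h1) h
    omega
  · have := Nat.le_of_dvd (Nat.pos_of_ne_zero h2) h
    omega

theorem HasSameFiniteQuotients.nonempty_abelianization {n : ℕ} {G : Type u} [Group G]
    {H : Type v} [Group H] (hs : HasSameFiniteQuotients G H) (𝔤 : LatticeFrame n G)
    (𝔥 : LatticeFrame n H) (hrf : Group.ResiduallyFinite H) :
    Nonempty (Abelianization G ≃* Abelianization H) := by
  have hG := 𝔤.fg
  have hH := 𝔥.fg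
  have : Group.FG (Abelianization G) := Group.fg_of_surjective abelianization_of_surjective
  have : Group.FG (Abelianization H) := Group.fg_of_surjective abelianization_of_surjective
  have : AddGroup.FG (Additive (Abelianization G)) := inferInstance
  have : AddGroup.FG (Additive (Abelianization H)) := inferInstance
  obtain ⟨e⟩ := AddCommGroup.nonempty_addEquiv_of_isModGraph
    (A := Additive (Abelianization G)) (B := Additive (Abelianization H)) fun m hm => by
      obtain ⟨F, _, ⟨l⟩⟩ := hs.exists_link 𝔤 𝔥 hrf hm
      exact l.exists_isModGraph
  exact ⟨MulEquiv.toAdditive.symm e⟩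

theorem HasSameFiniteQuotients.exists_orderIso {n : ℕ} {G : Type u} [Group G]
    {H : Type v} [Group H] (hs : HasSameFiniteQuotients G H) (𝔤 : LatticeFrame n G)
    (𝔥 : LatticeFrame n H) (hrf : Group.ResiduallyFinite H) :
    ∃ α : ConjFiniteSubgroups G ≃o ConjFiniteSubgroups H,
      ∀ (A : FiniteSubgroup G) (B : FiniteSubgroup H),
        α (ConjFiniteSubgroups.mk A) = ConjFiniteSubgroups.mk B → Nonempty (A.1 ≃* B.1) := by
  have hN : 𝔤.lattice.index * 𝔥.lattice.index ≠ 0 :=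
    mul_ne_zero Subgroup.FiniteIndex.index_ne_zero Subgroup.FiniteIndex.index_ne_zero
  obtain ⟨F, _, ⟨l⟩⟩ := hs.exists_link 𝔤 𝔥 hrf (mul_ne_zero hN hN)
  exact l.exists_orderIso rfl hN (Dvd.intro _ rfl) (Dvd.intro_left _ rfl)

theorem HasSameFiniteQuotients.exists_retraction {n : ℕ} {G : Type u} [Group G]
    {H : Type v} [Group H] (hs : HasSameFiniteQuotients G H) (𝔤 : LatticeFrame n G)
    (𝔥 : LatticeFrame n H) (hrf : Group.ResiduallyFinite H) :
    (∃ r : G →* G, (∀ g ∈ 𝔤.lattice, r g = 1) ∧ ∀ g, r g * g⁻¹ ∈ 𝔤.lattice) →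
      ∃ r : H →* H, (∀ g ∈ 𝔥.lattice, r g = 1) ∧ ∀ g, r g * g⁻¹ ∈ 𝔥.lattice := by
  obtain ⟨F, _, ⟨l⟩⟩ := hs.exists_link 𝔤 𝔥 hrf
    (Subgroup.FiniteIndex.index_ne_zero : 𝔤.lattice.index ≠ 0)
  exact l.exists_retraction rfl

/-- The point group, the splitting and the `ℚ`-class of the point group are determined by the finite
quotients, for all realizations. -/
theorem HasSameFiniteQuotients.realizations {n : ℕ} {G : Type u} [Group G] {H : Type v} [Group H]
    (hs : HasSameFiniteQuotients G H) (hrf : Group.ResiduallyFinite H) {Γ Γ' : Subgroup (EIsom n)}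
    (hΓ : IsCrystallographic Γ) (hΓ' : IsCrystallographic Γ') (e : G ≃* Γ) (e' : H ≃* Γ') :
    Nonempty (pointGroup Γ ≃* pointGroup Γ') ∧ (IsSymmorphic Γ ↔ IsSymmorphic Γ') ∧
      PointGroupsInSameQClass Γ Γ' := by
  obtain ⟨b⟩ := hΓ.nonempty_basis
  obtain ⟨b'⟩ := hΓ'.nonempty_basis
  set 𝔤 := (hΓ.frame b).map e.symm with h𝔤
  set 𝔥 := (hΓ'.frame b').map e'.symm with h𝔥
  have hL := hΓ.mem_map_frame_lattice b e
  have hL' := hΓ'.mem_map_frame_lattice b' e'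
  refine ⟨?_, ?_, ⟨_, hΓ.isIntegralPointGroup_range b⟩, ⟨_, hΓ'.isIntegralPointGroup_range b'⟩, ?_⟩
  -- For m = 1 the kernels are the whole lattices, so F is isomorphic to both point groups.
  · obtain ⟨F, _, ⟨l⟩⟩ := hs.exists_link 𝔤 𝔥 hrf one_ne_zero
    obtain ⟨f⟩ := nonempty_mulEquiv_of_ker_eq ((toPointGroup Γ).comp e.toMonoidHom) l.p
      ((toPointGroup_surjective Γ).comp e.surjective) l.p_surjective fun g => by
        rw [l.p_eq_one]
        simp only [one_smul]
        rw [← 𝔤.mem_lattice]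
        exact (hL g).symm
    obtain ⟨f'⟩ := nonempty_mulEquiv_of_ker_eq ((toPointGroup Γ').comp e'.toMonoidHom) l.q
      ((toPointGroup_surjective Γ').comp e'.surjective) l.q_surjective fun h => by
        rw [l.q_eq_one]
        simp only [one_smul]
        rw [← 𝔥.mem_lattice]
        exact (hL' h).symm
    exact ⟨f.trans f'.symm⟩
  · rw [isSymmorphic_iff e _ hL, isSymmorphic_iff e' _ hL']
    exact ⟨hs.exists_retraction 𝔤 𝔥 hrf, hs.symm.exists_retraction 𝔥 𝔤 𝔤.residuallyFinite⟩
  · intro P P' hP hP'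
    obtain ⟨c, rfl⟩ := hP.exists_eq_range hΓ
    obtain ⟨c', rfl⟩ := hP'.exists_eq_range hΓ'
    obtain ⟨rel, hrel⟩ := hs.exists_rationallyEquivalent ((hΓ.frame c).map e.symm)
      ((hΓ'.frame c').map e'.symm) hrf
    have := hrel.inSameQClass
    rwa [hΓ.map_frame_range, hΓ'.map_frame_range] at this

theorem proposition1p2 (n : ℕ) (G : Type u) [Group G] (hG : IsCrystallographicGroup n G) :
    (ProfinitelyRigidRelativeTo (fun (K : Type u) [Group K] => IsCrystallographicGroup n K) G →
      ProfinitelyRigid G) ∧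
    ∀ (H : Type v) [Group H], Group.FG H → Group.ResiduallyFinite H →
      HasSameFiniteQuotients G H →
      IsCrystallographicGroup n H ∧
      (∃ α : ConjFiniteSubgroups G ≃o ConjFiniteSubgroups H,
        ∀ (A : FiniteSubgroup G) (B : FiniteSubgroup H),
          α (ConjFiniteSubgroups.mk A) = ConjFiniteSubgroups.mk B → Nonempty (A.1 ≃* B.1)) ∧
      (TorsionFreeGroup G ↔ TorsionFreeGroup H) ∧
      (CentrelessGroup G ↔ CentrelessGroup H) ∧
      (JustInfinite G ↔ JustInfinite H) ∧
      Nonempty (Abelianization G ≃* Abelianization H) ∧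
      -- the point groups and the splitting, for all realizations of `G` and `H` as discrete
      -- cocompact groups of isometries
      ∀ Γ Γ' : Subgroup (EIsom n), IsCrystallographic Γ → IsCrystallographic Γ' →
        Nonempty (G ≃* Γ) → Nonempty (H ≃* Γ') →
        Nonempty (pointGroup Γ ≃* pointGroup Γ') ∧
        (IsSymmorphic Γ ↔ IsSymmorphic Γ') ∧
        PointGroupsInSameQClass Γ Γ' := by
  obtain ⟨𝔤⟩ := hG.nonempty_frame
  refine ⟨fun h => ⟨⟨𝔤.fg, 𝔤.residuallyFinite⟩, fun K _ hK hs => h.2 K ?_ hs⟩,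
    fun H _ hH hrf hs => ?_⟩
  · obtain ⟨𝔨, -⟩ := HasSameFiniteQuotients.exists_latticeFrame 𝔤 hs hK.1 hK.2
    exact 𝔨.isCrystallographicGroup
  · obtain ⟨𝔥, -⟩ := HasSameFiniteQuotients.exists_latticeFrame 𝔤 hs hH hrf
    obtain ⟨α, hα⟩ := hs.exists_orderIso 𝔤 𝔥 hrf
    obtain ⟨β, hβ⟩ := hs.symm.exists_orderIso 𝔥 𝔤 𝔤.residuallyFinite
    obtain ⟨rel, hrel⟩ := hs.exists_rationallyEquivalent 𝔤 𝔥 hrf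
    exact ⟨𝔥.isCrystallographicGroup, ⟨α, hα⟩,
      ⟨TorsionFreeGroup.of_orderIso α hα, TorsionFreeGroup.of_orderIso β hβ⟩,
      ⟨hrel.centreless, hrel.symm.centreless⟩,
      ⟨hrel.justInfinite (𝔤.infinite 𝔥), hrel.symm.justInfinite (𝔥.infinite 𝔤)⟩,
      hs.nonempty_abelianization 𝔤 𝔥 hrf,
      fun Γ Γ' hΓ hΓ' ⟨e⟩ ⟨e'⟩ => hs.realizations hrf hΓ hΓ' e e'⟩

end Conclusion
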